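/- **Setting.** $n$ asynchronous processes share memory. A *normalized* algorithm $N$ accesses shared memory only by Read and CAS, and each of its operations runs a loop of three methods: a *CAS generator*, which takes the input of the operation and emits a list of CASes $(\mathrm{obj},\mathrm{exp},\mathrm{new})$; the *CAS executor*, which executes the list in order until the first failure or the end and returns the number $\mathrm{idx}$ of successful CASes; and a *wrap-up*, which from the list and $\mathrm{idx}$ (and the input) determines the output of the operation or that the loop is to be repeated. Generator and wrap-up are *parallelizable* (Timnat–Petrank): their runs depend only on their input, on shared memory and on the results of their CASes; and if at points where such a method is invoked finitely many additional threads are created that run it on the same input, concurrently and at any speed, then every run by an additional thread is avoidable, i.e. there is an execution with the same high-level history, the same additional threads, and identical up to the creation of this thread, in which every CAS this thread attempts fails or is futile (new value equal to expected value). Moreover CASes are ABA-free (no successful CAS installs a value that the object has, or has had before), and the expected value of every CAS is a value that the object has held; both are meant for all executions, including those with additional threads. In the persistent model, processes may crash at any time, independently and repeatedly. A crash erases the volatile local state of the process; persistent memory remains, and the process restarts from the context designated by its restart pointer. A *capsule boundary* persists the current context and sets the restart pointer to it. A program $A$ is a *$k$-contention-delay simulation* of $B$ if, in crash-free executions, (i)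 each instruction of $B$ (local ones included) is implemented in $A$ by at most $k$ steps, with the same effect: for each execution $E$ of $A$ there is an execution of $B$ with the same high-level history, in which all instructions completed in $E$ occur with the same results and in an order that respects the partial order of their implementations in $E$; and (ii) whenever an operation on a base object experiences contention at least $kC$ in an execution $E$ of $A$, there is an execution $E'$ of $B$, made up of instructions simulated in $E$ in an order respecting their partial order in $E$, in which the corresponding access experiences contention at least $C$. Contention of an operation of a process on an object is the number of responses to other processes on that object (on the primitive objects implementing it) between the end of the previous instruction of the process and the end of the operation. **Theorem.** There is an absolute constant $k$ such that for every $n$ and every such normalized algorithm $N$, the following persistent program, the *persistent normalized simulator* of $N$, has the properties 1–4. It replaces every object by a recoverable CAS object (the cell holds, with the value, the process and sequence number of the CAS that wrote it; the writer is notified in its announcement slot before its value is overwritten); the CASes of generator and wrap-up notify but leave out their own process and sequence number; the CASes of the executor's list carry consecutive sequence numbers; the list is persisted as it is emitted; and an executor that restarts after a crash runs, for each entry, the recovery operation of the object and skips the entry if the announcement shows its sequence number as successful or shows a larger one. 1. *Persistence.* For every execution of the simulator with crashes there is a crash-free execution of $N$ with the same operations, the same results and the same order of invocations and responses. 2. *Constant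 contention delay.* The simulator is a $k$-contention-delay simulation of $N$. 3. *One capsule boundary per iteration.* Apart from the boundaries at the invocation and the response of an operation, capsule boundaries are set only on passing from the generator to the executor, and there exactly one is set in each iteration of the loop (the count of exactly one is for crash-free executions). 4. *Recovery of the executor.* In every execution with crashes, the recovery check of a list entry is positive if and only if the CAS of this entry has already succeeded; whenever the executor (also in a repetition after a crash) returns $\mathrm{idx}$, the CASes of the list that have succeeded so far are exactly the first $\mathrm{idx}$ ones; and no CAS of a list takes effect twice. -/

import Mathlib

namespace PersistentNormalized

/-! ## Concurrent programs over shared memory -/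

/-- One instruction of a process, together with the local state that follows it. `await` receives the
next operation from the client, `loc` is a local instruction, and the other three are the atomic
accesses to a base object. -/
inductive Instr (Obj : Type) (V : Obj → Type) (In S : Type) : Type
  | await (k : In → S)
  | loc (s : S)
  | read (x : Obj) (k : V x → S)
  | write (x : Obj) (v : V x) (s : S)
  | cas (x : Obj) (old new : V x) (k : Bool → S)

/-- The base object that an instruction accesses, if any. -/
def Instr.target {Obj : Type} {V : Obj → Type} {In S : Type} : Instr Obj V In S → Option Obj
  | .await _ => none
  | .loc _ => none
  | .read x _ => some x
  | .write x _ _ => some x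
  | .cas x _ _ _ => some x

open Classical in
/-- `I.Run m m' s'`: executing `I` atomically in memory `m` can lead to memory `m'` and to the local
state `s'`. -/
inductive Instr.Run {Obj : Type} {V : Obj → Type} {In S : Type} :
    Instr Obj V In S → (∀ x, V x) → (∀ x, V x) → S → Prop
  | await (k : In → S) (m : ∀ x, V x) (i : In) : Run (.await k) m m (k i)
  | loc (s : S) (m : ∀ x, V x) : Run (.loc s) m m s
  | read (x : Obj) (k : V x → S) (m : ∀ x, V x) : Run (.read x k) m m (k (m x))
  | write (x : Obj) (v : V x) (s : S) (m : ∀ x, V x) :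
      Run (.write x v s) m (Function.update m x v) s
  | cas_success (x : Obj) (old new : V x) (k : Bool → S) (m : ∀ x, V x) (h : m x = old) :
      Run (.cas x old new k) m (Function.update m x new) (k true)
  | cas_failure (x : Obj) (old new : V x) (k : Bool → S) (m : ∀ x, V x) (h : m x ≠ old) :
      Run (.cas x old new k) m m (k false)

/-- High-level events: invocation of an operation and its response. -/
inductive Event (In Out : Type) : Type
  | inv (i : In)
  | res (o : Out)

/-- A concurrent program for the processes `Fin n`. `event p s` is the high-level event, if any, that
takes place when process `p` executes its instruction in local state `s`. -/
structure Program (n : ℕ) (In Out : Type) where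
  Obj : Type
  Val : Obj → Type
  State : Type
  mem₀ : ∀ x, Val x
  init : Fin n → State
  instr : Fin n → State → Instr Obj Val In State
  event : Fin n → State → Option (Event In Out)

namespace Program

variable {n : ℕ} {In Out : Type}

/-- A step in an execution: the process, the memory just before the step, and the local states of
the process before and after it. -/
structure Step (A : Program n In Out) where
  proc : Fin n
  mem : ∀ x, A.Val x
  pre : A.State
  post : A.State

structure Config (A : Program n In Out) where
  loc : Fin n → A.State
  mem : ∀ x, A.Val x

/-- `A.Exec E c`: `E` is a (finite, crash-free) execution of `A`, listed in the order of time, and it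
ends in configuration `c`. -/
inductive Exec (A : Program n In Out) : List A.Step → A.Config → Prop
  | nil : Exec A [] ⟨A.init, A.mem₀⟩
  | step {E : List A.Step} {c : A.Config} (h : Exec A E c) (p : Fin n) {m' : ∀ x, A.Val x}
      {s' : A.State} (hr : (A.instr p (c.loc p)).Run c.mem m' s') :
      Exec A (E ++ [⟨p, c.mem, c.loc p, s'⟩]) ⟨Function.update c.loc p s', m'⟩

def IsExec (A : Program n In Out) (E : List A.Step) : Prop := ∃ c, A.Exec E c

/-- The high-level history of an execution: which process invoked which operation, and which response
it obtained, in the order of time. -/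
def history (A : Program n In Out) (E : List A.Step) : List (Fin n × Event In Out) :=
  E.filterMap fun e => (A.event e.proc e.pre).map fun v => (e.proc, v)

/-- The base object accessed in a step. -/
def object (A : Program n In Out) (e : A.Step) : Option A.Obj := (A.instr e.proc e.pre).target

end Program

/-! ## Simulations and their delay -/

/-- How the instructions of the original program `B` are implemented in `A`: `orig s` is the local
state of the original process whose next instruction is being implemented when the simulating process
is in state `s`; `start` holds the states in which the implementation of an instruction begins; `base x`
is the base object of `B` that the primitive object `x` serves to implement (`none` if `x` serves
none, being private to a process). -/
structure Implementation {n : ℕ} {In Out : Type} (A B : Program n In Out) where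
  orig : A.State → B.State
  start : Set A.State
  base : A.Obj → Option B.Obj

namespace Implementation

variable {n : ℕ} {In Out : Type} {A B : Program n In Out}

/-- Every program implements itself, instruction by instruction. -/
def refl (B : Program n In Out) : Implementation B B := ⟨id, Set.univ, some⟩

/-- The number of instructions of the original program that the process of step `t` has completed
before step `t`: step `t` belongs to the implementation of its instruction with this number. -/
noncomputable def index (I : Implementation A B) (E : List A.Step) (t : Fin E.length) : ℕ :=
  {u : Fin E.length | u < t ∧ E[u].proc = E[t].proc ∧ E[u].post ∈ I.start}.ncard

/-- Steps `t` and `u` belong to the implementation of the same instruction of the same process. -/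
def SameInstr (I : Implementation A B) (E : List A.Step) (t u : Fin E.length) : Prop :=
  E[t].proc = E[u].proc ∧ I.index E t = I.index E u

/-- Step `t` completes the implementation of an instruction. -/
def Completes (I : Implementation A B) (E : List A.Step) (t : Fin E.length) : Prop :=
  E[t].post ∈ I.start

/-- Step `t` of `E` belongs to the implementation of the instruction that is executed in step `t'` of
the execution `E'` of the original program. -/
def Corr (I : Implementation A B) (E : List A.Step) (E' : List B.Step) (t : Fin E.length)
    (t' : Fin E'.length) : Prop :=
  E[t].proc = E'[t'].proc ∧ I.index E t = (refl B).index E' t'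

/-- `E` maps to the execution `E'` of the original program: `E'` consists of instructions simulated in
`E`, and their order in `E'` respects the partial order of their implementations in `E`: an instruction
whose implementation ends before another one begins comes first. -/
structure MapsTo (I : Implementation A B) (E : List A.Step) (E' : List B.Step) : Prop where
  isExec : B.IsExec E'
  same : ∀ t' : Fin E'.length, ∃ t : Fin E.length, I.Corr E E' t t' ∧ I.orig E[t].pre = E'[t'].pre
  order : ∀ (s t : Fin E.length) (t' : Fin E'.length), I.Completes E s →
    (∀ u : Fin E.length, I.SameInstr E u t → s < u) → I.Corr E E' t t' →
    ∃ s' : Fin E'.length, s' < t' ∧ I.Corr E E' s s'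

/-- `A` is a `k`-computation-delay simulation of `B`: in crash-free executions every instruction is
implemented in at most `k` steps (local steps included), and with the same effect as in an execution
of `B`. -/
structure IsComputationDelay (I : Implementation A B) (k : ℕ) : Prop where
  steps : ∀ E, A.IsExec E → ∀ t : Fin E.length, {u : Fin E.length | I.SameInstr E u t}.ncard ≤ k
  effect : ∀ E, A.IsExec E → ∃ E', I.MapsTo E E' ∧ B.history E' = A.history E ∧
    ∀ t : Fin E.length, I.Completes E t →
      ∃ t' : Fin E'.length, I.Corr E E' t t' ∧ E'[t'].post = I.orig E[t].post

/-- The contention, up to step `t`, experienced on the object `x` of `B` by the operation that step `t`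
belongs to: the number of responses to other processes on (primitive objects of) `x`, where the
operation counts as invoked right after the previous one of the process has ended. -/
noncomputable def contention (I : Implementation A B) (E : List A.Step) (t : Fin E.length)
    (x : B.Obj) : ℕ :=
  {u : Fin E.length | u < t ∧ E[u].proc ≠ E[t].proc ∧ (A.object E[u]).bind I.base = some x ∧
    ∀ v : Fin E.length, u < v → v < t → E[v].proc = E[t].proc → ¬ I.Completes E v}.ncard

/-- `A` is a `k`-contention-delay simulation of `B`. -/
structure IsContentionDelay (I : Implementation A B) (k : ℕ) : Prop extends
    I.IsComputationDelay k where
  contention_le : ∀ E, A.IsExec E → ∀ t : Fin E.length, I.Completes E t →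
    ∀ x, (B.instr E[t].proc (I.orig E[t].pre)).target = some x →
    ∀ C : ℕ, k * C ≤ I.contention E t x →
      ∃ E', I.MapsTo E E' ∧ ∃ t' : Fin E'.length, I.Corr E E' t t' ∧
        C ≤ (refl B).contention E' t' x

end Implementation

/-! ## Persistent programs: the parallel persistent memory model -/

/-- A persistent program. The memory is persistent. After a crash of `p` its volatile local state is
gone, and `p` restarts in the state `restart`, from which it has to reload everything. The object
`restartPtr p` is its restart pointer location. -/
structure PersistentProgram (n : ℕ) (In Out : Type) extends Program n In Out where
  restart : State
  restartPtr : Fin n → Obj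

namespace PersistentProgram

variable {n : ℕ} {In Out : Type}

inductive PStep (A : PersistentProgram n In Out) : Type
  | step (e : A.toProgram.Step)
  | crash (p : Fin n)

/-- `A.PExec E c`: `E` is an execution of `A` in which processes may crash at any time, independently
of each other and any number of times. -/
inductive PExec (A : PersistentProgram n In Out) : List A.PStep → A.toProgram.Config → Prop
  | nil : PExec A [] ⟨A.init, A.mem₀⟩
  | step {E : List A.PStep} {c : A.toProgram.Config} (h : PExec A E c) (p : Fin n)
      {m' : ∀ x, A.Val x} {s' : A.State} (hr : (A.instr p (c.loc p)).Run c.mem m' s') :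
      PExec A (E ++ [.step ⟨p, c.mem, c.loc p, s'⟩]) ⟨Function.update c.loc p s', m'⟩
  | crash {E : List A.PStep} {c : A.toProgram.Config} (h : PExec A E c) (p : Fin n) :
      PExec A (E ++ [.crash p]) ⟨Function.update c.loc p A.restart, c.mem⟩

def IsPExec (A : PersistentProgram n In Out) (E : List A.PStep) : Prop := ∃ c, A.PExec E c

/-- The steps of an execution, crash events removed. -/
def steps (A : PersistentProgram n In Out) (E : List A.PStep) : List A.toProgram.Step :=
  E.filterMap fun e => match e with
    | .step e => some e
    | .crash _ => none

/-- `A` simulates `B` persistently: whatever crashes occur, once the crash events are removed, the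
execution is equivalent to an execution of `B`, with the same operations and results and the same order of
invocations and responses. -/
def Simulates (A : PersistentProgram n In Out) (B : Program n In Out) : Prop :=
  ∀ E, A.IsPExec E → ∃ E', B.IsExec E' ∧ B.history E' = A.toProgram.history (A.steps E)

/-- The step is a capsule boundary: it sets the restart pointer of the process. -/
def IsBoundary (A : PersistentProgram n In Out) (e : A.toProgram.Step) : Prop :=
  ∃ v s', A.instr e.proc e.pre = .write (A.restartPtr e.proc) v s'

end PersistentProgram

/-! ## Normalized data structures -/

/-- A CAS to be executed: object, expected value, new value. -/
structure CasDesc (Obj Val : Type) : Type where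
  obj : Obj
  exp : Val
  new : Val

/-- An instruction of a method. A method accesses shared memory by read and CAS only; `emit d` appends
an item to its output list, and `ret` ends it. -/
inductive MInstr (Obj Val Item Res S : Type) : Type
  | loc (s : S)
  | read (x : Obj) (k : Val → S)
  | cas (x : Obj) (old new : Val) (k : Bool → S)
  | emit (d : Item) (s : S)
  | ret (r : Res)

/-- A method, whose run depends on nothing but its argument, the values it reads from shared memory, and
the results of its CASes. -/
structure Method (Obj Val Arg Item Res : Type) where
  State : Type
  start : Arg → State
  next : State → MInstr Obj Val Item Res State

/-- The data of an algorithm in normalized form. The CAS generator takes the input of the operation and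
emits a list of CASes; the wrap-up takes that list and the index that the CAS executor returned (as well as
the input of the operation) and returns the output of the operation, or `none` if the operation is
to be repeated. The CAS executor is the same for all algorithms. -/
structure NormalizedAlgorithm (Obj Val In Out : Type) where
  mem₀ : Obj → Val
  gen : Method Obj Val In (CasDesc Obj Val) Unit
  wrap : Method Obj Val (In × List (CasDesc Obj Val) × ℕ) Empty (Option Out)

namespace NormalizedAlgorithm

variable {Obj Val In Out : Type}

/-- The local state of a process: no operation is active; operation `i` is about to be invoked; in the
generator, with the list emitted so far; in the executor, about to execute entry `j` of the list `L`;
in the wrap-up called with `(i, L, j)`; about to respond. -/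
inductive LState (N : NormalizedAlgorithm Obj Val In Out) : Type
  | idle
  | called (i : In)
  | gen (i : In) (s : N.gen.State) (L : List (CasDesc Obj Val))
  | exec (i : In) (L : List (CasDesc Obj Val)) (j : ℕ)
  | wrap (i : In) (L : List (CasDesc Obj Val)) (j : ℕ) (s : N.wrap.State)
  | resp (o : Out)

def callGen (N : NormalizedAlgorithm Obj Val In Out) (i : In) : N.LState := .gen i (N.gen.start i) []

def callWrap (N : NormalizedAlgorithm Obj Val In Out) (i : In) (L : List (CasDesc Obj Val)) (j : ℕ) :
    N.LState :=
  .wrap i L j (N.wrap.start (i, L, j))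

/-- The code of an operation: generator, executor and wrap-up in a loop. The executor executes the list
in order until the first failure or the end of the list, and returns the number of
CASes that were successful. -/
def instr (N : NormalizedAlgorithm Obj Val In Out) :
    N.LState → Instr Obj (fun _ => Val) In N.LState
  | .idle => .await fun i => .called i
  | .called i => .loc (N.callGen i)
  | .gen i s L => match N.gen.next s with
    | .loc s' => .loc (.gen i s' L)
    | .read x k => .read x fun v => .gen i (k v) L
    | .cas x old new k => .cas x old new fun b => .gen i (k b) L
    | .emit d s' => .loc (.gen i s' (L ++ [d]))
    | .ret _ => .loc (.exec i L 0)
  | .exec i L j => match L[j]? with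
    | some d => .cas d.obj d.exp d.new fun b => if b then .exec i L (j + 1) else N.callWrap i L j
    | none => .loc (N.callWrap i L j)
  | .wrap i L j s => match N.wrap.next s with
    | .loc s' => .loc (.wrap i L j s')
    | .read x k => .read x fun v => .wrap i L j (k v)
    | .cas x old new k => .cas x old new fun b => .wrap i L j (k b)
    | .emit d _ => d.elim
    | .ret none => .loc (N.callGen i)
    | .ret (some o) => .loc (.resp o)
  | .resp _ => .loc .idle

def event (N : NormalizedAlgorithm Obj Val In Out) : N.LState → Option (Event In Out)
  | .called i => some (.inv i)
  | .resp o => some (.res o)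
  | _ => none

/-- The concurrent program in which `n` processes execute operations of the data structure. -/
def program (N : NormalizedAlgorithm Obj Val In Out) (n : ℕ) : Program n In Out where
  Obj := Obj
  Val := fun _ => Val
  State := N.LState
  mem₀ := N.mem₀
  init := fun _ => .idle
  instr := fun _ => N.instr
  event := fun _ => N.event

/-! ### Executions with additional threads -/

/-- The process is at the point where the generator or the wrap-up is invoked. -/
def AtCall (N : NormalizedAlgorithm Obj Val In Out) (s : N.LState) : Prop :=
  (∃ i, s = N.callGen i) ∨ ∃ i L j, s = N.callWrap i L j

/-- The state belongs to a run of the generator or of the wrap-up that has not come to its end. -/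
def InMethod (N : NormalizedAlgorithm Obj Val In Out) : N.LState → Prop
  | .gen _ s _ => ∀ r, N.gen.next s ≠ .ret r
  | .wrap _ _ _ s => ∀ r, N.wrap.next s ≠ .ret r
  | _ => False

/-- `main` is a step of a process, `spawn p s` creates an additional thread at the point where process
`p` invokes a method (which method, and with what arguments, is recorded in `s`), and `thread h` is a step of
the additional thread with number `h`. -/
inductive XStep (N : NormalizedAlgorithm Obj Val In Out) (n : ℕ) : Type
  | main (e : (N.program n).Step)
  | spawn (p : Fin n) (s : N.LState)
  | thread (h : ℕ) (mem : Obj → Val) (pre post : N.LState)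

structure XConfig (N : NormalizedAlgorithm Obj Val In Out) (n : ℕ) where
  loc : Fin n → N.LState
  mem : Obj → Val
  threads : List N.LState

/-- Executions in which any finite number of additional threads is created at the points where
methods are invoked. Each additional thread runs that method on the same input, concurrently with all others, and
at any speed. -/
inductive XExec (N : NormalizedAlgorithm Obj Val In Out) (n : ℕ) :
    List (N.XStep n) → N.XConfig n → Prop
  | nil : XExec N n [] ⟨fun _ => .idle, N.mem₀, []⟩
  | main {E : List (N.XStep n)} {c : N.XConfig n} (h : XExec N n E c) (p : Fin n) {m' : Obj → Val}
      {s' : N.LState} (hr : (N.instr (c.loc p)).Run c.mem m' s') :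
      XExec N n (E ++ [.main ⟨p, c.mem, c.loc p, s'⟩]) ⟨Function.update c.loc p s', m', c.threads⟩
  | spawn {E : List (N.XStep n)} {c : N.XConfig n} (h : XExec N n E c) (p : Fin n)
      (hp : N.AtCall (c.loc p)) :
      XExec N n (E ++ [.spawn p (c.loc p)]) ⟨c.loc, c.mem, c.threads ++ [c.loc p]⟩
  | thread {E : List (N.XStep n)} {c : N.XConfig n} (h : XExec N n E c) (a : ℕ) {s : N.LState}
      (ha : c.threads[a]? = some s) (hs : N.InMethod s) {m' : Obj → Val} {s' : N.LState}
      (hr : (N.instr s).Run c.mem m' s') :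
      XExec N n (E ++ [.thread a c.mem s s']) ⟨c.loc, m', c.threads.set a s'⟩

/-- The high-level history, to which additional threads do not contribute. -/
def xhistory (N : NormalizedAlgorithm Obj Val In Out) (n : ℕ) (E : List (N.XStep n)) :
    List (Fin n × Event In Out) :=
  E.filterMap fun e => match e with
    | .main e => (N.event e.pre).map fun v => (e.proc, v)
    | _ => none

/-- The additional threads that are created in `E`, in the order of their numbers. -/
def spawns (N : NormalizedAlgorithm Obj Val In Out) (n : ℕ) (E : List (N.XStep n)) :
    List (Fin n × N.LState) :=
  E.filterMap fun e => match e with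
    | .spawn p s => some (p, s)
    | _ => none

/-- Generator and wrap-up are parallelizable: every run of them by an additional thread is avoidable. That is,
for every execution `E₀ ++ .spawn p s :: E₁` there is an equivalent execution that is identical up to the creation
of this thread, has the same additional threads, and in which each CAS that this
thread attempts fails or is futile (its new value being the expected one). -/
def Parallelizable (N : NormalizedAlgorithm Obj Val In Out) (n : ℕ) : Prop :=
  ∀ (E₀ E₁ : List (N.XStep n)) (p : Fin n) (s : N.LState) (c : N.XConfig n),
    N.XExec n (E₀ ++ .spawn p s :: E₁) c →
    ∃ (E₂ : List (N.XStep n)) (c' : N.XConfig n),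
      N.XExec n (E₀ ++ .spawn p s :: E₂) c' ∧
      N.xhistory n (E₀ ++ .spawn p s :: E₂) = N.xhistory n (E₀ ++ .spawn p s :: E₁) ∧
      N.spawns n E₂ = N.spawns n E₁ ∧
      ∀ m s₁ s₂, XStep.thread (N.spawns n E₀).length m s₁ s₂ ∈ E₂ →
        ∀ x old new k, N.instr s₁ = .cas x old new k → m x ≠ old ∨ new = old

/-- In the execution `E` that ends in `c`, object `x` has the value `v` at the end or had it before. -/
def Held (N : NormalizedAlgorithm Obj Val In Out) {n : ℕ} (E : List (N.XStep n)) (c : N.XConfig n)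
    (x : Obj) (v : Val) : Prop :=
  c.mem x = v ∨ (∃ e, XStep.main e ∈ E ∧ e.mem x = v) ∨
    ∃ h m s s', XStep.thread h m s s' ∈ E ∧ m x = v

/-- A process or an additional thread is about to execute `CAS(x, old, new)`. -/
def Poised (N : NormalizedAlgorithm Obj Val In Out) {n : ℕ} (c : N.XConfig n)
    (x : Obj) (old new : Val) : Prop :=
  (∃ p k, N.instr (c.loc p) = .cas x old new k) ∨
    ∃ s k, s ∈ c.threads ∧ N.instr s = .cas x old new k

/-- CASes are ABA-free: no object ever takes on a value again that it has held. -/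
def ABAFree (N : NormalizedAlgorithm Obj Val In Out) (n : ℕ) : Prop :=
  ∀ E c, N.XExec n E c → ∀ x old new, N.Poised c x old new → c.mem x = old → ¬ N.Held E c x new

/-- The expected value of each CAS is a value that the object has held. -/
def ExpectsHeld (N : NormalizedAlgorithm Obj Val In Out) (n : ℕ) : Prop :=
  ∀ E c, N.XExec n E c → ∀ x old new, N.Poised c x old new → N.Held E c x old

/-! ## The persistent normalized simulator -/

/-- The objects of the simulator, all of them persistent. Every object `x` of the data structure becomes a
recoverable CAS object, which consists of `cell x` and of one announcement `ann x p` for each process; the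
other objects are private to process `p`: `heap p s` stores the list entry with
sequence number `s`, `slot p false` and `slot p true` are the two copies of its context, and `ptr p` is
its restart pointer, which tells which copy is valid. -/
inductive SObj (n : ℕ) (Obj : Type) : Type
  | cell (x : Obj)
  | ann (x : Obj) (p : Fin n)
  | heap (p : Fin n) (s : ℕ)
  | slot (p : Fin n) (b : Bool)
  | ptr (p : Fin n)

/-- Where to restart: outside of operations (with the result of the last one, if any), at the start of
an operation, or at the executor, with a list of the given length. -/
inductive Pc (In Out : Type) : Type
  | idle (last : Option Out)
  | gen (i : In)
  | exec (i : In) (len : ℕ)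

/-- The context persisted at a capsule boundary: program counter (with the variables in use) and
sequence number. -/
structure Ctx (In Out : Type) : Type where
  pc : Pc In Out
  seq : ℕ

/-- A cell of a recoverable CAS object holds the value and the process and sequence number of the CAS that wrote
it; the CASes of generator and wrap-up, and the initial value, leave the latter out. -/
abbrev Cell (n : ℕ) (Val : Type) : Type := Val × Option (Fin n × ℕ)

abbrev SVal (n : ℕ) (Obj Val In Out : Type) : SObj n Obj → Type
  | .cell _ => Cell n Val
  | .ann _ _ => ℕ × Bool
  | .heap _ _ => Option (CasDesc Obj Val)
  | .slot _ _ => Ctx In Out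
  | .ptr _ => Bool

/-- The volatile variables of a process: which copy of the context is valid, the sequence number for the first
entry of the list under construction or execution, the state of the simulated process, and
whether the executor is recovering from a crash. -/
structure Frame (N : NormalizedAlgorithm Obj Val In Out) : Type where
  valid : Bool
  seq : ℕ
  st : N.LState
  recovering : Bool

/-- Move on in the simulated code; when the executor is left for the wrap-up, the sequence numbers of the
list are used up. -/
def Frame.goto {N : NormalizedAlgorithm Obj Val In Out} (f : N.Frame) (s' : N.LState) : N.Frame :=
  match f.st, s' with
  | .exec _ L _, .wrap _ _ _ _ => ⟨f.valid, f.seq + L.length, s', false⟩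
  | _, _ => { f with st := s' }

/-- The sequence number of the current CAS, for a CAS of the executor. -/
def Frame.casSeq {N : NormalizedAlgorithm Obj Val In Out} (f : N.Frame) : Option ℕ :=
  match f.st with
  | .exec _ _ j => some (f.seq + j)
  | _ => none

/-- The simulated code after its current CAS has returned `b`. -/
def Frame.afterCas {N : NormalizedAlgorithm Obj Val In Out} (f : N.Frame) (b : Bool) : N.Frame :=
  match N.instr f.st with
  | .cas _ _ _ k => f.goto (k b)
  | _ => f

/-- The context to be persisted, at the points of the code that have a capsule boundary: before and after an
operation, and between generator and executor. -/
def Frame.boundary {N : NormalizedAlgorithm Obj Val In Out} (f : N.Frame) : Option (Ctx In Out) :=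
  match f.st with
  | .called i => some ⟨.gen i, f.seq⟩
  | .gen i s L => match N.gen.next s with
    | .ret _ => some ⟨.exec i L.length, f.seq⟩
    | _ => none
  | .resp o => some ⟨.idle (some o), f.seq⟩
  | _ => none

/-- The list entry that is emitted by the current instruction, with its sequence number. -/
def Frame.emitted {N : NormalizedAlgorithm Obj Val In Out} (f : N.Frame) :
    Option (ℕ × CasDesc Obj Val) :=
  match f.st with
  | .gen _ s L => match N.gen.next s with
    | .emit d _ => some (f.seq + L.length, d)
    | _ => none
  | _ => none

/-- Control states of the simulator. `restart`, `load` and `reload` read the context and the list after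
a crash; `run f` begins the next instruction; `commit` is the second half of a capsule boundary, its first half
having written the context into the copy that is not valid; `tryCas`, `notify`, `announce`, `swap` make up a
recoverable CAS, and `checkNotify`, `checkRead` the recovery operation. -/
inductive SState (N : NormalizedAlgorithm Obj Val In Out) (n : ℕ) : Type
  | restart
  | load (b : Bool)
  | reload (b : Bool) (seq : ℕ) (i : In) (len : ℕ) (L : List (CasDesc Obj Val))
  | run (f : N.Frame)
  | commit (f : N.Frame)
  | tryCas (f : N.Frame) (d : CasDesc Obj Val)
  | notify (f : N.Frame) (d : CasDesc Obj Val) (y : Cell n Val) (q : Fin n) (s : ℕ)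
  | announce (f : N.Frame) (d : CasDesc Obj Val) (y : Cell n Val)
  | swap (f : N.Frame) (d : CasDesc Obj Val) (y : Cell n Val)
  | checkNotify (f : N.Frame) (d : CasDesc Obj Val) (q : Fin n) (s : ℕ)
  | checkRead (f : N.Frame) (d : CasDesc Obj Val)

abbrev SInstr (N : NormalizedAlgorithm Obj Val In Out) (n : ℕ) : Type :=
  Instr (SObj n Obj) (SVal n Obj Val In Out) In (N.SState n)

/-- After the notification: a CAS of the executor is announced, a CAS of generator or wrap-up is not. -/
def afterNotify (N : NormalizedAlgorithm Obj Val In Out) {n : ℕ} (f : N.Frame)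
    (d : CasDesc Obj Val) (y : Cell n Val) : N.SState n :=
  match f.casSeq with
  | some _ => .announce f d y
  | none => .swap f d y

open Classical in
/-- First step of a recoverable CAS: read the cell; return `false` if it does not have the expected value, and
otherwise notify the process that wrote it. -/
noncomputable def rcas (N : NormalizedAlgorithm Obj Val In Out) {n : ℕ} (f : N.Frame)
    (d : CasDesc Obj Val) : N.SInstr n :=
  .read (.cell d.obj) fun y =>
    if y.1 = d.exp then
      match y.2 with
      | some (q, s) => .notify f d y q s
      | none => N.afterNotify f d y
    else .run (f.afterCas false)

/-- First step of the recovery operation. -/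
def recover (N : NormalizedAlgorithm Obj Val In Out) {n : ℕ} (f : N.Frame)
    (d : CasDesc Obj Val) : N.SInstr n :=
  .read (.cell d.obj) fun y =>
    match y.2 with
    | some (q, s) => .checkNotify f d q s
    | none => .checkRead f d

/-- The CAS with sequence number `s` is known to have succeeded if it was announced and flagged, or if a
later CAS of the list was announced after it. -/
def succeeded (a : ℕ × Bool) (s : ℕ) : Bool := decide (s < a.1) || (decide (a.1 = s) && a.2)

/-- The code of the simulator. -/
noncomputable def sinstr (N : NormalizedAlgorithm Obj Val In Out) {n : ℕ} (p : Fin n) :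
    N.SState n → N.SInstr n
  | .restart => .read (.ptr p) fun b => .load b
  | .load b => .read (.slot p b) fun c => match c.pc with
    | .idle _ => .run ⟨b, c.seq, .idle, false⟩
    | .gen i => .run ⟨b, c.seq, N.callGen i, false⟩
    | .exec i len => .reload b c.seq i len []
  | .reload b seq i len L =>
    if L.length < len then
      .read (.heap p (seq + L.length)) fun d => match d with
        | some d => .reload b seq i len (L ++ [d])
        | none => .restart
    else .loc (.run ⟨b, seq, .exec i L 0, true⟩)
  | .run f => match N.instr f.st with
    | .await k => .await fun i => .run (f.goto (k i))
    | .read x k => .read (.cell x) fun y => .run (f.goto (k y.1))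
    | .write _ _ s' => .loc (.run (f.goto s'))
    | .cas x old new _ => if f.recovering then N.recover f ⟨x, old, new⟩ else N.rcas f ⟨x, old, new⟩
    | .loc s' => match f.boundary, f.emitted with
      | some c, _ => .write (.slot p (!f.valid)) c (.commit f)
      | none, some (s, d) => .write (.heap p s) (some d) (.run (f.goto s'))
      | none, none => .loc (.run (f.goto s'))
  | .commit f => match N.instr f.st with
    | .loc s' => .write (.ptr p) (!f.valid) (.run { f.goto s' with valid := !f.valid })
    | _ => .loc (.commit f)
  | .tryCas f d => N.rcas f d
  | .notify f d y q s => .cas (.ann d.obj q) (s, false) (s, true) fun _ => N.afterNotify f d y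
  | .announce f d y => match f.casSeq with
    | some s => .write (.ann d.obj p) (s, false) (.swap f d y)
    | none => .loc (.swap f d y)
  | .swap f d y =>
    .cas (.cell d.obj) y (d.new, f.casSeq.map fun s => (p, s)) fun b => .run (f.afterCas b)
  | .checkNotify f d q s => .cas (.ann d.obj q) (s, false) (s, true) fun _ => .checkRead f d
  | .checkRead f d => .read (.ann d.obj p) fun a =>
    if (f.casSeq.map (succeeded a)).getD false then .run (f.afterCas true) else .tryCas f d

/-- The variables of the process, except while it reloads them after a crash. -/
def SState.frame? {N : NormalizedAlgorithm Obj Val In Out} {n : ℕ} : N.SState n → Option N.Frame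
  | .restart => none
  | .load _ => none
  | .reload _ _ _ _ _ => none
  | .run f => some f
  | .commit f => some f
  | .tryCas f _ => some f
  | .notify f _ _ _ _ => some f
  | .announce f _ _ => some f
  | .swap f _ _ => some f
  | .checkNotify f _ _ _ => some f
  | .checkRead f _ => some f

/-- The persistent normalized simulator. Invocation and response of an operation take effect with the capsule
boundary before and after it. -/
noncomputable def simulator (N : NormalizedAlgorithm Obj Val In Out) (n : ℕ) :
    PersistentProgram n In Out where
  Obj := SObj n Obj
  Val := SVal n Obj Val In Out
  State := N.SState n
  mem₀ := fun x => match x with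
    | .cell x => (N.mem₀ x, none)
    | .ann _ _ => (0, false)
    | .heap _ _ => none
    | .slot _ _ => ⟨.idle none, 1⟩
    | .ptr _ => false
  init := fun _ => .run ⟨false, 1, .idle, false⟩
  instr := fun p => N.sinstr p
  event := fun _ s => match s with
    | .commit f => N.event f.st
    | _ => none
  restart := .restart
  restartPtr := fun p => .ptr p

/-- The simulator implements the program of the data structure instruction by instruction. -/
noncomputable def impl (N : NormalizedAlgorithm Obj Val In Out) (n : ℕ) :
    Implementation (N.simulator n).toProgram (N.program n) where
  orig := fun s => (SState.frame? (N := N) (n := n) s).elim LState.idle Frame.st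
  start := {s | ∃ f, s = SState.run f}
  base := fun x => match x with
    | SObj.cell x => some x
    | SObj.ann x _ => some x
    | _ => none

/-! ### Boundaries and recovery of the simulator -/

/-- The process is about to pass from the generator to the executor. This happens once in each iteration
of the main loop of an operation. -/
def BeforeExecutor (N : NormalizedAlgorithm Obj Val In Out) (s : N.LState) : Prop :=
  ∃ i L, N.instr s = .loc (.exec i L 0)

/-- Capsule boundaries are where they should be: whether or not there are crashes, a boundary is set only
at the invocation or the response of an operation, or on passing from generator to executor;
and in crash-free executions each of these instructions is implemented with exactly one boundary. -/
structure BoundariesAtExecutor (N : NormalizedAlgorithm Obj Val In Out) (n : ℕ) : Prop where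
  only : ∀ E, (N.simulator n).IsPExec E → ∀ e, .step e ∈ E → (N.simulator n).IsBoundary e →
    (N.event ((N.impl n).orig e.pre)).isSome ∨ N.BeforeExecutor ((N.impl n).orig e.pre)
  one : ∀ E, (N.simulator n).toProgram.IsExec E → ∀ t : Fin E.length, (N.impl n).Completes E t →
    ((N.event ((N.impl n).orig E[t].pre)).isSome ∨ N.BeforeExecutor ((N.impl n).orig E[t].pre)) →
    {u : Fin E.length | (N.impl n).SameInstr E u t ∧ (N.simulator n).IsBoundary E[u]}.ncard = 1

/-- The step is a successful CAS on a cell by which process `p` writes sequence number `s` into it. -/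
def CasDone (N : NormalizedAlgorithm Obj Val In Out) {n : ℕ} (p : Fin n) (s : ℕ)
    (e : (N.simulator n).PStep) : Prop :=
  ∃ (m : ∀ x, SVal n Obj Val In Out x) (pre post : N.SState n) (x : Obj) (y : Cell n Val) (v : Val)
    (k : Bool → N.SState n),
    e = .step ⟨p, m, pre, post⟩ ∧ N.sinstr p pre = .cas (.cell x) y (v, some (p, s)) k ∧
      m (.cell x) = y

/-- The executor recovers its position by means of the sequence numbers, in every execution with crashes. -/
structure ExecutorRecovers (N : NormalizedAlgorithm Obj Val In Out) (n : ℕ) : Prop where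
  /-- The check of an entry after a crash tells whether its CAS has succeeded. -/
  check : ∀ (E₀ E₁ : List (N.simulator n).PStep) (p : Fin n) (m : ∀ x, SVal n Obj Val In Out x)
    (f : N.Frame) (d : CasDesc Obj Val) (post : N.SState n) (i : In) (L : List (CasDesc Obj Val))
    (j : ℕ),
    (N.simulator n).IsPExec (E₀ ++ .step ⟨p, m, .checkRead f d, post⟩ :: E₁) →
    f.st = .exec i L j →
    (post = .run (f.goto (.exec i L (j + 1))) ↔ ∃ e ∈ E₀, N.CasDone p (f.seq + j) e)
  /-- Whenever the executor returns an index to the wrap-up, also in a repetition after a crash, the CASes of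
  the list that have succeeded so far are those before this index. -/
  position : ∀ (E₀ E₁ : List (N.simulator n).PStep) (p : Fin n) (m : ∀ x, SVal n Obj Val In Out x)
    (pre post : N.SState n) (f f' : N.Frame) (i : In) (L : List (CasDesc Obj Val)) (j r : ℕ),
    (N.simulator n).IsPExec (E₀ ++ .step ⟨p, m, pre, post⟩ :: E₁) →
    pre.frame? = some f → f.st = .exec i L j → post = .run f' → f'.st = N.callWrap i L r →
    r ≤ L.length ∧ ∀ a < L.length, (∃ e ∈ E₀, N.CasDone p (f.seq + a) e) ↔ a < r
  /-- No CAS of a list takes effect twice. -/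
  once : ∀ (E₀ E₁ E₂ : List (N.simulator n).PStep) (e e' : (N.simulator n).PStep) (p : Fin n) (s : ℕ),
    (N.simulator n).IsPExec (E₀ ++ e :: E₁ ++ e' :: E₂) → N.CasDone p s e → ¬ N.CasDone p s e'

end NormalizedAlgorithm

end PersistentNormalized

/-! The simulator departs from `N` in two respects, which are treated separately: a crash throws a
process back to its last capsule boundary, and one instruction of `N` takes several steps.

Crashes. A crash in the generator or the wrap-up erases the local progress of a run whose CASes have
already acted on the shared memory. `VExec` models this on the level of `N`: each process has a
current state and a permanent one, to which crashes return it. A lost run is just what an additional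
thread would do while the process itself waits at the call, so `VExec.exists_xexec` turns such
executions into executions with additional threads and the same history. Parallelizability removes
these threads one at a time, the last one created first (`XExec.exists_spawns_eq_nil`). The same
translation makes ABA-freedom and the condition on expected values available for `VExec`.

The executor. It must not be repeated blindly, so in `VExec` each of its steps is permanent, and the
simulator has to reconstruct its position. The invariant `Inv` couples the simulator with a `VExec`,
using as ghost data the set `H x` of all contents that the cell of `x` has had. A tag (process and
sequence number) that was ever in a cell is either still there or recorded in the announcement of
its owner, because a writer is notified before its value is overwritten. Hence recovery finds
exactly the entries that have succeeded. If the executor had already stopped at a failed CAS, that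
CAS fails again when repeated: its expected value was held, is gone, and by ABA-freedom does not
return (`VExec.stopped`). Preservation of the invariant is `Inv.step`; properties 1 and 4, and the
position of the boundaries, are read off from it.

Delay. Without crashes, the values of the cells change only in the step that completes an
instruction, so the completing steps form an execution of `N` (`exec_plain`). A rank that grows
along an instruction bounds its length by 4. For contention, the instructions completed before the
step in question are followed by the pending accesses to the same object, that of the step itself
last; since each instruction accounts for at most 4 responses, at least a quarter of the contention
remains (`contention_le`). -/

namespace PersistentNormalized

namespace NormalizedAlgorithm

variable {Obj Val In Out : Type}

/-! ## Executions with volatile progress -/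

/-- The instruction to be executed in this state makes all progress of the process permanent. -/
def Commits (N : NormalizedAlgorithm Obj Val In Out) : N.LState → Prop
  | .called _ => True
  | .gen _ s _ => ∃ r, N.gen.next s = .ret r
  | .exec _ _ _ => True
  | .resp _ => True
  | _ => False

/-- `cur p` is the state of process `p`, and `com p` the state to which a crash takes it back. -/
structure VConfig (N : NormalizedAlgorithm Obj Val In Out) (n : ℕ) where
  cur : Fin n → N.LState
  com : Fin n → N.LState
  mem : Obj → Val

open Classical in
/-- Executions of the data structure in which a crash of a process discards its volatile progress. The
indices are the high-level history, the values that each object has held, and the final configuration. -/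
inductive VExec (N : NormalizedAlgorithm Obj Val In Out) (n : ℕ) :
    List (Fin n × Event In Out) → (Obj → Set Val) → N.VConfig n → Prop
  | nil : VExec N n [] (fun x => {N.mem₀ x}) ⟨fun _ => .idle, fun _ => .idle, N.mem₀⟩
  | step {h : List (Fin n × Event In Out)} {H : Obj → Set Val} {c : N.VConfig n}
      (hE : VExec N n h H c) (p : Fin n) {m' : Obj → Val} {s' : N.LState}
      (hr : (N.instr (c.cur p)).Run c.mem m' s') :
      VExec N n (h ++ ((N.event (c.cur p)).map fun v => (p, v)).toList)
        (fun x => insert (m' x) (H x))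
        ⟨Function.update c.cur p s',
          if N.Commits (c.cur p) then Function.update c.com p s' else c.com, m'⟩
  | crash {h : List (Fin n × Event In Out)} {H : Obj → Set Val} {c : N.VConfig n}
      (hE : VExec N n h H c) (p : Fin n) :
      VExec N n h H ⟨Function.update c.cur p (c.com p), c.com, c.mem⟩

/-- The shapes of the permanent and the current state of a process. -/
inductive Tentative (N : NormalizedAlgorithm Obj Val In Out) : N.LState → N.LState → Prop
  | idle : Tentative N .idle .idle
  | called (i : In) : Tentative N .idle (.called i)
  | gen (i : In) (s : N.gen.State) (L : List (CasDesc Obj Val)) :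
      Tentative N (N.callGen i) (.gen i s L)
  | exec (i : In) (L : List (CasDesc Obj Val)) (j : ℕ) (hj : j ≤ L.length) :
      Tentative N (.exec i L j) (.exec i L j)
  | wrap (i : In) (L : List (CasDesc Obj Val)) (j : ℕ) (hj : j ≤ L.length) (s : N.wrap.State) :
      Tentative N (N.callWrap i L j) (.wrap i L j s)
  -- The wrap-up has asked for a repetition. No boundary is set before the next generator run, so a
  -- crash in it leads back to the wrap-up of the previous iteration.
  | again (i : In) (L : List (CasDesc Obj Val)) (j : ℕ) (hj : j ≤ L.length) (s : N.gen.State)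
      (L' : List (CasDesc Obj Val)) : Tentative N (N.callWrap i L j) (.gen i s L')
  | resp (i : In) (L : List (CasDesc Obj Val)) (j : ℕ) (hj : j ≤ L.length) (o : Out) :
      Tentative N (N.callWrap i L j) (.resp o)

theorem Tentative.refl_left {N : NormalizedAlgorithm Obj Val In Out} {s t : N.LState}
    (h : N.Tentative s t) : N.Tentative s s := by
  cases h
  · exact .idle
  · exact .idle
  · exact .gen _ _ _
  · exact .exec _ _ _ ‹_›
  · exact .wrap _ _ _ ‹_› _
  · exact .wrap _ _ _ ‹_› _
  · exact .wrap _ _ _ ‹_› _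

open Classical in
theorem Tentative.step {N : NormalizedAlgorithm Obj Val In Out} {s t t' : N.LState}
    (h : N.Tentative s t) {m m' : Obj → Val} (hr : (N.instr t).Run m m' t') :
    N.Tentative (if N.Commits t then t' else s) t' := by
  cases h with
  | idle => cases hr; simpa [Commits] using .called _
  | called i => cases hr; simpa [Commits] using .gen _ _ _
  | gen i s L =>
    revert hr
    simp only [instr]
    cases hs : N.gen.next s <;> intro hr <;> cases hr <;> simp [Commits, hs] <;> constructor
    simp
  | exec i L j hj =>
    revert hr
    simp only [instr]
    rcases hs : L[j]? with _ | d <;> intro hr <;> cases hr <;> simp [Commits] <;>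
      constructor <;> first | exact hj | (obtain ⟨h, -⟩ := List.getElem?_eq_some_iff.1 hs; omega)
  | wrap i L j hj s =>
    revert hr
    simp only [instr]
    rcases hs : N.wrap.next s with _ | _ | _ | d | (_ | o)
    all_goals first | exact d.elim | skip
    all_goals intro hr; cases hr <;> simp [Commits] <;> constructor <;> exact hj
  | again i L j hj s L' =>
    revert hr
    simp only [instr]
    cases hs : N.gen.next s <;> intro hr <;> cases hr <;> simp [Commits, hs] <;> constructor <;>
      first | exact hj | simp
  | resp i L j hj o => cases hr; simpa [Commits] using .idle

/-- The input of the active operation. -/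
def LState.input? {N : NormalizedAlgorithm Obj Val In Out} : N.LState → Option In
  | .gen i _ _ => some i
  | .exec i _ _ => some i
  | .wrap i _ _ _ => some i
  | _ => none

/-- Progress since the last commit may cross from one iteration of the loop to the next, but never
from one operation in progress to another. -/
theorem Tentative.input_eq {N : NormalizedAlgorithm Obj Val In Out} {s t : N.LState}
    (h : N.Tentative s t) {i : In} (hi : t.input? = some i) : s.input? = some i := by
  cases h <;> simp_all [LState.input?, callGen, callWrap]

theorem VExec.tentative {N : NormalizedAlgorithm Obj Val In Out} {n : ℕ}
    {h : List (Fin n × Event In Out)} {H : Obj → Set Val} {c : N.VConfig n}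
    (hE : N.VExec n h H c) (p : Fin n) : N.Tentative (c.com p) (c.cur p) := by
  induction hE with
  | nil => exact .idle
  | step hE q hr ih =>
    by_cases hpq : p = q
    · subst hpq
      have := ih.step hr
      split_ifs at this ⊢ <;> simpa using this
    · split_ifs <;> simpa [Function.update_of_ne hpq] using ih
  | crash hE q ih =>
    by_cases hpq : p = q
    · subst hpq
      simpa using ih.refl_left
    · simpa [Function.update_of_ne hpq] using ih

/-- Provides an earlier point of the execution at which a generator run on the input `i` could have
been handed to an additional thread. -/
theorem VExec.invoked {N : NormalizedAlgorithm Obj Val In Out} {n : ℕ}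
    {h : List (Fin n × Event In Out)} {H : Obj → Set Val} {c : N.VConfig n}
    (hE : N.VExec n h H c) (p : Fin n) {i : In} (hi : (c.com p).input? = some i) :
    ∃ q, (q, Event.inv i) ∈ h := by
  induction hE with
  | nil => simp [LState.input?] at hi
  | @step h H c hE q m' s' hr ih =>
    have key : (c.com p).input? = some i → ∃ r, (r, Event.inv i) ∈
        h ++ ((N.event (c.cur q)).map fun v => (q, v)).toList := fun hi => by
      obtain ⟨r, hr⟩ := ih hi
      exact ⟨r, List.mem_append_left _ hr⟩
    by_cases hc : N.Commits (c.cur q)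
    · by_cases hpq : p = q
      · subst hpq
        simp only [hc, if_true, Function.update_self] at hi
        have ht := (hE.tentative p).input_eq (i := i)
        have hs := (hE.tentative p).step hr
        cases hcur : c.cur p with
        | called i' =>
          rw [hcur] at hr
          cases hr
          simp only [callGen, LState.input?, Option.some.injEq] at hi
          exact ⟨p, by simp [hi, event]⟩
        | gen i' s L =>
          rw [hcur] at hr
          obtain ⟨r, hs⟩ : ∃ r, N.gen.next s = .ret r := by rwa [hcur] at hc
          simp only [instr, hs] at hr
          cases hr
          rw [← hcur]
          exact key (ht (by simpa [hcur, LState.input?] using hi))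
        | exec i' L j =>
          rw [hcur] at hr
          rw [← hcur]
          refine key (ht ?_)
          simp only [instr] at hr
          rcases hL : L[j]? with _ | d <;> simp only [hL] at hr <;> cases hr <;>
            simpa [hcur, callWrap, LState.input?] using hi
        | resp o => rw [hcur] at hr; cases hr; simp [LState.input?] at hi
        | idle => simp [hcur, Commits] at hc
        | wrap => simp [hcur, Commits] at hc
      · simp only [hc, if_true, Function.update_of_ne hpq] at hi
        exact key hi
    · simp only [hc, if_false] at hi
      exact key hi
  | crash hE q ih => exact ih hi

/-! ### Additional threads for lost progress -/

/-- A run of generator or wrap-up is under way or has just come to its end. -/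
def InRun (N : NormalizedAlgorithm Obj Val In Out) : N.LState → Prop
  | .gen _ _ _ => True
  | .wrap _ _ _ _ => True
  | _ => False

/-- Nothing within a method is permanent except its beginning. So a crash takes a process to a point
where additional threads may be created, or out of the methods altogether. -/
theorem Tentative.atCall {N : NormalizedAlgorithm Obj Val In Out} {s t : N.LState}
    (h : N.Tentative s t) (hs : N.InRun s) : N.AtCall s := by
  cases h
  case idle => exact hs.elim
  case called => exact hs.elim
  case exec => exact hs.elim
  case gen i _ _ => exact .inl ⟨i, rfl⟩
  all_goals exact .inr ⟨_, _, _, rfl⟩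

theorem InMethod.inRun_of_run {N : NormalizedAlgorithm Obj Val In Out} {s s' : N.LState}
    (h : N.InMethod s) {m m' : Obj → Val} (hr : (N.instr s).Run m m' s') : N.InRun s' := by
  cases s with
  | gen i s L =>
    simp only [instr] at hr
    cases hs : N.gen.next s with
    | ret r => exact (h r hs).elim
    | _ => simp only [hs] at hr; cases hr <;> trivial
  | wrap i L j s =>
    simp only [instr] at hr
    cases hs : N.wrap.next s with
    | ret r => exact (h r hs).elim
    | emit d => exact d.elim
    | _ => simp only [hs] at hr; cases hr <;> trivial
  | _ => exact h.elim

theorem InMethod.inRun {N : NormalizedAlgorithm Obj Val In Out} {s : N.LState}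
    (h : N.InMethod s) : N.InRun s := by
  cases s <;> trivial

/-- The uncommitted steps outside a running method are the receipt of an operation and the return of
the wrap-up. Among these only a request for repetition opens a new run, and it is a generator run on
the same input. -/
theorem run_of_not_inMethod {N : NormalizedAlgorithm Obj Val In Out} {s s' : N.LState}
    (hc : ¬ N.Commits s) (h : ¬ N.InMethod s) {m m' : Obj → Val}
    (hr : (N.instr s).Run m m' s') :
    m' = m ∧ (¬ N.InRun s' ∨ ∃ i, s.input? = some i ∧ s' = N.callGen i) := by
  cases s with
  | idle => cases hr; exact ⟨rfl, .inl id⟩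
  | called i => exact (hc trivial).elim
  | gen i s L => exact (h fun r hs => hc ⟨r, hs⟩).elim
  | exec => exact (hc trivial).elim
  | resp => exact (hc trivial).elim
  | wrap i L j s =>
    simp only [instr] at hr
    rcases hs : N.wrap.next s with _ | _ | _ | d | (_ | o)
    case emit => exact d.elim
    case ret.none => simp only [hs] at hr; cases hr; exact ⟨rfl, .inr ⟨i, rfl, rfl⟩⟩
    case ret.some => simp only [hs] at hr; cases hr; exact ⟨rfl, .inl id⟩
    all_goals exact (h fun r hr => by simp [hs] at hr).elim

theorem atCall_of_commits {N : NormalizedAlgorithm Obj Val In Out} {s s' : N.LState}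
    (hc : N.Commits s) {m m' : Obj → Val} (hr : (N.instr s).Run m m' s') (h : N.InRun s') :
    N.AtCall s' := by
  cases s with
  | called i => cases hr; exact .inl ⟨i, rfl⟩
  | gen i s L =>
    obtain ⟨r, hs⟩ := hc
    simp only [instr, hs] at hr
    cases hr
    exact h.elim
  | exec i L j =>
    simp only [instr] at hr
    rcases hL : L[j]? with _ | d <;> simp only [hL] at hr <;> cases hr
    · exact .inr ⟨_, _, _, rfl⟩
    · exact h.elim
    · exact .inr ⟨_, _, _, rfl⟩
  | resp => cases hr; exact h.elim
  | idle => exact hc.elim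
  | wrap => exact hc.elim

theorem event_eq_none {N : NormalizedAlgorithm Obj Val In Out} {s : N.LState}
    (h : ¬ N.Commits s) : N.event s = none := by
  cases s <;> first | rfl | exact (h trivial).elim

theorem xhistory_main (N : NormalizedAlgorithm Obj Val In Out) {n : ℕ} (E : List (N.XStep n))
    (e : (N.program n).Step) :
    N.xhistory n (E ++ [.main e]) =
      N.xhistory n E ++ ((N.event e.pre).map fun v => (e.proc, v)).toList := by
  simp only [xhistory, List.filterMap_append, List.filterMap_cons, List.filterMap_nil]
  cases N.event e.pre <;> rfl

theorem held_main {N : NormalizedAlgorithm Obj Val In Out} {n : ℕ} {E : List (N.XStep n)}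
    {c : N.XConfig n} {p : Fin n} {s' : N.LState} {loc : Fin n → N.LState} {m' : Obj → Val}
    {T : List N.LState} {x : Obj} {v : Val} :
    N.Held (E ++ [.main ⟨p, c.mem, c.loc p, s'⟩]) ⟨loc, m', T⟩ x v ↔ m' x = v ∨ N.Held E c x v := by
  simp only [Held, List.mem_append, List.mem_singleton, XStep.main.injEq, reduceCtorEq, or_false]
  constructor
  · rintro (h | ⟨e, h | rfl, h'⟩ | h)
    exacts [.inl h, .inr (.inr (.inl ⟨e, h, h'⟩)), .inr (.inl h'), .inr (.inr (.inr h))]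
  · rintro (h | h | ⟨e, h, h'⟩ | h)
    exacts [.inl h, .inr (.inl ⟨_, .inr rfl, h⟩), .inr (.inl ⟨e, .inl h, h'⟩), .inr (.inr h)]

theorem held_thread {N : NormalizedAlgorithm Obj Val In Out} {n : ℕ} {E : List (N.XStep n)}
    {c : N.XConfig n} {a : ℕ} {s s' : N.LState} {loc : Fin n → N.LState} {m' : Obj → Val}
    {T : List N.LState} {x : Obj} {v : Val} :
    N.Held (E ++ [.thread a c.mem s s']) ⟨loc, m', T⟩ x v ↔ m' x = v ∨ N.Held E c x v := by
  simp only [Held, List.mem_append, List.mem_singleton, XStep.thread.injEq, reduceCtorEq, or_false]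
  constructor
  · rintro (h | h | ⟨b, m, t, t', h | ⟨-, rfl, -, -⟩, h'⟩)
    exacts [.inl h, .inr (.inr (.inl h)), .inr (.inr (.inr ⟨b, m, t, t', h, h'⟩)), .inr (.inl h')]
  · rintro (h | h | h | ⟨b, m, t, t', h, h'⟩)
    exacts [.inl h, .inr (.inr ⟨_, _, _, _, .inr ⟨rfl, rfl, rfl, rfl⟩, h⟩), .inr (.inl h),
      .inr (.inr ⟨b, m, t, t', .inl h, h'⟩)]

/-- The numbering of the threads plays no role in the construction, which therefore keeps track only
of the multiset of their states. -/
theorem XExec.spawn_all {N : NormalizedAlgorithm Obj Val In Out} {n : ℕ} {E : List (N.XStep n)}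
    {c : N.XConfig n} (hE : N.XExec n E c) (p : Fin n) (U : Multiset N.LState)
    (hU : ∀ u ∈ U, u = c.loc p ∧ N.AtCall u) :
    ∃ E' T, N.XExec n E' ⟨c.loc, c.mem, T⟩ ∧ N.xhistory n E' = N.xhistory n E ∧
      (∀ x v, N.Held E' ⟨c.loc, c.mem, T⟩ x v ↔ N.Held E c x v) ∧
      (T : Multiset N.LState) = c.threads + U := by
  induction U using Multiset.induction with
  | empty => exact ⟨E, c.threads, hE, rfl, fun x v => Iff.rfl, by simp⟩
  | cons u U ih =>
    obtain ⟨E', T, h₁, h₂, h₃, h₄⟩ := ih fun v hv => hU v (Multiset.mem_cons_of_mem hv)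
    obtain ⟨rfl, hp⟩ := hU u (Multiset.mem_cons_self _ _)
    refine ⟨_, _, h₁.spawn p hp, ?_, fun x v => ?_, ?_⟩
    · simpa [xhistory] using h₂
    · rw [← h₃]
      simp [Held]
    · rw [← Multiset.coe_add, h₄, Multiset.coe_singleton, ← Multiset.singleton_add]
      abel

theorem exists_getElem?_of_coe_eq_cons {α : Type*} {l : List α} {a : α} {M : Multiset α}
    (h : (l : Multiset α) = a ::ₘ M) (b : α) :
    ∃ j, l[j]? = some a ∧ (l.set j b : Multiset α) = b ::ₘ M := by
  have ha : a ∈ l := by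
    rw [← Multiset.mem_coe, h]
    exact Multiset.mem_cons_self _ _
  obtain ⟨l₁, l₂, rfl⟩ := List.append_of_mem ha
  have hM : ((l₁ ++ l₂ : List α) : Multiset α) = M := by
    have : a ::ₘ ((l₁ ++ l₂ : List α) : Multiset α) = a ::ₘ M := by
      rw [← h, Multiset.cons_coe]
      exact (Multiset.coe_eq_coe.2 List.perm_middle).symm
    exact (Multiset.cons_inj_right a).1 this
  refine ⟨l₁.length, by simp, ?_⟩
  rw [← hM, Multiset.cons_coe]
  simp

open Classical in
/-- The additional thread for process `p` in state `s`, if the progress of `p` is going to be lost. -/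
noncomputable def lostRun (N : NormalizedAlgorithm Obj Val In Out) {n : ℕ} (D : Set (Fin n))
    (p : Fin n) (s : N.LState) : Multiset N.LState :=
  if p ∈ D ∧ N.InRun s then {s} else 0

theorem sum_lostRun (N : NormalizedAlgorithm Obj Val In Out) {n : ℕ} (D : Set (Fin n)) (p : Fin n)
    (cur : Fin n → N.LState) :
    ∑ q, N.lostRun D q (cur q) =
      N.lostRun D p (cur p) + ∑ q ∈ Finset.univ.erase p, N.lostRun D q (cur q) :=
  (Finset.add_sum_erase _ _ (Finset.mem_univ p)).symm

theorem sum_lostRun_congr (N : NormalizedAlgorithm Obj Val In Out) {n : ℕ} {D D' : Set (Fin n)}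
    {p : Fin n} {cur cur' : Fin n → N.LState} (hD : ∀ q ≠ p, q ∈ D ↔ q ∈ D')
    (hc : ∀ q ≠ p, cur q = cur' q) :
    ∑ q ∈ Finset.univ.erase p, N.lostRun D q (cur q) =
      ∑ q ∈ Finset.univ.erase p, N.lostRun D' q (cur' q) := by
  classical
  refine Finset.sum_congr rfl fun q hq => ?_
  have hq := Finset.ne_of_mem_erase hq
  rw [hc q hq]
  exact if_congr (and_congr_left' (hD q hq)) rfl rfl

open Classical in
/-- Whichever processes `D` are going to lose their volatile progress, and whatever runs `W` of the
generator are to be added to it, there is an execution with additional threads in which the progress of `D` is made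
by additional threads and the members of `W` are additional threads that have not begun to run. -/
theorem VExec.exists_xexec {N : NormalizedAlgorithm Obj Val In Out} {n : ℕ}
    {h : List (Fin n × Event In Out)} {H : Obj → Set Val} {c : N.VConfig n}
    (hE : N.VExec n h H c) (D : Set (Fin n)) (W : Multiset N.LState)
    (hW : ∀ s ∈ W, ∃ i p, s = N.callGen i ∧ (p, Event.inv i) ∈ h) :
    ∃ E T R, N.XExec n E ⟨fun p => if p ∈ D then c.com p else c.cur p, c.mem, T⟩ ∧
      N.xhistory n E = h ∧
      (∀ x v, N.Held E ⟨fun p => if p ∈ D then c.com p else c.cur p, c.mem, T⟩ x v ↔ v ∈ H x) ∧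
      (T : Multiset N.LState) = ∑ p, N.lostRun D p (c.cur p) + W + R := by
  induction hE generalizing D W with
  | nil =>
    obtain rfl : W = 0 := Multiset.eq_zero_of_forall_notMem fun s hs => by
      obtain ⟨i, p, -, hp⟩ := hW s hs
      exact List.not_mem_nil hp
    refine ⟨[], [], 0, by simpa using XExec.nil, rfl, fun x v => ?_, ?_⟩
    · simp [Held, eq_comm]
    · simp [lostRun, InRun]
  | @step h H c hE p m' s' hr ih =>
    by_cases hc : N.Commits (c.cur p)
    · simp only [hc, if_true]
      set h' := h ++ ((N.event (c.cur p)).map fun v => (p, v)).toList with hh'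
      let Q : N.LState → Prop := fun s => ∃ i p, s = N.callGen i ∧ (p, Event.inv i) ∈ h
      -- A committing step saves all that `p` has done, so up to this step `p` has to run by itself.
      -- If `p` belongs to `D`, a thread takes over only after the step.
      obtain ⟨D', hD'⟩ : ∃ D', D' = D \ {p} := ⟨_, rfl⟩
      have hp : p ∉ D' := by simp [hD']
      -- Runs requested for an input invoked earlier are left to the induction hypothesis. For the
      -- others the invocation is this very step, after which `p` stands at the generator call, and
      -- their threads are created there.
      obtain ⟨E, T, R, h₁, h₂, h₃, h₄⟩ := ih D' (W.filter Q)
        fun s hs => (Multiset.mem_filter.1 hs).2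
      have hr' : (N.instr ((fun q => if q ∈ D' then c.com q else c.cur q) p)).Run c.mem m' s' := by
        simpa [hp] using hr
      have h₅ := h₁.main p hr'
      have hloc : Function.update (fun q => if q ∈ D' then c.com q else c.cur q) p s' =
          fun q => if q ∈ D then Function.update c.com p s' q else Function.update c.cur p s' q := by
        funext q
        by_cases hq : q = p
        · subst hq; simp
        · simp [hq, hD']
      obtain ⟨E', T', h₆, h₇, h₈, h₉⟩ := h₅.spawn_all p
        (W.filter (fun s => ¬ Q s) + N.lostRun D p s') (by
          intro u hu
          rcases Multiset.mem_add.1 hu with hu | hu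
          · obtain ⟨hu, hQ⟩ := Multiset.mem_filter.1 hu
            obtain ⟨i, q, rfl, hq⟩ := hW u hu
            have hq' : (q, Event.inv i) ∈ ((N.event (c.cur p)).map fun v => (p, v)).toList :=
              (List.mem_append.1 hq).resolve_left fun hq => hQ ⟨i, q, rfl, hq⟩
            cases hcur : c.cur p <;> simp [hcur, event] at hq'
            rw [hcur] at hr
            cases hr
            obtain ⟨rfl, rfl⟩ := hq'
            exact ⟨by simp, .inl ⟨_, rfl⟩⟩
          · unfold lostRun at hu
            split_ifs at hu with hu'
            · obtain rfl := Multiset.mem_singleton.1 hu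
              exact ⟨by simp, N.atCall_of_commits hc hr hu'.2⟩
            · simp at hu)
      simp only [hloc] at h₆ h₈
      refine ⟨E', T', R, h₆, ?_, fun x v => ?_, ?_⟩
      · rw [h₇, hh', ← h₂, xhistory_main]
        simp only [hp, if_false]
      · rw [h₈]
        refine (held_main (c := ⟨fun q => if q ∈ D' then c.com q else c.cur q, c.mem, T⟩)).trans ?_
        rw [h₃, Set.mem_insert_iff, eq_comm]
      · rw [h₉]
        simp only
        rw [h₄, N.sum_lostRun _ p, N.sum_lostRun D p,
          sum_lostRun_congr (p := p) N (D := D') (D' := D) (cur := c.cur)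
            (cur' := Function.update c.cur p s') (fun q hq => by simp [hq, hD'])
            fun q hq => by simp [Function.update_of_ne hq]]
        conv_rhs => rw [← Multiset.filter_add_not Q W]
        have : N.lostRun D' p (c.cur p) = 0 := by simp [lostRun, hp]
        rw [this, Function.update_self]
        abel
    · simp only [hc, if_false, event_eq_none hc, Option.map_none, Option.toList_none,
        List.append_nil] at hW ⊢
      by_cases hp : p ∈ D
      · have hloc : (fun q => if q ∈ D then c.com q else Function.update c.cur p s' q) =
            fun q => if q ∈ D then c.com q else c.cur q := by
          funext q
          by_cases hq : q = p
          · subst hq; simp [hp]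
          · simp [Function.update_of_ne hq]
        rw [hloc]
        have hrest := sum_lostRun_congr (p := p) N (D := D) (D' := D)
            (cur := Function.update c.cur p s') (cur' := c.cur) (fun q hq => Iff.rfl)
            fun q hq => by simp [Function.update_of_ne hq]
        -- The step of the doomed process `p` is made by its thread, provided that it lies within a
        -- method: threads end with their method.
        by_cases hm : N.InMethod (c.cur p)
        · obtain ⟨E, T, R, h₁, h₂, h₃, h₄⟩ := ih D W hW
          have hT : (T : Multiset N.LState) = c.cur p ::ₘ
              (∑ q ∈ Finset.univ.erase p, N.lostRun D q (c.cur q) + W + R) := by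
            rw [h₄, N.sum_lostRun D p, lostRun, if_pos ⟨hp, hm.inRun⟩, ← Multiset.singleton_add]
            abel
          obtain ⟨a, ha, ha'⟩ := exists_getElem?_of_coe_eq_cons hT s'
          refine ⟨_, _, R, h₁.thread a ha hm hr, ?_, fun x v => ?_, ?_⟩
          · simpa [xhistory] using h₂
          · rw [held_thread (c := ⟨_, _, _⟩), h₃, Set.mem_insert_iff, eq_comm]
          · simp only
            rw [ha', N.sum_lostRun D p, hrest, Function.update_self, lostRun,
              if_pos ⟨hp, hm.inRun_of_run hr⟩, ← Multiset.singleton_add]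
            abel
        · obtain ⟨rfl, hs'⟩ := N.run_of_not_inMethod hc hm hr
          have hH : ∀ x, c.mem x ∈ H x := fun x => by
            obtain ⟨E, T, R, h₁, h₂, h₃, h₄⟩ := ih ∅ 0 (by simp)
            exact (h₃ x _).1 (.inl rfl)
          rcases hs' with hs' | ⟨i, hi, rfl⟩
          -- No new run begins and the memory is unchanged, so no step is added. A thread that has
          -- come to its end is discarded into `R`.
          · obtain ⟨E, T, R, h₁, h₂, h₃, h₄⟩ := ih D W hW
            refine ⟨E, T, N.lostRun D p (c.cur p) + R, h₁, h₂, fun x v => ?_, ?_⟩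
            · rw [h₃, Set.insert_eq_of_mem (hH x)]
            · rw [h₄, N.sum_lostRun D p, N.sum_lostRun D p, hrest, Function.update_self,
                lostRun.eq_1 _ _ _ s', if_neg fun h => hs' h.2]
              abel
          -- A lost wrap-up asks for repetition. In the constructed execution `p` never gets to this
          -- generator call, so no thread can be created here. Instead a fresh thread is requested
          -- through `W`: it was created at an earlier invocation of the input `i`, by whatever
          -- process, and has waited since.
          · obtain ⟨q, hq⟩ := hE.invoked p ((hE.tentative p).input_eq hi)
            obtain ⟨E, T, R, h₁, h₂, h₃, h₄⟩ := ih D (W + {N.callGen i}) fun s hs => by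
              rcases Multiset.mem_add.1 hs with hs | hs
              · exact hW s hs
              · exact ⟨i, q, Multiset.mem_singleton.1 hs, hq⟩
            refine ⟨E, T, N.lostRun D p (c.cur p) + R, h₁, h₂, fun x v => ?_, ?_⟩
            · rw [h₃, Set.insert_eq_of_mem (hH x)]
            · rw [h₄, N.sum_lostRun D p, N.sum_lostRun D p, hrest, Function.update_self,
                lostRun.eq_1 _ _ _ (N.callGen i), if_pos ⟨hp, trivial⟩]
              abel
      · obtain ⟨E, T, R, h₁, h₂, h₃, h₄⟩ := ih D W hW
        have hr' : (N.instr ((fun q => if q ∈ D then c.com q else c.cur q) p)).Run c.mem m' s' := by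
          simpa [hp] using hr
        have h₅ := h₁.main p hr'
        have hloc : Function.update (fun q => if q ∈ D then c.com q else c.cur q) p s' =
            fun q => if q ∈ D then c.com q else Function.update c.cur p s' q := by
          funext q
          by_cases hq : q = p
          · subst hq; simp [hp]
          · simp [Function.update_of_ne hq]
        dsimp only at h₅
        rw [hloc] at h₅
        refine ⟨_, T, R, h₅, ?_, fun x v => ?_, ?_⟩
        · simpa [xhistory, hp, event_eq_none hc] using h₂
        · refine (held_main (c := ⟨fun q => if q ∈ D then c.com q else c.cur q, c.mem, T⟩)).trans ?_
          rw [h₃, Set.mem_insert_iff, eq_comm]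
        · rw [h₄, N.sum_lostRun D p, N.sum_lostRun D p,
            sum_lostRun_congr (p := p) N (D := D) (D' := D)
            (cur := Function.update c.cur p s') (cur' := c.cur) (fun q hq => Iff.rfl)
            fun q hq => by simp [Function.update_of_ne hq]]
          simp [lostRun, hp]
  | @crash h H c hE p ih =>
    -- Up to the crash `p` is doomed, so the constructed process already stands in the state to
    -- which the crash leads. The old thread of `p` goes into `R`, and if `p` is going to lose its
    -- progress again, a new one is created.
    obtain ⟨D', hD'⟩ : ∃ D', D' = insert p D := ⟨_, rfl⟩
    obtain ⟨E, T, R, h₁, h₂, h₃, h₄⟩ := ih D' W hW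
    have hloc : (fun q => if q ∈ D then c.com q else Function.update c.cur p (c.com p) q) =
        fun q => if q ∈ D' then c.com q else c.cur q := by
      funext q
      by_cases hq : q = p
      · subst hq; simp [hD']
      · simp [hq, hD']
    obtain ⟨E', T', h₆, h₇, h₈, h₉⟩ := h₁.spawn_all p (N.lostRun D p (c.com p)) (by
      intro u hu
      unfold lostRun at hu
      split_ifs at hu with hu'
      · obtain rfl := Multiset.mem_singleton.1 hu
        exact ⟨by simp [hD'], (hE.tentative p).atCall hu'.2⟩
      · simp at hu)
    refine ⟨E', T', N.lostRun (D') p (c.cur p) + R, ?_, h₇.trans h₂, fun x v => ?_, ?_⟩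
    · simpa only [hloc] using h₆
    · simp only [hloc]
      rw [h₈, h₃]
    · rw [h₉]
      simp only
      rw [h₄, N.sum_lostRun _ p, N.sum_lostRun D p,
        sum_lostRun_congr (p := p) N (D := D') (D' := D) (cur := c.cur)
          (cur' := Function.update c.cur p (c.com p)) (fun q hq => by simp [hq, hD'])
          fun q hq => by simp [Function.update_of_ne hq], Function.update_self]
      abel

/-! ### ABA-freedom in executions with volatile progress. -/

theorem VExec.exists_xexec_cur {N : NormalizedAlgorithm Obj Val In Out} {n : ℕ}
    {h : List (Fin n × Event In Out)} {H : Obj → Set Val} {c : N.VConfig n}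
    (hE : N.VExec n h H c) :
    ∃ E T, N.XExec n E ⟨c.cur, c.mem, T⟩ ∧ N.xhistory n E = h ∧
      ∀ x v, N.Held E ⟨c.cur, c.mem, T⟩ x v ↔ v ∈ H x := by
  obtain ⟨E, T, R, h₁, h₂, h₃, -⟩ := hE.exists_xexec ∅ 0 (by simp)
  simp only [Set.mem_empty_iff_false, if_false] at h₁ h₃
  exact ⟨E, T, h₁, h₂, h₃⟩

theorem VExec.new_notMem {N : NormalizedAlgorithm Obj Val In Out} {n : ℕ} (hN : N.ABAFree n)
    {h : List (Fin n × Event In Out)} {H : Obj → Set Val} {c : N.VConfig n}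
    (hE : N.VExec n h H c) {p : Fin n} {x : Obj} {old new : Val} {k : Bool → N.LState}
    (hp : N.instr (c.cur p) = .cas x old new k) (ho : c.mem x = old) : new ∉ H x := by
  obtain ⟨E, T, h₁, -, h₃⟩ := hE.exists_xexec_cur
  exact fun hx => hN E _ h₁ x old new (.inl ⟨p, k, hp⟩) ho ((h₃ x _).2 hx)

theorem VExec.old_mem {N : NormalizedAlgorithm Obj Val In Out} {n : ℕ} (hN : N.ExpectsHeld n)
    {h : List (Fin n × Event In Out)} {H : Obj → Set Val} {c : N.VConfig n}
    (hE : N.VExec n h H c) {p : Fin n} {x : Obj} {old new : Val} {k : Bool → N.LState}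
    (hp : N.instr (c.cur p) = .cas x old new k) : old ∈ H x := by
  obtain ⟨E, T, h₁, -, h₃⟩ := hE.exists_xexec_cur
  exact (h₃ x _).1 (hN E _ h₁ x old new (.inl ⟨p, k, hp⟩))

theorem instr_ne_write (N : NormalizedAlgorithm Obj Val In Out) (s : N.LState) (x : Obj) (v : Val)
    (s' : N.LState) : N.instr s ≠ .write x v s' := by
  cases s with
  | gen i s L => simp only [instr]; split <;> simp
  | exec i L j => simp only [instr]; split <;> simp
  | wrap i L j s =>
    simp only [instr]
    split
    case h_4 d _ _ => exact d.elim
    all_goals simp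
  | _ => simp [instr]

/-- A memory value that has been held and is not the current one does not come back. -/
theorem VExec.ne_of_run {N : NormalizedAlgorithm Obj Val In Out} {n : ℕ} (hN : N.ABAFree n)
    {h : List (Fin n × Event In Out)} {H : Obj → Set Val} {c : N.VConfig n}
    (hE : N.VExec n h H c) {p : Fin n} {m' : Obj → Val} {s' : N.LState}
    (hr : (N.instr (c.cur p)).Run c.mem m' s') {x : Obj} {v : Val} (hv : v ∈ H x)
    (hx : c.mem x ≠ v) : m' x ≠ v := by
  classical
  generalize hI : N.instr (c.cur p) = I at hr
  cases hr with
  | await => exact hx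
  | loc => exact hx
  | read => exact hx
  | cas_failure => exact hx
  | write => exact (N.instr_ne_write _ _ _ _ hI).elim
  | cas_success y old new k _ ho =>
    by_cases hxy : x = y
    · subst hxy
      rw [Function.update_self]
      rintro rfl
      exact hE.new_notMem hN hI ho hv
    · rwa [Function.update_of_ne hxy]

/-- The CAS at which the executor stopped will not succeed any more. -/
theorem VExec.stopped {N : NormalizedAlgorithm Obj Val In Out} {n : ℕ} (hA : N.ABAFree n)
    (hN : N.ExpectsHeld n) {h : List (Fin n × Event In Out)} {H : Obj → Set Val} {c : N.VConfig n}
    (hE : N.VExec n h H c) (p : Fin n) {i : In} {L : List (CasDesc Obj Val)} {j : ℕ}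
    {s : N.wrap.State} {d : CasDesc Obj Val} (hp : c.com p = .wrap i L j s) (hd : L[j]? = some d) :
    d.exp ∈ H d.obj ∧ c.mem d.obj ≠ d.exp := by
  induction hE with
  | nil => simp at hp
  | @step h H c hE q m' s' hr ih =>
    -- Once the expected value is a value of the past, ABA-freedom keeps it from coming back.
    have key : c.com p = .wrap i L j s → _ := fun hp =>
      (⟨.inr (ih hp).1, hE.ne_of_run hA hr (ih hp).1 (ih hp).2⟩ :
        d.exp ∈ insert (m' d.obj) (H d.obj) ∧ m' d.obj ≠ d.exp)
    by_cases hc : N.Commits (c.cur q)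
    · by_cases hpq : p = q
      · subst hpq
        simp only [hc, if_true, Function.update_self] at hp
        subst hp
        cases hcur : c.cur p with
        | exec i' L' j' =>
          generalize hI : N.instr (c.cur p) = I at hr
          rw [hcur] at hI
          simp only [instr] at hI
          rcases hL : L'[j']? with _ | e <;> simp only [hL] at hI <;> subst hI
          · generalize ht : N.callWrap i' L' j' = t at hr
            cases hr
            simp only [callWrap, LState.wrap.injEq] at ht
            obtain ⟨-, rfl, rfl, -⟩ := ht
            simp [hL] at hd
          · generalize ht : (LState.wrap i L j s : N.LState) = t at hr
            cases hr
            · simp at ht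
            · rename_i hne
              simp only [callWrap, Bool.false_eq_true, if_false, LState.wrap.injEq] at ht
              obtain ⟨-, rfl, rfl, -⟩ := ht
              obtain rfl : e = d := by simpa [hL] using hd
              -- The step at which the executor stops: its CAS fails, so the expected value is not
              -- the present one, and it has been held because all expected values have.
              exact ⟨.inr (hE.old_mem hN (p := p) (x := e.obj) (by rw [hcur, instr, hL])), hne⟩
        | called => rw [hcur] at hr; generalize ht : (LState.wrap i L j s : N.LState) = t at hr; cases hr; simp [callGen] at ht
        | gen i' s' L' =>
          rw [hcur] at hr hc
          obtain ⟨r, hs⟩ := hc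
          simp only [instr, hs] at hr
          generalize ht : (LState.wrap i L j s : N.LState) = t at hr
          cases hr
          simp at ht
        | resp => rw [hcur] at hr; generalize ht : (LState.wrap i L j s : N.LState) = t at hr; cases hr; simp at ht
        | idle => simp [hcur, Commits] at hc
        | wrap => simp [hcur, Commits] at hc
      · simp only [hc, if_true, Function.update_of_ne hpq] at hp
        exact key hp
    · simp only [hc, if_false] at hp
      exact key hp
  | crash hE q ih => exact ih hp

/-! ## Removal of additional threads -/

theorem spawns_append (N : NormalizedAlgorithm Obj Val In Out) {n : ℕ} (E E' : List (N.XStep n)) :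
    N.spawns n (E ++ E') = N.spawns n E ++ N.spawns n E' :=
  List.filterMap_append

theorem xhistory_append (N : NormalizedAlgorithm Obj Val In Out) {n : ℕ}
    (E E' : List (N.XStep n)) : N.xhistory n (E ++ E') = N.xhistory n E ++ N.xhistory n E' :=
  List.filterMap_append

theorem XExec.length_threads {N : NormalizedAlgorithm Obj Val In Out} {n : ℕ}
    {E : List (N.XStep n)} {c : N.XConfig n} (hE : N.XExec n E c) :
    c.threads.length = (N.spawns n E).length := by
  induction hE with
  | nil => rfl
  | main _ _ _ ih => simpa [spawns] using ih
  | spawn _ _ _ ih => simpa [spawns] using ih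
  | thread _ _ _ _ _ ih => simpa [spawns] using ih

/-- A step whose CAS fails or is futile does not change the memory. -/
theorem mem_eq_of_run {N : NormalizedAlgorithm Obj Val In Out} {s s' : N.LState} {m m' : Obj → Val}
    (hr : (N.instr s).Run m m' s')
    (h : ∀ x old new k, N.instr s = .cas x old new k → m x ≠ old ∨ new = old) : m' = m := by
  classical
  generalize hI : N.instr s = I at hr
  cases hr with
  | write => exact (N.instr_ne_write _ _ _ _ hI).elim
  | cas_success x old new k _ ho =>
    rcases h x old new k hI with h | rfl
    · exact (h ho).elim
    · rw [← ho]
      convert Function.update_eq_self x m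
  | _ => rfl

/-- The steps of the thread leave the memory as it is, so the others do not notice when they are
deleted. As no thread is created later, the numbers of the remaining threads do not shift. -/
theorem XExec.remove_thread {N : NormalizedAlgorithm Obj Val In Out} {n : ℕ}
    {F : List (N.XStep n)} {c : N.XConfig n} (hF : N.XExec n F c) {E₀ E₂ : List (N.XStep n)}
    {p : Fin n} {s : N.LState} (h : F = E₀ ++ .spawn p s :: E₂) (hE₂ : N.spawns n E₂ = [])
    (hcas : ∀ m s₁ s₂, XStep.thread (N.spawns n E₀).length m s₁ s₂ ∈ E₂ →
      ∀ x old new k, N.instr s₁ = .cas x old new k → m x ≠ old ∨ new = old) :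
    ∃ E' T u, N.XExec n E' ⟨c.loc, c.mem, T⟩ ∧ c.threads = T ++ [u] ∧
      T.length = (N.spawns n E₀).length ∧ N.xhistory n E' = N.xhistory n F ∧
      N.spawns n E' = N.spawns n E₀ := by
  induction hF generalizing E₂ with
  | nil => simp at h
  | @main E c hE q m' s' hr ih =>
    obtain rfl | ⟨E₃, e, rfl⟩ := List.eq_nil_or_concat' E₂
    · have := congrArg List.getLast? h
      simp at this
    · rw [← List.cons_append, ← List.append_assoc] at h
      obtain ⟨rfl, h'⟩ := List.append_inj' h rfl
      obtain rfl := List.singleton_inj.1 h'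
      obtain ⟨E', T, u, h₁, h₂, h₃, h₄, h₅⟩ := ih rfl (by simpa [spawns] using hE₂)
        fun m s₁ s₂ hm => hcas m s₁ s₂ (by simp [hm])
      refine ⟨_, T, u, h₁.main q hr, h₂, h₃, ?_, ?_⟩
      · rw [xhistory_append, xhistory_append _ (E₀ ++ _), h₄]
      · rw [← h₅, spawns_append]
        simp [spawns]
  | @spawn E c hE q hq ih =>
    obtain rfl | ⟨E₃, e, rfl⟩ := List.eq_nil_or_concat' E₂
    · obtain ⟨rfl, h'⟩ := List.append_inj' h rfl
      refine ⟨_, _, _, hE, rfl, hE.length_threads, ?_, rfl⟩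
      simp [xhistory]
    · rw [← List.cons_append, ← List.append_assoc] at h
      obtain ⟨rfl, h'⟩ := List.append_inj' h rfl
      obtain rfl := List.singleton_inj.1 h'
      simp [spawns] at hE₂
  | @thread E c hE a t ha ht m' s' hr ih =>
    obtain rfl | ⟨E₃, e, rfl⟩ := List.eq_nil_or_concat' E₂
    · have := congrArg List.getLast? h
      simp at this
    · rw [← List.cons_append, ← List.append_assoc] at h
      obtain ⟨rfl, h'⟩ := List.append_inj' h rfl
      obtain rfl := List.singleton_inj.1 h'
      obtain ⟨E', T, u, h₁, h₂, h₃, h₄, h₅⟩ := ih rfl (by simpa [spawns] using hE₂)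
        fun m s₁ s₂ hm => hcas m s₁ s₂ (by simp [hm])
      have hx : N.xhistory n (E₀ ++ XStep.spawn p s :: E₃ ++ [XStep.thread a c.mem t s']) =
          N.xhistory n (E₀ ++ XStep.spawn p s :: E₃) := by simp [xhistory]
      -- The thread to be removed is the last in the list, with `T.length` as its number.
      by_cases haT : a = T.length
      · subst haT
        have hm : m' = c.mem := mem_eq_of_run hr (hcas c.mem t s' (by simp [h₃]))
        subst hm
        refine ⟨E', T, s', h₁, ?_, h₃, h₄.trans hx.symm, h₅⟩
        simp [h₂]
      · have haT' : a < T.length := by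
          have := (List.getElem?_eq_some_iff.1 ha).1
          rw [h₂, List.length_append, List.length_singleton] at this
          omega
        rw [h₂, List.getElem?_append_left haT'] at ha
        refine ⟨_, T.set a s', u, h₁.thread a ha ht hr, ?_, by simpa using h₃, ?_, ?_⟩
        · simp [h₂, List.set_append_left _ _ haT']
        · rw [hx, ← h₄]
          simp [xhistory]
        · rw [← h₅]
          simp [spawns]

theorem exists_last_spawn (N : NormalizedAlgorithm Obj Val In Out) {n : ℕ} (E : List (N.XStep n))
    (h : N.spawns n E ≠ []) :
    ∃ E₀ E₁ p s, E = E₀ ++ .spawn p s :: E₁ ∧ N.spawns n E₁ = [] := by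
  induction E with
  | nil => exact (h rfl).elim
  | cons e E ih =>
    by_cases hE : N.spawns n E = []
    · cases e with
      | spawn p s => exact ⟨[], E, p, s, rfl, hE⟩
      | _ => exact (h hE).elim
    · obtain ⟨E₀, E₁, p, s, rfl, h₁⟩ := ih hE
      exact ⟨e :: E₀, E₁, p, s, rfl, h₁⟩

/-- Induction on the number of threads. Parallelizability, applied to the thread created last, keeps
everything before its creation and adds no later thread, so removing this thread leaves one thread
less. -/
theorem XExec.exists_spawns_eq_nil {N : NormalizedAlgorithm Obj Val In Out} {n : ℕ}
    (hN : N.Parallelizable n) {E : List (N.XStep n)} {c : N.XConfig n} (hE : N.XExec n E c) :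
    ∃ E' c', N.XExec n E' c' ∧ N.spawns n E' = [] ∧ N.xhistory n E' = N.xhistory n E := by
  induction hk : (N.spawns n E).length generalizing E c with
  | zero => exact ⟨E, c, hE, List.length_eq_zero_iff.1 hk, rfl⟩
  | succ k ih =>
    obtain ⟨E₀, E₁, p, s, rfl, h₁⟩ := N.exists_last_spawn E (by intro h; simp [h] at hk)
    obtain ⟨E₂, c', h₂, h₃, h₄, h₅⟩ := hN E₀ E₁ p s c hE
    obtain ⟨E', T, u, h₆, -, -, h₇, h₈⟩ := h₂.remove_thread rfl (h₄.trans h₁) h₅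
    obtain ⟨E'', c'', h₉, h₁₀, h₁₁⟩ := ih h₆ (by
      rw [h₈]
      rw [spawns_append, List.length_append] at hk
      have : (N.spawns n (XStep.spawn p s :: E₁)).length = 1 := by
        change ((p, s) :: N.spawns n E₁).length = 1
        simp [h₁]
      omega)
    exact ⟨E'', c'', h₉, h₁₀, by rw [h₁₁, h₇, h₃]⟩

theorem XExec.exists_exec {N : NormalizedAlgorithm Obj Val In Out} {n : ℕ}
    {E : List (N.XStep n)} {c : N.XConfig n} (hE : N.XExec n E c) (h : N.spawns n E = []) :
    ∃ E', (N.program n).Exec E' ⟨c.loc, c.mem⟩ ∧ (N.program n).history E' = N.xhistory n E := by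
  induction hE with
  | nil => exact ⟨[], .nil, rfl⟩
  | @main E c hE q m' s' hr ih =>
    obtain ⟨E', h₁, h₂⟩ := ih (by simpa [spawns] using h)
    refine ⟨_, h₁.step q hr, ?_⟩
    rw [xhistory_main, ← h₂]
    simp only [Program.history, List.filterMap_append, List.filterMap_cons, List.filterMap_nil]
    simp only [program]
    cases N.event (c.loc q) <;> rfl
  | spawn => simp [spawns] at h
  | @thread E c hE a t ha ht m' s' hr ih =>
    have hE' : N.spawns n E = [] := by simpa [spawns] using h
    have := hE.length_threads
    rw [hE', List.length_nil, List.length_eq_zero_iff] at this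
    simp [this] at ha

/-- Lost progress has no effect on the high-level history. -/
theorem VExec.exists_isExec {N : NormalizedAlgorithm Obj Val In Out} {n : ℕ}
    (hN : N.Parallelizable n) {h : List (Fin n × Event In Out)} {H : Obj → Set Val}
    {c : N.VConfig n} (hE : N.VExec n h H c) :
    ∃ E, (N.program n).IsExec E ∧ (N.program n).history E = h := by
  obtain ⟨E, T, h₁, h₂, -⟩ := hE.exists_xexec_cur
  obtain ⟨E', c', h₃, h₄, h₅⟩ := h₁.exists_spawns_eq_nil hN
  obtain ⟨E'', h₆, h₇⟩ := h₃.exists_exec h₄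
  exact ⟨E'', ⟨_, h₆⟩, by rw [h₇, h₅, h₂]⟩

/-! ## The invariant of the simulator -/

abbrev SMem (n : ℕ) (Obj Val In Out : Type) : Type := ∀ x, SVal n Obj Val In Out x

/-- The context to which process `p` returns after a crash. -/
def ctx {n : ℕ} (m : SMem n Obj Val In Out) (p : Fin n) : Ctx In Out := m (.slot p (m (.ptr p)))

/-- The cell of `x` has held the tag of process `p` and sequence number `s`. Here `H` gives for each object
what its cell has held. -/
def Holds {n : ℕ} (H : Obj → Set (Cell n Val)) (x : Obj) (p : Fin n) (s : ℕ) : Prop :=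
  ∃ v, (v, some (p, s)) ∈ H x

structure ListOk {n : ℕ} (m : SMem n Obj Val In Out) (p : Fin n) (i : In)
    (L : List (CasDesc Obj Val)) : Prop where
  pc : (ctx m p).pc = .exec i L.length
  heap : ∀ a d, L[a]? = some d → m (.heap p ((ctx m p).seq + a)) = some d

/-- The persistent context of process `p` represents the given state. -/
inductive CtxOk (N : NormalizedAlgorithm Obj Val In Out) {n : ℕ} (m : SMem n Obj Val In Out)
    (p : Fin n) : N.LState → Prop
  | idle (o : Option Out) (h : (ctx m p).pc = .idle o) : CtxOk N m p .idle
  | gen (i : In) (h : (ctx m p).pc = .gen i) : CtxOk N m p (N.callGen i)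
  | exec (i : In) (L : List (CasDesc Obj Val)) (j : ℕ) (h : ListOk m p i L) :
      CtxOk N m p (.exec i L j)
  | wrap (i : In) (L : List (CasDesc Obj Val)) (j : ℕ) (h : ListOk m p i L) :
      CtxOk N m p (N.callWrap i L j)

/-- For permanent states: the number of list entries whose CASes have succeeded. -/
def LState.pos {N : NormalizedAlgorithm Obj Val In Out} : N.LState → ℕ
  | .exec _ _ j => j
  | .wrap _ _ j _ => j
  | _ => 0

def LState.list {N : NormalizedAlgorithm Obj Val In Out} : N.LState → List (CasDesc Obj Val)
  | .exec _ L _ => L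
  | .wrap _ L _ _ => L
  | _ => []

/-- The first unused sequence number, if the list in execution begins with number `b`. -/
def LState.nextSeq {N : NormalizedAlgorithm Obj Val In Out} (b : ℕ) : N.LState → ℕ
  | .wrap _ L _ _ => b + L.length
  | _ => b

/-- The sequence numbers that process `p` has used, in the permanent state `t`. -/
structure SeqOk {N : NormalizedAlgorithm Obj Val In Out} {n : ℕ} (m : SMem n Obj Val In Out)
    (H : Obj → Set (Cell n Val)) (p : Fin n) (t : N.LState) : Prop where
  held : ∀ a < t.pos, ∀ d, t.list[a]? = some d → Holds H d.obj p ((ctx m p).seq + a)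
  lt : ∀ x s, Holds H x p s → s < (ctx m p).seq + t.pos
  -- Equality is possible, since an entry is announced before its CAS is tried; so an announcement
  -- beyond an entry proves its success. The strict bound in the next field keeps all announcements
  -- below the numbers of the following list.
  ann_le : ∀ x, (m (.ann x p)).1 ≤ (ctx m p).seq + t.pos
  ann_lt : ∀ x, (m (.ann x p)).1 < (ctx m p).seq + t.list.length

/-- Outside the executor the volatile sequence number may be ahead of the persisted one by the
length of the permanent list. A list under construction thus occupies heap cells beyond those of the
permanent list, which a crash may still call for. -/
structure FrameOk {N : NormalizedAlgorithm Obj Val In Out} {n : ℕ} (m : SMem n Obj Val In Out)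
    (p : Fin n) (t : N.LState) (f : N.Frame) : Prop where
  valid : f.valid = m (.ptr p)
  seq : f.seq = match f.st with
    | .exec _ _ _ => (ctx m p).seq
    | _ => t.nextSeq (ctx m p).seq
  heap : ∀ i s L, f.st = .gen i s L → ∀ a d, L[a]? = some d → m (.heap p (f.seq + a)) = some d
  recovering : f.recovering = true → ∃ i L j, f.st = .exec i L j

/-- The executor has not recovered its position yet. -/
def Lag {N : NormalizedAlgorithm Obj Val In Out} (cur : N.LState) (f : N.Frame) : Prop :=
  ∃ i L j' j, f.st = .exec i L j' ∧ j' ≤ j ∧ (cur = .exec i L j ∨ cur = N.callWrap i L j)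

/-- The second alternative is that of an executor which repeats, after a crash in a later phase, the
CAS at which it had stopped. -/
def AtEntry {N : NormalizedAlgorithm Obj Val In Out} (cur : N.LState) (f : N.Frame) : Prop :=
  cur = f.st ∨ ∃ i L j, f.st = .exec i L j ∧ cur = N.callWrap i L j

def IsCas {N : NormalizedAlgorithm Obj Val In Out} (f : N.Frame) (d : CasDesc Obj Val) : Prop :=
  ∃ k, N.instr f.st = .cas d.obj d.exp d.new k

/-- Only facts that other processes cannot destroy are recorded: `y` has been in the cell, not that
it still is. -/
structure Ready {N : NormalizedAlgorithm Obj Val In Out} {n : ℕ} (m : SMem n Obj Val In Out)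
    (H : Obj → Set (Cell n Val)) (cur : N.LState) (f : N.Frame) (d : CasDesc Obj Val)
    (y : Cell n Val) : Prop where
  cur_eq : cur = f.st
  isCas : IsCas f d
  mem : y ∈ H d.obj
  fst_eq : y.1 = d.exp
  notified : ∀ q s, y.2 = some (q, s) → succeeded (m (.ann d.obj q)) s = true

/-- The relation between the control state of process `p` and its permanent state `com` and current
state `cur` in the simulated execution. -/
def Ctrl {N : NormalizedAlgorithm Obj Val In Out} {n : ℕ} (m : SMem n Obj Val In Out)
    (H : Obj → Set (Cell n Val)) (p : Fin n) (com cur : N.LState) : N.SState n → Prop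
  | .restart => cur = com
  | .load b => cur = com ∧ b = m (.ptr p)
  | .reload b seq i len L =>
    cur = com ∧ b = m (.ptr p) ∧ ctx m p = ⟨.exec i len, seq⟩ ∧ L <+: com.list
  | .run f => FrameOk m p com f ∧
    (f.recovering = true ∧ Lag cur f ∨ f.recovering = false ∧ cur = f.st)
  | .commit f => FrameOk m p com f ∧ cur = f.st ∧ f.boundary = some (m (.slot p (!f.valid)))
  | .tryCas f d => FrameOk m p com f ∧ AtEntry cur f ∧ IsCas f d
  | .notify f d y q s => FrameOk m p com f ∧ cur = f.st ∧ IsCas f d ∧ y ∈ H d.obj ∧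
    y.1 = d.exp ∧ y.2 = some (q, s)
  | .announce f d y => FrameOk m p com f ∧ Ready m H cur f d y
  | .swap f d y => FrameOk m p com f ∧ Ready m H cur f d y ∧
    ∀ s, f.casSeq = some s → (m (.ann d.obj p)).1 = s
  -- Either the pending notification concerns the very entry that is being checked, or the
  -- announcement is already conclusive for this entry.
  | .checkNotify f d q s => FrameOk m p com f ∧ f.recovering = true ∧ Lag cur f ∧ IsCas f d ∧
    Holds H d.obj q s ∧ ∀ s', f.casSeq = some s' →
      (q = p ∧ s = s') ∨ (Holds H d.obj p s' → succeeded (m (.ann d.obj p)) s' = true)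
  | .checkRead f d => FrameOk m p com f ∧ f.recovering = true ∧ Lag cur f ∧ IsCas f d ∧
    ∀ s', f.casSeq = some s' → Holds H d.obj p s' → succeeded (m (.ann d.obj p)) s' = true

/-- Injectivity expresses ABA-freedom for cells: a value determines the tag that goes with it, so
comparing cells amounts to comparing values. The last field says that no success is ever lost: a tag
not visible in the cell has left its trace in the announcement. -/
structure MemOk {n : ℕ} (m : SMem n Obj Val In Out) (H : Obj → Set (Cell n Val)) : Prop where
  mem : ∀ x, m (.cell x) ∈ H x
  inj : ∀ x, (H x).InjOn Prod.fst
  flag : ∀ x p s, m (.ann x p) = (s, true) → Holds H x p s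
  notified : ∀ x p s, Holds H x p s →
    ((m (.cell x)).2 = some (p, s) ∧ s ≤ (m (.ann x p)).1) ∨ succeeded (m (.ann x p)) s = true

structure Own {N : NormalizedAlgorithm Obj Val In Out} {n : ℕ} (m : SMem n Obj Val In Out)
    (H : Obj → Set (Cell n Val)) (p : Fin n) (com cur : N.LState) (s : N.SState n) : Prop where
  ctxOk : CtxOk N m p com
  seqOk : SeqOk m H p com
  ctrl : Ctrl m H p com cur s

/-- A forward simulation relation from the simulator to `VExec`. The ghost history `H` of cell
contents yields, on forgetting the tags, the history of values used there. -/
structure Inv (N : NormalizedAlgorithm Obj Val In Out) {n : ℕ} (h : List (Fin n × Event In Out))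
    (loc : Fin n → N.SState n) (m : SMem n Obj Val In Out) (H : Obj → Set (Cell n Val))
    (a : N.VConfig n) : Prop where
  exec : N.VExec n h (fun x => Prod.fst '' H x) a
  mem_eq : ∀ x, a.mem x = (m (.cell x)).1
  ok : MemOk m H
  own : ∀ p, Own m H p (a.com p) (a.cur p) (loc p)

/-! ### Stability -/

/-- What a step of process `r` may change. -/
structure Env {n : ℕ} (r : Fin n) (m : SMem n Obj Val In Out) (H : Obj → Set (Cell n Val))
    (m' : SMem n Obj Val In Out) (H' : Obj → Set (Cell n Val)) : Prop where
  subset : ∀ x, H x ⊆ H' x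
  holds : ∀ x p s, p ≠ r → Holds H' x p s → Holds H x p s
  ptr : ∀ p ≠ r, m' (.ptr p) = m (.ptr p)
  slot : ∀ p ≠ r, ∀ b, m' (.slot p b) = m (.slot p b)
  heap : ∀ p ≠ r, ∀ s, m' (.heap p s) = m (.heap p s)
  ann : ∀ x, ∀ p ≠ r, (m' (.ann x p)).1 = (m (.ann x p)).1
  succ : ∀ x q s, Holds H x q s → succeeded (m (.ann x q)) s = true →
    succeeded (m' (.ann x q)) s = true

theorem ctx_congr {n : ℕ} {m m' : SMem n Obj Val In Out} {p : Fin n}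
    (hp : m' (.ptr p) = m (.ptr p)) (hs : ∀ b, m' (.slot p b) = m (.slot p b)) :
    ctx m' p = ctx m p := by
  rw [ctx, ctx, hp, hs]

theorem CtxOk.congr {N : NormalizedAlgorithm Obj Val In Out} {n : ℕ} {m m' : SMem n Obj Val In Out}
    {p : Fin n} {t : N.LState} (h : CtxOk N m p t) (hc : ctx m' p = ctx m p)
    (hh : ∀ a < t.list.length,
      m' (.heap p ((ctx m p).seq + a)) = m (.heap p ((ctx m p).seq + a))) :
    CtxOk N m' p t := by
  have key : ∀ i L, t.list = L → ListOk m p i L → ListOk m' p i L := by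
    rintro i L rfl ⟨h₁, h₂⟩
    refine ⟨by rw [hc, h₁], fun a d hd => ?_⟩
    rw [hc, hh a (List.getElem?_eq_some_iff.1 hd).1, h₂ a d hd]
  cases h with
  | idle o h => exact .idle o (by rw [hc, h])
  | gen i h => exact .gen i (by rw [hc, h])
  | exec i L j h => exact .exec i L j (key i L rfl h)
  | wrap i L j h => exact .wrap i L j (key i L rfl h)

theorem SeqOk.congr {N : NormalizedAlgorithm Obj Val In Out} {n : ℕ} {m m' : SMem n Obj Val In Out}
    {H H' : Obj → Set (Cell n Val)} {p : Fin n} {t : N.LState} (h : SeqOk m H p t)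
    (hc : ctx m' p = ctx m p) (ha : ∀ x, (m' (.ann x p)).1 = (m (.ann x p)).1)
    (hH : ∀ x s, Holds H' x p s ↔ Holds H x p s) : SeqOk m' H' p t := by
  constructor
  · intro a ha d hd
    rw [hc, hH]
    exact h.held a ha d hd
  · intro x s hs
    rw [hc]
    exact h.lt x s ((hH x s).1 hs)
  · intro x
    rw [hc, ha]
    exact h.ann_le x
  · intro x
    rw [hc, ha]
    exact h.ann_lt x

theorem FrameOk.congr {N : NormalizedAlgorithm Obj Val In Out} {n : ℕ}
    {m m' : SMem n Obj Val In Out} {p : Fin n} {t : N.LState} {f : N.Frame} (h : FrameOk m p t f)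
    (hp : m' (.ptr p) = m (.ptr p)) (hc : ctx m' p = ctx m p)
    (hh : ∀ s, m' (.heap p s) = m (.heap p s)) : FrameOk m' p t f := by
  refine ⟨by rw [hp, h.valid], ?_, fun i s L hL a d hd => ?_, h.recovering⟩
  · rw [hc]
    exact h.seq
  · rw [hh]
    exact h.heap i s L hL a d hd

theorem Env.holds_iff {n : ℕ} {r : Fin n} {m m' : SMem n Obj Val In Out}
    {H H' : Obj → Set (Cell n Val)} (h : Env r m H m' H') {p : Fin n} (hp : p ≠ r) (x : Obj)
    (s : ℕ) : Holds H' x p s ↔ Holds H x p s :=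
  ⟨h.holds x p s hp, fun ⟨v, hv⟩ => ⟨v, h.subset x hv⟩⟩

/-- What is claimed about `p` concerns its private objects, its own tags, the numbers it has
announced, and facts about `H` and about recorded successes that can only grow. None of this is
affected by steps of others. -/
theorem Own.stable {N : NormalizedAlgorithm Obj Val In Out} {n : ℕ} {r p : Fin n}
    {m m' : SMem n Obj Val In Out} {H H' : Obj → Set (Cell n Val)} (hE : Env r m H m' H')
    (hp : p ≠ r) {com cur : N.LState} {s : N.SState n} (h : Own m H p com cur s) :
    Own m' H' p com cur s := by
  have hc : ctx m' p = ctx m p := ctx_congr (hE.ptr p hp) (hE.slot p hp)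
  have hf : ∀ {f}, FrameOk m p com f → FrameOk m' p com f := fun hf =>
    hf.congr (hE.ptr p hp) hc (hE.heap p hp)
  have hready : ∀ {f d y}, Ready m H cur f d y → Ready m' H' cur f d y := fun {f d y} hr =>
    ⟨hr.cur_eq, hr.isCas, hE.subset _ hr.mem, hr.fst_eq, fun q s hq =>
      hE.succ _ q s ⟨y.1, by rw [← hq]; exact hr.mem⟩ (hr.notified q s hq)⟩
  refine ⟨h.ctxOk.congr hc fun a _ => hE.heap p hp _,
    h.seqOk.congr hc (fun x => hE.ann x p hp) (fun x s => hE.holds_iff hp x s), ?_⟩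
  have hctrl := h.ctrl
  cases s with
  | restart => exact hctrl
  | load b => exact ⟨hctrl.1, hctrl.2.trans (hE.ptr p hp).symm⟩
  | reload b seq i len L =>
    exact ⟨hctrl.1, hctrl.2.1.trans (hE.ptr p hp).symm, hc.trans hctrl.2.2.1, hctrl.2.2.2⟩
  | run f => exact ⟨hf hctrl.1, hctrl.2⟩
  | commit f =>
    refine ⟨hf hctrl.1, hctrl.2.1, ?_⟩
    rw [hE.slot p hp]
    exact hctrl.2.2
  | tryCas f d => exact ⟨hf hctrl.1, hctrl.2⟩
  | notify f d y q s =>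
    obtain ⟨h₁, h₂, h₃, h₄, h₅⟩ := hctrl
    exact ⟨hf h₁, h₂, h₃, hE.subset _ h₄, h₅⟩
  | announce f d y => exact ⟨hf hctrl.1, hready hctrl.2⟩
  | swap f d y =>
    refine ⟨hf hctrl.1, hready hctrl.2.1, fun s hs => ?_⟩
    rw [hE.ann _ p hp]
    exact hctrl.2.2 s hs
  | checkNotify f d q s =>
    obtain ⟨h₁, h₂, h₃, h₄, ⟨v, h₅⟩, h₆⟩ := hctrl
    refine ⟨hf h₁, h₂, h₃, h₄, ⟨v, hE.subset _ h₅⟩, fun s' hs' => (h₆ s' hs').imp id fun h hh => ?_⟩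
    have hh := hE.holds _ p s' hp hh
    exact hE.succ _ p s' hh (h hh)
  | checkRead f d =>
    obtain ⟨h₁, h₂, h₃, h₄, h₆⟩ := hctrl
    refine ⟨hf h₁, h₂, h₃, h₄, fun s' hs' hh => ?_⟩
    have hh := hE.holds _ p s' hp hh
    exact hE.succ _ p s' hh (h₆ s' hs' hh)

/-! ### Changes of the memory -/

theorem MemOk.congr {n : ℕ} {m m' : SMem n Obj Val In Out} {H : Obj → Set (Cell n Val)}
    (h : MemOk m H) (hc : ∀ x, m' (.cell x) = m (.cell x))
    (ha : ∀ x p, m' (.ann x p) = m (.ann x p)) : MemOk m' H := by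
  constructor
  · intro x
    rw [hc]
    exact h.mem x
  · exact h.inj
  · intro x p s
    rw [ha]
    exact h.flag x p s
  · intro x p s
    rw [hc, ha]
    exact h.notified x p s

theorem Env.refl {n : ℕ} (r : Fin n) (m : SMem n Obj Val In Out) (H : Obj → Set (Cell n Val)) :
    Env r m H m H :=
  ⟨fun _ _ h => h, fun _ _ _ _ h => h, fun _ _ => rfl, fun _ _ _ => rfl, fun _ _ _ => rfl,
    fun _ _ _ => rfl, fun _ _ _ _ h => h⟩

theorem succeeded_iff (a : ℕ × Bool) (s : ℕ) :
    succeeded a s = true ↔ s < a.1 ∨ a = (s, true) := by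
  obtain ⟨a, b⟩ := a
  simp [succeeded]

open Classical in
theorem Env.update_slot {n : ℕ} (r : Fin n) (m : SMem n Obj Val In Out)
    (H : Obj → Set (Cell n Val)) (b : Bool) (v : Ctx In Out) :
    Env r m H (Function.update m (.slot r b) v) H := by
  refine ⟨fun _ _ h => h, fun _ _ _ _ h => h, fun p hp => ?_, fun p hp b => ?_, fun p hp s => ?_,
    fun x p hp => ?_, fun x q s _ hs => ?_⟩ <;> rw [Function.update_of_ne] <;> simp [*]

open Classical in
theorem Env.update_ptr {n : ℕ} (r : Fin n) (m : SMem n Obj Val In Out)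
    (H : Obj → Set (Cell n Val)) (b : Bool) :
    Env r m H (Function.update m (.ptr r) b) H := by
  refine ⟨fun _ _ h => h, fun _ _ _ _ h => h, fun p hp => ?_, fun p hp b => ?_, fun p hp s => ?_,
    fun x p hp => ?_, fun x q s _ hs => ?_⟩ <;> rw [Function.update_of_ne] <;> simp [*]

open Classical in
theorem Env.update_heap {n : ℕ} (r : Fin n) (m : SMem n Obj Val In Out)
    (H : Obj → Set (Cell n Val)) (s : ℕ) (v : Option (CasDesc Obj Val)) :
    Env r m H (Function.update m (.heap r s) v) H := by
  refine ⟨fun _ _ h => h, fun _ _ _ _ h => h, fun p hp => ?_, fun p hp b => ?_, fun p hp s => ?_,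
    fun x p hp => ?_, fun x q s _ hs => ?_⟩ <;> rw [Function.update_of_ne] <;> simp [*]

theorem exists_eq_of_run_cas {Obj In S : Type} {V : Obj → Type} {m m' : ∀ x, V x} {x : Obj}
    {old new : V x} {k : Bool → S} {s' : S}
    (hr : Instr.Run (In := In) (.cas x old new k) m m' s') : ∃ b, s' = k b := by
  cases hr
  exacts [⟨_, rfl⟩, ⟨_, rfl⟩]

/-- The effect of a notification. -/
structure Notified {n : ℕ} (m : SMem n Obj Val In Out) (m' : SMem n Obj Val In Out) : Prop where
  cell : ∀ x, m' (.cell x) = m (.cell x)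
  ptr : ∀ p, m' (.ptr p) = m (.ptr p)
  slot : ∀ p b, m' (.slot p b) = m (.slot p b)
  heap : ∀ p s, m' (.heap p s) = m (.heap p s)
  ann_fst : ∀ x p, (m' (.ann x p)).1 = (m (.ann x p)).1

/-- A failing notification is as good as a successful one: the number announced is at least `s`, so
a slot other than `(s, false)` is either flagged for `s` or has moved on to a larger number. -/
theorem notified_of_run {n : ℕ} {S : Type} {m m' : SMem n Obj Val In Out}
    {H : Obj → Set (Cell n Val)} (hm : MemOk m H) {r : Fin n} {x : Obj} {q : Fin n} {s : ℕ}
    {k : Bool → S} {s' : S}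
    (hr : Instr.Run (In := In) (.cas (SObj.ann x q) (s, false) (s, true) k) m m' s')
    (hq : Holds H x q s) :
    Notified m m' ∧ MemOk m' H ∧ Env r m H m' H ∧ succeeded (m' (.ann x q)) s = true := by
  classical
  have hle : s ≤ (m (.ann x q)).1 := by
    rcases hm.notified x q s hq with h | h
    · exact h.2
    · rcases (succeeded_iff _ _).1 h with h | h
      · exact h.le
      · rw [h]
  cases hr with
  | cas_success _ _ _ _ _ h =>
    have hann : ∀ y p, Function.update m (SObj.ann x q) ((s, true) : ℕ × Bool) (.ann y p) =
        m (.ann y p) ∨ y = x ∧ p = q := by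
      intro y p
      by_cases hyp : y = x ∧ p = q
      · exact .inr hyp
      · exact .inl (Function.update_of_ne (by simpa using hyp) _ _)
    have hn : Notified m (Function.update m (SObj.ann x q) ((s, true) : ℕ × Bool)) := by
      refine ⟨fun y => ?_, fun p => ?_, fun p b => ?_, fun p t => ?_, fun y p => ?_⟩
      · exact Function.update_of_ne (by simp) _ _
      · exact Function.update_of_ne (by simp) _ _
      · exact Function.update_of_ne (by simp) _ _
      · exact Function.update_of_ne (by simp) _ _
      · rcases hann y p with hyp | ⟨rfl, rfl⟩
        · rw [hyp]
        · rw [Function.update_self, h]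
    have hs : ∀ y p t, succeeded (m (.ann y p)) t = true →
        succeeded (Function.update m (SObj.ann x q) ((s, true) : ℕ × Bool) (.ann y p)) t = true := by
      intro y p t ht
      rcases hann y p with hyp | ⟨rfl, rfl⟩
      · rwa [hyp]
      · rw [h, succeeded_iff] at ht
        rw [Function.update_self, succeeded_iff]
        exact ht.imp id fun h => by simp at h
    refine ⟨hn, ⟨fun y => ?_, hm.inj, fun y p t ht => ?_, fun y p t ht => ?_⟩, ⟨fun _ _ h => h,
      fun _ _ _ _ h => h, fun p _ => hn.ptr p, fun p _ => hn.slot p, fun p _ => hn.heap p,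
      fun y p _ => hn.ann_fst y p, fun y p t _ => hs y p t⟩, ?_⟩
    · rw [hn.cell]
      exact hm.mem y
    · rcases hann y p with hyp | ⟨rfl, rfl⟩
      · rw [hyp] at ht
        exact hm.flag y p t ht
      · rw [Function.update_self] at ht
        simp only [Prod.mk.injEq, and_true] at ht
        rwa [← ht]
    · rw [hn.cell, hn.ann_fst]
      exact (hm.notified y p t ht).imp id (hs y p t)
    · rw [Function.update_self, succeeded_iff]
      exact .inr rfl
  | cas_failure _ _ _ _ _ h =>
    refine ⟨⟨fun _ => rfl, fun _ => rfl, fun _ _ => rfl, fun _ _ => rfl, fun _ _ => rfl⟩, hm,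
      Env.refl r m H, ?_⟩
    rw [succeeded_iff]
    rcases hle.lt_or_eq with hlt | heq
    · exact .inl hlt
    · right
      refine Prod.ext heq.symm ?_
      by_contra hb
      exact h (Prod.ext heq.symm (by simpa using hb))

open Classical in
-- Overwriting a flag loses no information, because earlier tags of `p` in this cell are smaller
-- than the new number and count as successful by comparison.
theorem MemOk.announce {n : ℕ} {m : SMem n Obj Val In Out} {H : Obj → Set (Cell n Val)}
    (hm : MemOk m H) {x : Obj} {p : Fin n} {s : ℕ} (hs : ∀ t, Holds H x p t → t < s) :
    MemOk (Function.update m (SObj.ann x p) ((s, false) : ℕ × Bool)) H ∧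
      Env p m H (Function.update m (SObj.ann x p) ((s, false) : ℕ × Bool)) H := by
  have hann : ∀ y q, Function.update m (SObj.ann x p) ((s, false) : ℕ × Bool) (.ann y q) =
      m (.ann y q) ∨ y = x ∧ q = p := by
    intro y q
    by_cases hyp : y = x ∧ q = p
    · exact .inr hyp
    · exact .inl (Function.update_of_ne (by simpa using hyp) _ _)
  have hcell : ∀ y, Function.update m (SObj.ann x p) ((s, false) : ℕ × Bool) (.cell y) =
      m (.cell y) := fun y => Function.update_of_ne (by simp) _ _
  refine ⟨⟨fun y => ?_, hm.inj, fun y q t ht => ?_, fun y q t ht => ?_⟩, ⟨fun _ _ h => h,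
    fun _ _ _ _ h => h, fun q _ => Function.update_of_ne (by simp) _ _,
    fun q _ b => Function.update_of_ne (by simp) _ _,
    fun q _ b => Function.update_of_ne (by simp) _ _, fun y q hq => ?_, fun y q t hh ht => ?_⟩⟩
  · rw [hcell]
    exact hm.mem y
  · rcases hann y q with h | ⟨rfl, rfl⟩
    · rw [h] at ht
      exact hm.flag y q t ht
    · simp at ht
  · rcases hann y q with h | ⟨rfl, rfl⟩
    · rw [h, hcell]
      exact hm.notified y q t ht
    · rw [Function.update_self, succeeded_iff]
      exact .inr (.inl (hs t ht))
  · rcases hann y q with h | ⟨rfl, rfl⟩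
    · rw [h]
    · exact (hq rfl).elim
  · rcases hann y q with h | ⟨rfl, rfl⟩
    · rwa [h]
    · rw [Function.update_self, succeeded_iff]
      exact .inl (hs t hh)

open Classical in
-- The three hypotheses are what the earlier steps of a recoverable CAS secure: freshness of the
-- value keeps `H` injective, notification preserves the trace of the overwritten tag, and the
-- announcement prepares that of the new tag.
theorem MemOk.swap {n : ℕ} {m : SMem n Obj Val In Out} {H : Obj → Set (Cell n Val)}
    (hm : MemOk m H) {x : Obj} {p : Fin n} {v : Val} {o : Option ℕ}
    (hv : v ∉ Prod.fst '' H x)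
    (hy : ∀ q s, (m (.cell x)).2 = some (q, s) → succeeded (m (.ann x q)) s = true)
    (ho : ∀ s, o = some s → (m (.ann x p)).1 = s) :
    let m' := Function.update m (SObj.cell x) ((v, o.map fun s => (p, s)) : Cell n Val)
    MemOk m' (fun y => insert (m' (.cell y)) (H y)) ∧
      Env p m H m' (fun y => insert (m' (.cell y)) (H y)) ∧
      ∀ y q t, Holds (fun y => insert (m' (.cell y)) (H y)) y q t →
        Holds H y q t ∨ y = x ∧ q = p ∧ o = some t := by
  intro m'
  have hann : ∀ y q, m' (.ann y q) = m (.ann y q) := fun y q =>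
    Function.update_of_ne (by simp) _ _
  have hself : m' (.cell x) = (v, o.map fun s => (p, s)) := Function.update_self _ _ _
  have hne : ∀ y ≠ x, m' (.cell y) = m (.cell y) := fun y hy =>
    Function.update_of_ne (by simpa using hy) _ _
  have hH : ∀ y ≠ x, insert (m' (.cell y)) (H y) = H y := fun y hy => by
    rw [hne y hy]
    exact Set.insert_eq_of_mem (hm.mem y)
  have hholds : ∀ y q t, Holds (fun y => insert (m' (.cell y)) (H y)) y q t →
      Holds H y q t ∨ y = x ∧ q = p ∧ o = some t := by
    rintro y q t ⟨w, hw⟩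
    by_cases hyx : y = x
    · subst hyx
      rcases hw with hw | hw
      · right
        rw [hself, Prod.ext_iff] at hw
        obtain ⟨s, hs, hs'⟩ := Option.map_eq_some_iff.1 hw.2.symm
        simp only [Prod.mk.injEq] at hs'
        exact ⟨rfl, hs'.1.symm, by rw [hs, hs'.2]⟩
      · exact .inl ⟨w, hw⟩
    · dsimp only at hw
      rw [hH y hyx] at hw
      exact .inl ⟨w, hw⟩
  refine ⟨⟨fun y => .inl rfl, fun y => ?_, fun y q t ht => ?_, fun y q t ht => ?_⟩,
    ⟨fun y => Set.subset_insert _ _, fun y q t hq ht => ?_,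
    fun q _ => Function.update_of_ne (by simp) _ _,
    fun q _ b => Function.update_of_ne (by simp) _ _,
    fun q _ b => Function.update_of_ne (by simp) _ _, fun y q hq => by rw [hann],
    fun y q t hh ht => by rwa [hann]⟩, hholds⟩
  · by_cases hyx : y = x
    · subst hyx
      rw [hself]
      refine (Set.injOn_insert ?_).2 ⟨hm.inj y, hv⟩
      exact fun h => hv ⟨_, h, rfl⟩
    · rw [hH y hyx]
      exact hm.inj y
  · rw [hann] at ht
    obtain ⟨w, hw⟩ := hm.flag y q t ht
    exact ⟨w, .inr hw⟩
  · rw [hann]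
    rcases hholds y q t ht with h | ⟨rfl, rfl, rfl⟩
    · rcases hm.notified y q t h with h | h
      · by_cases hyx : y = x
        · subst hyx
          -- The tag being overwritten: its writer has been notified.
          exact .inr (hy q t h.1)
        · rw [hne y hyx]
          exact .inl h
      · exact .inr h
    · left
      rw [hself]
      exact ⟨rfl, (ho t rfl).ge⟩
  · rcases hholds y q t ht with h | h
    · exact h
    · exact (hq h.2.1).elim

/-! ### Steps of the simulator -/

/-- For steps that are not the effect of a simulated instruction, or that merely repeat one during
recovery: the `VExec` stays where it is. -/
theorem Inv.silent {N : NormalizedAlgorithm Obj Val In Out} {n : ℕ}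
    {h : List (Fin n × Event In Out)} {loc : Fin n → N.SState n} {m m' : SMem n Obj Val In Out}
    {H : Obj → Set (Cell n Val)} {a : N.VConfig n} (hI : Inv N h loc m H a) {p : Fin n}
    {s' : N.SState n} (hev : (N.simulator n).event p (loc p) = none)
    (hcell : ∀ x, m' (.cell x) = m (.cell x)) (hm : MemOk m' H) (hE : Env p m H m' H)
    (hown : Own m' H p (a.com p) (a.cur p) s') :
    ∃ a', Inv N (h ++ (((N.simulator n).event p (loc p)).map fun v => (p, v)).toList)
      (Function.update loc p s') m' (fun x => insert (m' (.cell x)) (H x)) a' := by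
  have hH : (fun x => insert (m' (.cell x)) (H x)) = H := by
    funext x
    rw [hcell]
    exact Set.insert_eq_of_mem (hI.ok.mem x)
  rw [hev, hH]
  refine ⟨a, by simpa using hI.exec, fun x => by rw [hcell, hI.mem_eq], hm, fun q => ?_⟩
  by_cases hq : q = p
  · subst hq
    rwa [Function.update_self]
  · rw [Function.update_of_ne hq]
    exact (hI.own q).stable hE hq

open Classical in
-- For the step at which a simulated instruction takes effect: the `VExec` makes one step.
theorem Inv.advance {N : NormalizedAlgorithm Obj Val In Out} {n : ℕ}
    {h : List (Fin n × Event In Out)} {loc : Fin n → N.SState n} {m m' : SMem n Obj Val In Out}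
    {H : Obj → Set (Cell n Val)} {a : N.VConfig n} (hI : Inv N h loc m H a) {p : Fin n}
    {s' : N.SState n} {t : N.LState} {μ : Obj → Val}
    (hev : (N.simulator n).event p (loc p) = N.event (a.cur p))
    (hr : (N.instr (a.cur p)).Run a.mem μ t) (hμ : ∀ x, μ x = (m' (.cell x)).1)
    (hm : MemOk m' (fun x => insert (m' (.cell x)) (H x)))
    (hE : Env p m H m' (fun x => insert (m' (.cell x)) (H x)))
    (hown : Own m' (fun x => insert (m' (.cell x)) (H x)) p
      (if N.Commits (a.cur p) then t else a.com p) t s') :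
    ∃ a', Inv N (h ++ (((N.simulator n).event p (loc p)).map fun v => (p, v)).toList)
      (Function.update loc p s') m' (fun x => insert (m' (.cell x)) (H x)) a' := by
  refine ⟨⟨Function.update a.cur p t,
    if N.Commits (a.cur p) then Function.update a.com p t else a.com, μ⟩, ?_, hμ, hm, fun q => ?_⟩
  · rw [hev]
    convert hI.exec.step p hr using 2 with x
    rw [Set.image_insert_eq, hμ]
  · by_cases hq : q = p
    · subst hq
      simp only [Function.update_self]
      convert hown using 1
      split_ifs <;> simp
    · simp only [Function.update_of_ne hq]
      have := (hI.own q).stable hE hq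
      split_ifs <;> simpa [Function.update_of_ne hq] using this

/-- A step of the simulated program that does not change the cells. -/
theorem Inv.advance_of_cell {N : NormalizedAlgorithm Obj Val In Out} {n : ℕ}
    {h : List (Fin n × Event In Out)} {loc : Fin n → N.SState n} {m m' : SMem n Obj Val In Out}
    {H : Obj → Set (Cell n Val)} {a : N.VConfig n} (hI : Inv N h loc m H a) {p : Fin n}
    {s' : N.SState n} {t com' : N.LState}
    (hev : (N.simulator n).event p (loc p) = N.event (a.cur p))
    (hr : (N.instr (a.cur p)).Run a.mem a.mem t)
    (hcell : ∀ x, m' (.cell x) = m (.cell x)) (hann : ∀ x q, m' (.ann x q) = m (.ann x q))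
    (hE : Env p m H m' H)
    (hcom : N.Commits (a.cur p) ∧ com' = t ∨ ¬ N.Commits (a.cur p) ∧ com' = a.com p)
    (hown : Own m' H p com' t s') :
    ∃ a', Inv N (h ++ (((N.simulator n).event p (loc p)).map fun v => (p, v)).toList)
      (Function.update loc p s') m' (fun x => insert (m' (.cell x)) (H x)) a' := by
  classical
  have hH : (fun x => insert (m' (.cell x)) (H x)) = H := by
    funext x
    rw [hcell]
    exact Set.insert_eq_of_mem (hI.ok.mem x)
  refine hI.advance hev hr (fun x => by rw [hcell, hI.mem_eq]) ?_ ?_ ?_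
  · rw [hH]
    exact hI.ok.congr hcell hann
  · rwa [hH]
  · rw [hH]
    rcases hcom with ⟨h, rfl⟩ | ⟨h, rfl⟩
    · rwa [if_pos h]
    · rwa [if_neg h]

/-! ### Simulated states and the variables of a process. -/

theorem Tentative.eq_exec {N : NormalizedAlgorithm Obj Val In Out} {t : N.LState} {i : In}
    {L : List (CasDesc Obj Val)} {j : ℕ} (h : N.Tentative t (.exec i L j)) :
    t = .exec i L j ∧ j ≤ L.length := by
  cases h
  exact ⟨rfl, ‹_›⟩

theorem Tentative.eq_callWrap {N : NormalizedAlgorithm Obj Val In Out} {t : N.LState} {i : In}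
    {L : List (CasDesc Obj Val)} {j : ℕ} {s : N.wrap.State} (h : N.Tentative t (.wrap i L j s)) :
    t = N.callWrap i L j ∧ j ≤ L.length := by
  cases h
  exact ⟨rfl, ‹_›⟩

def LState.IsExec {N : NormalizedAlgorithm Obj Val In Out} (s : N.LState) : Prop :=
  ∃ i L j, s = .exec i L j

theorem Frame.goto_of_not_isExec {N : NormalizedAlgorithm Obj Val In Out} {f : N.Frame}
    (hf : ¬ f.st.IsExec) (t : N.LState) : f.goto t = { f with st := t } := by
  unfold Frame.goto
  split
  · rename_i h
    exact (hf ⟨_, _, _, h⟩).elim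
  · rfl

theorem Frame.goto_callWrap {N : NormalizedAlgorithm Obj Val In Out} {f : N.Frame} {i : In}
    {L : List (CasDesc Obj Val)} {j : ℕ} (hf : f.st = .exec i L j) (i' : In)
    (L' : List (CasDesc Obj Val)) (j' : ℕ) :
    f.goto (N.callWrap i' L' j') = ⟨f.valid, f.seq + L.length, N.callWrap i' L' j', false⟩ := by
  simp [Frame.goto, hf, callWrap]

theorem Frame.goto_exec {N : NormalizedAlgorithm Obj Val In Out} (f : N.Frame) (i : In)
    (L : List (CasDesc Obj Val)) (j : ℕ) :
    f.goto (.exec i L j) = { f with st := .exec i L j } := by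
  unfold Frame.goto
  split
  · rename_i h
    simp at h
  · rfl

theorem Frame.goto_st {N : NormalizedAlgorithm Obj Val In Out} (f : N.Frame) (t : N.LState) :
    (f.goto t).st = t := by
  unfold Frame.goto
  split <;> rfl

/-- Separates the CASes of the executor, which commit and are tagged, from those of generator and
wrap-up, which do neither and stay within their method. -/
theorem instr_eq_cas {N : NormalizedAlgorithm Obj Val In Out} {t : N.LState} {x : Obj}
    {old new : Val} {k : Bool → N.LState} (h : N.instr t = .cas x old new k) :
    (∃ i L j, t = .exec i L j ∧ L[j]? = some ⟨x, old, new⟩ ∧ k true = .exec i L (j + 1) ∧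
      k false = N.callWrap i L j) ∨
    (∃ i s L, t = .gen i s L ∧ ¬ N.Commits t ∧ ∀ b, ∃ s', k b = .gen i s' L) ∨
    ∃ i L j s, t = .wrap i L j s ∧ ¬ N.Commits t ∧ ∀ b, ∃ s', k b = .wrap i L j s' := by
  cases t with
  | gen i s L =>
    refine .inr (.inl ⟨i, s, L, rfl, ?_⟩)
    simp only [instr] at h
    cases hs : N.gen.next s <;> simp only [hs, reduceCtorEq, Instr.cas.injEq] at h
    obtain ⟨-, -, -, rfl⟩ := h
    exact ⟨by simp [Commits, hs], fun b => ⟨_, rfl⟩⟩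
  | exec i L j =>
    refine .inl ⟨i, L, j, rfl, ?_⟩
    simp only [instr] at h
    rcases hL : L[j]? with _ | d <;> simp only [hL, reduceCtorEq, Instr.cas.injEq] at h
    obtain ⟨rfl, h₁, h₂, rfl⟩ := h
    obtain rfl := eq_of_heq h₁
    obtain rfl := eq_of_heq h₂
    simp
  | wrap i L j s =>
    refine .inr (.inr ⟨i, L, j, s, rfl, ?_⟩)
    simp only [instr] at h
    rcases hs : N.wrap.next s with _ | _ | _ | d | (_ | o)
    case emit => exact d.elim
    all_goals simp only [hs, reduceCtorEq, Instr.cas.injEq] at h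
    obtain ⟨-, -, -, rfl⟩ := h
    exact ⟨by simp [Commits], fun b => ⟨_, rfl⟩⟩
  | _ => simp [instr] at h

theorem IsCas.getElem? {N : NormalizedAlgorithm Obj Val In Out} {f : N.Frame}
    {d : CasDesc Obj Val} (h : IsCas f d) {i : In} {L : List (CasDesc Obj Val)} {j : ℕ}
    (hf : f.st = .exec i L j) : L[j]? = some d := by
  obtain ⟨k, hk⟩ := h
  rw [hf] at hk
  rcases instr_eq_cas hk with ⟨i, L, j, h, h', -⟩ | ⟨i, s, L, h, -⟩ | ⟨i, L, j, s, h, -⟩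
  · simp only [LState.exec.injEq] at h
    obtain ⟨rfl, rfl, rfl⟩ := h
    exact h'
  · simp at h
  · simp at h

theorem Frame.afterCas_eq {N : NormalizedAlgorithm Obj Val In Out} {f : N.Frame} {x : Obj}
    {old new : Val} {k : Bool → N.LState} (h : N.instr f.st = .cas x old new k) (b : Bool) :
    f.afterCas b = f.goto (k b) := by
  simp [Frame.afterCas, h]

theorem Frame.afterCas_exec {N : NormalizedAlgorithm Obj Val In Out} {f : N.Frame} {i : In}
    {L : List (CasDesc Obj Val)} {j : ℕ} {d : CasDesc Obj Val} (hf : f.st = .exec i L j)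
    (hd : L[j]? = some d) :
    f.afterCas true = f.goto (.exec i L (j + 1)) ∧ f.afterCas false = f.goto (N.callWrap i L j) := by
  simp [Frame.afterCas, hf, instr, hd]

theorem Frame.casSeq_exec {N : NormalizedAlgorithm Obj Val In Out} {f : N.Frame} {i : In}
    {L : List (CasDesc Obj Val)} {j : ℕ} (hf : f.st = .exec i L j) :
    f.casSeq = some (f.seq + j) := by
  simp [Frame.casSeq, hf]

theorem Frame.casSeq_eq_some {N : NormalizedAlgorithm Obj Val In Out} {f : N.Frame} {s : ℕ}
    (h : f.casSeq = some s) : ∃ i L j, f.st = .exec i L j ∧ s = f.seq + j := by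
  unfold Frame.casSeq at h
  split at h
  · rename_i i L j hf
    exact ⟨i, L, j, hf, (Option.some.inj h).symm⟩
  · simp at h

section

variable {N : NormalizedAlgorithm Obj Val In Out} {n : ℕ} {m : SMem n Obj Val In Out}
  {H : Obj → Set (Cell n Val)} {p : Fin n}

theorem FrameOk.seq_exec {com : N.LState} {f : N.Frame} (h : FrameOk m p com f) {i : In}
    {L : List (CasDesc Obj Val)} {j : ℕ} (hf : f.st = .exec i L j) : f.seq = (ctx m p).seq := by
  simpa [hf] using h.seq

theorem FrameOk.seq_of_not_isExec {com : N.LState} {f : N.Frame} (h : FrameOk m p com f)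
    (hf : ¬ f.st.IsExec) : f.seq = com.nextSeq (ctx m p).seq := by
  have := h.seq
  split at this
  · rename_i h
    exact (hf ⟨_, _, _, h⟩).elim
  · exact this

theorem FrameOk.not_recovering {com : N.LState} {f : N.Frame} (h : FrameOk m p com f)
    (hf : ¬ f.st.IsExec) : f.recovering = false := by
  cases hr : f.recovering
  · rfl
  · exact (hf (h.recovering hr)).elim

theorem FrameOk.goto_callWrap {com : N.LState} {f : N.Frame} (h : FrameOk m p com f) {i : In}
    {L : List (CasDesc Obj Val)} {j : ℕ} (hf : f.st = .exec i L j) (j' : ℕ) :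
    FrameOk m p (N.callWrap i L j') (f.goto (N.callWrap i L j')) := by
  rw [Frame.goto_callWrap hf]
  refine ⟨h.valid, ?_, fun i s L hL => ?_, fun h => by simp at h⟩
  · simp [callWrap, h.seq_exec hf, LState.nextSeq]
  · simp [callWrap] at hL

theorem FrameOk.goto_exec {com : N.LState} {f : N.Frame} (h : FrameOk m p com f) {i : In}
    {L : List (CasDesc Obj Val)} {j : ℕ} (hf : f.st = .exec i L j) (com' : N.LState) (j' : ℕ) :
    FrameOk m p com' (f.goto (.exec i L j')) := by
  rw [Frame.goto_exec]
  refine ⟨h.valid, ?_, fun i s L hL => ?_, fun h => ⟨_, _, _, rfl⟩⟩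
  · simpa using h.seq_exec hf
  · simp at hL

theorem FrameOk.goto {com : N.LState} {f : N.Frame} (h : FrameOk m p com f)
    (hf : ¬ f.st.IsExec) {t : N.LState} (ht : ¬ t.IsExec)
    (hh : ∀ i s L, t = .gen i s L → ∀ a d, L[a]? = some d → m (.heap p (f.seq + a)) = some d) :
    FrameOk m p com (f.goto t) := by
  rw [Frame.goto_of_not_isExec hf]
  refine ⟨h.valid, ?_, hh, fun hr => (hf (h.recovering hr)).elim⟩
  have := h.seq_of_not_isExec hf
  dsimp only
  split
  · exact (ht ⟨_, _, _, rfl⟩).elim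
  · exact this

theorem not_isExec_gen (i : In) (s : N.gen.State) (L : List (CasDesc Obj Val)) :
    ¬ (LState.gen i s L : N.LState).IsExec := by
  rintro ⟨_, _, _, h⟩
  simp at h

theorem not_isExec_wrap (i : In) (L : List (CasDesc Obj Val)) (j : ℕ) (s : N.wrap.State) :
    ¬ (LState.wrap i L j s : N.LState).IsExec := by
  rintro ⟨_, _, _, h⟩
  simp at h

theorem ctrl_run {com cur : N.LState} {f : N.Frame} (h : FrameOk m p com f)
    (hr : f.recovering = false) (hc : cur = f.st) : Ctrl m H p com cur (.run f) :=
  ⟨h, .inr ⟨hr, hc⟩⟩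

/-- The control state after a step of a method. -/
theorem ctrl_run_goto {com : N.LState} {f : N.Frame} (h : FrameOk m p com f)
    (hf : ¬ f.st.IsExec) {t : N.LState} (ht : ¬ t.IsExec)
    (hh : ∀ i s L, t = .gen i s L → ∀ a d, L[a]? = some d → m (.heap p (f.seq + a)) = some d) :
    Ctrl m H p com t (.run (f.goto t)) := by
  refine ctrl_run (h.goto hf ht hh) ?_ (f.goto_st t).symm
  rw [Frame.goto_of_not_isExec hf]
  exact h.not_recovering hf

theorem CtxOk.exec_congr {i : In} {L : List (CasDesc Obj Val)} {j : ℕ}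
    (h : CtxOk N m p (.exec i L j)) (j' : ℕ) :
    CtxOk N m p (.exec i L j') ∧ CtxOk N m p (N.callWrap i L j') := by
  cases h with
  | exec _ _ _ h => exact ⟨.exec _ _ _ h, .wrap _ _ _ h⟩

theorem SeqOk.callWrap {i : In} {L : List (CasDesc Obj Val)} {j : ℕ}
    (h : SeqOk m H p (.exec i L j : N.LState)) : SeqOk m H p (N.callWrap i L j) :=
  ⟨h.held, h.lt, h.ann_le, h.ann_lt⟩

theorem ctrl_afterNotify {com cur : N.LState} {f : N.Frame} {d : CasDesc Obj Val}
    {y : Cell n Val} (hf : FrameOk m p com f) (hr : Ready m H cur f d y) :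
    Ctrl m H p com cur (N.afterNotify f d y) := by
  unfold afterNotify
  split
  · exact ⟨hf, hr⟩
  · rename_i h
    exact ⟨hf, hr, fun s hs => by simp [h] at hs⟩

end

/-- Some configuration of the data structure corresponds to the simulator after a step of `p`. -/
def Next (N : NormalizedAlgorithm Obj Val In Out) {n : ℕ} (h : List (Fin n × Event In Out))
    (loc : Fin n → N.SState n) (H : Obj → Set (Cell n Val)) (p : Fin n)
    (m' : SMem n Obj Val In Out) (s' : N.SState n) : Prop :=
  ∃ a', Inv N (h ++ (((N.simulator n).event p (loc p)).map fun v => (p, v)).toList)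
    (Function.update loc p s') m' (fun x => insert (m' (.cell x)) (H x)) a'

section

variable {N : NormalizedAlgorithm Obj Val In Out} {n : ℕ} {h : List (Fin n × Event In Out)}
  {loc : Fin n → N.SState n} {m m' : SMem n Obj Val In Out} {H : Obj → Set (Cell n Val)}
  {a : N.VConfig n} {p : Fin n} {s' : N.SState n}

theorem Inv.crash (hI : Inv N h loc m H a) (p : Fin n) :
    ∃ a', Inv N h (Function.update loc p .restart) m H a' := by
  refine ⟨_, hI.exec.crash p, hI.mem_eq, hI.ok, fun q => ?_⟩
  by_cases hq : q = p
  · subst hq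
    simp only [Function.update_self]
    exact ⟨(hI.own q).ctxOk, (hI.own q).seqOk, rfl⟩
  · simp only [Function.update_of_ne hq]
    exact hI.own q

/-- A silent step that does not change the memory. -/
theorem Inv.silent_same (hI : Inv N h loc m H a)
    (hev : (N.simulator n).event p (loc p) = none)
    (hc : Ctrl m H p (a.com p) (a.cur p) s') : Next N h loc H p m s' :=
  hI.silent hev (fun _ => rfl) hI.ok (Env.refl p m H) ⟨(hI.own p).ctxOk, (hI.own p).seqOk, hc⟩

/-- A step of the simulated program that does not change the memory. -/
theorem Inv.advance_same (hI : Inv N h loc m H a) {t com' : N.LState}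
    (hev : (N.simulator n).event p (loc p) = N.event (a.cur p))
    (hr : (N.instr (a.cur p)).Run a.mem a.mem t)
    (hcom : N.Commits (a.cur p) ∧ com' = t ∨ ¬ N.Commits (a.cur p) ∧ com' = a.com p)
    (hown : Own m H p com' t s') : Next N h loc H p m s' :=
  hI.advance_of_cell hev hr (fun _ => rfl) (fun _ _ => rfl) (Env.refl p m H) hcom hown

/-- A step within a method that does not change the memory. -/
theorem Inv.advance_method (hI : Inv N h loc m H a) {f : N.Frame} {t : N.LState}
    (hev : (N.simulator n).event p (loc p) = none) (hf : FrameOk m p (a.com p) f)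
    (hcur : a.cur p = f.st) (hc : ¬ N.Commits f.st)
    (hr : (N.instr f.st).Run a.mem a.mem t) (ht : ¬ t.IsExec)
    (hh : ∀ i s L, t = .gen i s L → ∀ a d, L[a]? = some d → m (.heap p (f.seq + a)) = some d) :
    Next N h loc H p m (.run (f.goto t)) := by
  have hfe : ¬ f.st.IsExec := by
    rintro ⟨i, L, j, h⟩
    rw [h] at hc
    exact hc trivial
  refine hI.advance_same (by rw [hev, hcur, event_eq_none hc]) (by rwa [hcur])
    (.inr ⟨by rwa [hcur], rfl⟩) ⟨(hI.own p).ctxOk, (hI.own p).seqOk, ?_⟩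
  exact ctrl_run_goto hf hfe ht hh

theorem Inv.step_restart (hI : Inv N h loc m H a) (hp : loc p = .restart)
    (hr : (N.sinstr p (loc p)).Run m m' s') : Next N h loc H p m' s' := by
  have hev : (N.simulator n).event p (loc p) = none := by rw [hp]; rfl
  have ho := (hI.own p).ctrl
  rw [hp] at ho hr
  cases hr
  exact hI.silent_same hev ⟨ho, rfl⟩

theorem Inv.step_load (hI : Inv N h loc m H a) {b : Bool} (hp : loc p = .load b)
    (hr : (N.sinstr p (loc p)).Run m m' s') : Next N h loc H p m' s' := by
  have hev : (N.simulator n).event p (loc p) = none := by rw [hp]; rfl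
  have ho := hI.own p
  obtain ⟨hctx, hseq, hcur, hb⟩ := hp ▸ ho
  rw [hp] at hr
  cases hr
  subst hb
  have hc : m (.slot p (m (.ptr p))) = ctx m p := rfl
  simp only [hc]
  refine hI.silent_same hev ?_
  rw [hcur]
  generalize a.com p = com at hctx
  cases hctx with
  | idle o h =>
    simp only [h]
    exact ctrl_run ⟨rfl, rfl, fun _ _ _ h => by simp at h, fun h => by simp at h⟩ rfl rfl
  | gen i h =>
    simp only [h]
    refine ctrl_run ⟨rfl, rfl, fun _ _ _ h => ?_, fun h => by simp at h⟩ rfl rfl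
    simp only [callGen, LState.gen.injEq] at h
    intro a d hd
    simp [← h.2.2] at hd
  | exec i L j h =>
    simp only [h.pc]
    exact ⟨rfl, rfl, by rw [← h.pc], List.nil_prefix⟩
  -- The persisted context is the same for executor and wrap-up, so a crash during the wrap-up also
  -- leads back to the executor.
  | wrap i L j h =>
    simp only [h.pc]
    exact ⟨rfl, rfl, by rw [← h.pc], List.nil_prefix⟩

theorem Inv.step_reload (hI : Inv N h loc m H a) {b : Bool} {seq : ℕ} {i : In} {len : ℕ}
    {L : List (CasDesc Obj Val)} (hp : loc p = .reload b seq i len L)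
    (hr : (N.sinstr p (loc p)).Run m m' s') : Next N h loc H p m' s' := by
  have hev : (N.simulator n).event p (loc p) = none := by rw [hp]; rfl
  have ho := hI.own p
  obtain ⟨hctx, hseq, hcur, hb, hc, hL⟩ := hp ▸ ho
  subst hb
  have hlist : ListOk m p i (a.com p).list ∧ (a.com p).list.length = len ∧
      ∃ j, a.com p = .exec i (a.com p).list j ∨ a.com p = N.callWrap i (a.com p).list j := by
    generalize a.com p = com at hctx
    cases hctx with
    | idle o h => simp [hc] at h
    | gen i h => simp [hc] at h
    | exec i' L' j' h =>
      have := h.pc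
      simp only [hc, Pc.exec.injEq] at this
      obtain ⟨rfl, rfl⟩ := this
      exact ⟨h, rfl, j', .inl rfl⟩
    | wrap i' L' j' h =>
      have := h.pc
      simp only [hc, Pc.exec.injEq] at this
      obtain ⟨rfl, rfl⟩ := this
      exact ⟨h, rfl, j', .inr rfl⟩
  obtain ⟨hlist, hlen, j, hj⟩ := hlist
  rw [hp] at hr
  simp only [sinstr] at hr
  split_ifs at hr with hlt
  · cases hr
    have hlt' : L.length < (a.com p).list.length := by omega
    have hget := hlist.heap L.length _ (List.getElem?_eq_getElem hlt')
    rw [hc] at hget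
    -- The whole list is in the heap, so the branch that restarts because of a missing entry is
    -- never taken.
    simp only [hget]
    refine hI.silent_same hev ⟨hcur, rfl, hc, ?_⟩
    obtain ⟨L', hL'⟩ := hL
    rw [List.prefix_iff_eq_take]
    simp only [List.length_append, List.length_singleton]
    rw [List.take_succ_eq_append_getElem hlt', ← List.prefix_iff_eq_take.1 ⟨L', hL'⟩]
  · cases hr
    obtain rfl : L = (a.com p).list := hL.eq_of_length_le (by omega)
    -- The recovering executor starts at entry 0, in general behind the true position `j`.
    refine hI.silent_same hev ⟨⟨rfl, ?_, fun _ _ _ h => by simp at h, fun _ => ⟨_, _, _, rfl⟩⟩,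
      .inl ⟨rfl, i, _, 0, j, rfl, Nat.zero_le _, ?_⟩⟩
    · simp [hc]
    · rw [hcur]
      exact hj

/-- A CAS that finds another value than the expected one. -/
theorem Inv.cas_fail (hI : Inv N h loc m H a) {f : N.Frame} {d : CasDesc Obj Val}
    (hev : (N.simulator n).event p (loc p) = none) (hf : FrameOk m p (a.com p) f)
    (hat : AtEntry (a.cur p) f) (hd : IsCas f d) (hy : (m (.cell d.obj)).1 ≠ d.exp) :
    Next N h loc H p m (.run (f.afterCas false)) := by
  have hne : a.mem d.obj ≠ d.exp := by rwa [hI.mem_eq]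
  obtain ⟨k, hk⟩ := hd
  rcases instr_eq_cas hk with ⟨i, L, j, hst, hL, -, hkf⟩ | hm
  · rw [(Frame.afterCas_exec hst hL).2]
    have hrec : (f.goto (N.callWrap i L j)).recovering = false := by rw [Frame.goto_callWrap hst]
    rcases hat with hcur | ⟨i', L', j', h, hcur⟩
    · have ht := (hst ▸ hcur ▸ hI.exec.tentative p).eq_exec
      have ho := hI.own p
      rw [ht.1] at ho
      refine hI.advance_same (com' := N.callWrap i L j) ?_ ?_ (.inl ⟨?_, rfl⟩)
        ⟨(ho.ctxOk.exec_congr _).2, ho.seqOk.callWrap, ctrl_run (hf.goto_callWrap hst j) hrec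
          (f.goto_st _).symm⟩
      · rw [hev, hcur, hst]; rfl
      · rw [hcur, hk, ← hkf]
        exact .cas_failure _ _ _ _ _ hne
      · rw [hcur, hst]; trivial
    -- The failure of this CAS was simulated before the crash, so its repetition does not move the
    -- `VExec`.
    · rw [hst, LState.exec.injEq] at h
      obtain ⟨rfl, rfl, rfl⟩ := h
      have ht := (hcur ▸ hI.exec.tentative p).eq_callWrap
      refine hI.silent_same hev ?_
      rw [ht.1, hcur]
      exact ctrl_run (hf.goto_callWrap hst j) hrec (f.goto_st _).symm
  · have hnot : ¬ N.Commits f.st := by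
      rcases hm with ⟨i, s, L, h, h', -⟩ | ⟨i, L, j, s, h, h', -⟩ <;> exact h'
    have hcur : a.cur p = f.st := by
      rcases hat with h | ⟨i, L, j, h, -⟩
      · exact h
      · rw [h] at hnot
        exact (hnot trivial).elim
    rw [Frame.afterCas_eq hk]
    refine hI.advance_method hev hf hcur hnot (by rw [hk]; exact .cas_failure _ _ _ _ _ hne) ?_ ?_
    · rcases hm with ⟨i, s, L, h, -, h'⟩ | ⟨i, L, j, s, h, -, h'⟩ <;> obtain ⟨s', h'⟩ := h' false <;>
        rw [h']
      · exact not_isExec_gen _ _ _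
      · exact not_isExec_wrap _ _ _ _
    · intro i₁ s₁ L₁ h₁
      rcases hm with ⟨i, s, L, h, -, h'⟩ | ⟨i, L, j, s, h, -, h'⟩ <;> obtain ⟨s', h'⟩ := h' false <;>
        simp only [h', reduceCtorEq, LState.gen.injEq] at h₁
      obtain ⟨rfl, rfl, rfl⟩ := h₁
      exact hf.heap _ _ _ h

/-- The read with which a recoverable CAS begins. -/
theorem Inv.step_rcas (hA : N.ABAFree n) (hN : N.ExpectsHeld n) (hI : Inv N h loc m H a)
    {f : N.Frame} {d : CasDesc Obj Val} (hev : (N.simulator n).event p (loc p) = none)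
    (hf : FrameOk m p (a.com p) f) (hat : AtEntry (a.cur p) f) (hd : IsCas f d)
    (hr : (N.rcas f d : N.SInstr n).Run m m' s') : Next N h loc H p m' s' := by
  cases hr
  by_cases hy : (m (.cell d.obj)).1 = d.exp
  · simp only [hy, if_true]
    -- An entry at which the executor had already stopped cannot find its expected value now.
    have hcur : a.cur p = f.st := by
      rcases hat with h | ⟨i, L, j, h, h'⟩
      · exact h
      · exfalso
        have ht := (h' ▸ hI.exec.tentative p).eq_callWrap
        have := (hI.exec.stopped hA hN p ht.1 (hd.getElem? h)).2
        rw [hI.mem_eq] at this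
        exact this hy
    split
    · rename_i q s hq
      exact hI.silent_same hev ⟨hf, hcur, hd, hI.ok.mem _, hy, hq⟩
    · rename_i hq
      exact hI.silent_same hev (ctrl_afterNotify hf ⟨hcur, hd, hI.ok.mem _, hy, fun q s h => by
        simp [hq] at h⟩)
  · simp only [hy, if_false]
    exact hI.cas_fail hev hf hat hd hy

theorem Inv.step_tryCas (hA : N.ABAFree n) (hN : N.ExpectsHeld n) (hI : Inv N h loc m H a)
    {f : N.Frame} {d : CasDesc Obj Val} (hp : loc p = .tryCas f d)
    (hr : (N.sinstr p (loc p)).Run m m' s') : Next N h loc H p m' s' := by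
  obtain ⟨-, -, h₁, h₂, h₃⟩ := hp ▸ hI.own p
  rw [hp] at hr
  exact hI.step_rcas hA hN (by rw [hp]; rfl) h₁ h₂ h₃ hr

/-- A notification changes nothing for the process that makes it. -/
theorem Notified.own {com cur : N.LState} {s : N.SState n} (hn : Notified m m')
    (h : Own m H p com cur s) {t : N.SState n} (ht : Ctrl m' H p com cur t) :
    Own m' H p com cur t := by
  have hc : ctx m' p = ctx m p := ctx_congr (hn.ptr p) (hn.slot p)
  exact ⟨h.ctxOk.congr hc fun _ _ => hn.heap _ _,
    h.seqOk.congr hc (fun x => hn.ann_fst x p) fun _ _ => Iff.rfl, ht⟩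

theorem Notified.frameOk {com : N.LState} {f : N.Frame} (hn : Notified m m')
    (h : FrameOk m p com f) : FrameOk m' p com f :=
  h.congr (hn.ptr p) (ctx_congr (hn.ptr p) (hn.slot p)) (hn.heap p)

theorem Inv.step_notify (hI : Inv N h loc m H a) {f : N.Frame} {d : CasDesc Obj Val}
    {y : Cell n Val} {q : Fin n} {s : ℕ} (hp : loc p = .notify f d y q s)
    (hr : (N.sinstr p (loc p)).Run m m' s') : Next N h loc H p m' s' := by
  have ho := hI.own p
  rw [hp] at ho hr
  obtain ⟨h₁, h₂, h₃, h₄, h₅, h₆⟩ := ho.ctrl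
  obtain ⟨hn, hm, hE, hs⟩ := notified_of_run hI.ok (r := p) hr
    ⟨y.1, by rw [← h₆]; exact h₄⟩
  obtain ⟨-, rfl⟩ := exists_eq_of_run_cas hr
  refine hI.silent (by rw [hp]; rfl) hn.cell hm hE (hn.own ho (ctrl_afterNotify (hn.frameOk h₁)
    ⟨h₂, h₃, h₄, h₅, fun q' s' h => ?_⟩))
  rw [h₆] at h
  simp only [Option.some.injEq, Prod.mk.injEq] at h
  obtain ⟨rfl, rfl⟩ := h
  exact hs

theorem Inv.step_checkNotify (hI : Inv N h loc m H a) {f : N.Frame} {d : CasDesc Obj Val}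
    {q : Fin n} {s : ℕ} (hp : loc p = .checkNotify f d q s)
    (hr : (N.sinstr p (loc p)).Run m m' s') : Next N h loc H p m' s' := by
  have ho := hI.own p
  rw [hp] at ho hr
  obtain ⟨h₁, h₂, h₃, h₄, h₅, h₆⟩ := ho.ctrl
  obtain ⟨hn, hm, hE, hs⟩ := notified_of_run hI.ok (r := p) hr h₅
  obtain ⟨-, rfl⟩ := exists_eq_of_run_cas hr
  refine hI.silent (by rw [hp]; rfl) hn.cell hm hE (hn.own ho ⟨hn.frameOk h₁, h₂, h₃, h₄,
    fun s' hs' hh => ?_⟩)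
  rcases h₆ s' hs' with ⟨rfl, rfl⟩ | h
  · exact hs
  · exact hE.succ _ _ _ hh (h hh)

theorem Inv.step_announce (hI : Inv N h loc m H a) {f : N.Frame} {d : CasDesc Obj Val}
    {y : Cell n Val} (hp : loc p = .announce f d y)
    (hr : (N.sinstr p (loc p)).Run m m' s') : Next N h loc H p m' s' := by
  classical
  have ho := hI.own p
  rw [hp] at ho hr
  obtain ⟨h₁, h₂⟩ := ho.ctrl
  simp only [sinstr] at hr
  rcases hs : f.casSeq with _ | s <;> simp only [hs] at hr
  · cases hr
    exact hI.silent_same (by rw [hp]; rfl) ⟨h₁, h₂, fun s h => by simp [hs] at h⟩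
  · cases hr
    obtain ⟨i, L, j, hst, rfl⟩ := Frame.casSeq_eq_some hs
    have hseq := h₁.seq_exec hst
    have ht := (hst ▸ h₂.cur_eq ▸ hI.exec.tentative p).eq_exec
    have hj : j < L.length := (List.getElem?_eq_some_iff.1 (h₂.isCas.getElem? hst)).1
    -- The permanent position is `j` itself, so every tag used so far by `p` is smaller than the one
    -- to be announced.
    have hlt : ∀ x t, Holds H x p t → t < f.seq + j := fun x t hh => by
      have := ho.seqOk.lt x t hh
      rwa [ht.1, ← hseq] at this
    obtain ⟨hm, hE⟩ := hI.ok.announce (x := d.obj) (p := p) (s := f.seq + j) (hlt _)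
    have hctx : ctx (Function.update m (SObj.ann d.obj p) ((f.seq + j, false) : ℕ × Bool)) p =
        ctx m p := ctx_congr (Function.update_of_ne (by simp) _ _)
          fun b => Function.update_of_ne (by simp) _ _
    have hann : ∀ x, (Function.update m (SObj.ann d.obj p) ((f.seq + j, false) : ℕ × Bool)
        (.ann x p)).1 = (m (.ann x p)).1 ∨ (Function.update m (SObj.ann d.obj p)
          ((f.seq + j, false) : ℕ × Bool) (.ann x p)).1 = f.seq + j := by
      intro x
      by_cases hx : x = d.obj
      · subst hx
        exact .inr (by rw [Function.update_self])
      · exact .inl (by rw [Function.update_of_ne (by simpa using hx)])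
    refine hI.silent (by rw [hp]; rfl) (fun x => Function.update_of_ne (by simp) _ _) hm hE
      ⟨ho.ctxOk.congr hctx fun a _ => Function.update_of_ne (by simp) _ _, ⟨?_, ?_, ?_, ?_⟩,
        h₁.congr (Function.update_of_ne (by simp) _ _) hctx
          fun s => Function.update_of_ne (by simp) _ _,
        ⟨h₂.cur_eq, h₂.isCas, h₂.mem, h₂.fst_eq, fun q s hq =>
          hE.succ _ q s ⟨y.1, by rw [← hq]; exact h₂.mem⟩ (h₂.notified q s hq)⟩, ?_⟩
    · rw [hctx]; exact ho.seqOk.held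
    · rw [hctx]; exact ho.seqOk.lt
    · intro x
      rw [hctx]
      rcases hann x with h | h <;> rw [h]
      · exact ho.seqOk.ann_le x
      · rw [ht.1, hseq]; rfl
    · intro x
      rw [hctx]
      rcases hann x with h | h <;> rw [h]
      · exact ho.seqOk.ann_lt x
      · rw [ht.1, hseq]
        exact Nat.add_lt_add_left hj _
    · intro s h
      rw [hs] at h
      rw [Function.update_self]
      exact Option.some.inj h

end

section

variable {N : NormalizedAlgorithm Obj Val In Out}

theorem Tentative.pos_le {com cur : N.LState} (h : N.Tentative com cur) :
    com.pos ≤ com.list.length := by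
  cases h <;> first | exact Nat.zero_le _ | assumption

theorem Tentative.nextSeq_eq {com cur : N.LState} (h : N.Tentative com cur) (hc : ¬ cur.IsExec)
    (b : ℕ) : com.nextSeq b = b + com.list.length := by
  cases h
  case exec => exact (hc ⟨_, _, _, rfl⟩).elim
  all_goals rfl

theorem not_isExec_idle : ¬ (LState.idle : N.LState).IsExec := by
  rintro ⟨_, _, _, h⟩
  simp at h

theorem not_isExec_called (i : In) : ¬ (LState.called i : N.LState).IsExec := by
  rintro ⟨_, _, _, h⟩
  simp at h

theorem not_isExec_resp (o : Out) : ¬ (LState.resp o : N.LState).IsExec := by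
  rintro ⟨_, _, _, h⟩
  simp at h

end

section

variable {N : NormalizedAlgorithm Obj Val In Out} {n : ℕ} {h : List (Fin n × Event In Out)}
  {loc : Fin n → N.SState n} {m m' : SMem n Obj Val In Out} {H : Obj → Set (Cell n Val)}
  {a : N.VConfig n} {p : Fin n} {s' : N.SState n}

/-- The first half of a capsule boundary. -/
theorem Inv.step_boundary (hI : Inv N h loc m H a) {f : N.Frame} {c : Ctx In Out}
    (hp : loc p = .run f) (hf : FrameOk m p (a.com p) f) (hcur : a.cur p = f.st)
    (hc : f.boundary = some c)
    (hr : (.write (.slot p (!f.valid)) c (.commit f) : N.SInstr n).Run m m' s') :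
    Next N h loc H p m' s' := by
  classical
  have ho := hI.own p
  cases hr
  -- The copy written is the invalid one, so a crash at this point still finds the old context.
  have hctx : ctx (Function.update m (SObj.slot p (!f.valid)) c) p = ctx m p := by
    have hptr : Function.update m (SObj.slot p (!f.valid)) c (.ptr p) = m (.ptr p) :=
      Function.update_of_ne (by simp) _ _
    unfold ctx
    rw [hptr, Function.update_of_ne (by rw [← hf.valid]; simp)]
  refine hI.silent (by rw [hp]; rfl) (fun x => Function.update_of_ne (by simp) _ _)
    (hI.ok.congr (fun x => Function.update_of_ne (by simp) _ _)
      fun x q => Function.update_of_ne (by simp) _ _) (Env.update_slot p m H _ _)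
    ⟨ho.ctxOk.congr hctx fun _ _ => Function.update_of_ne (by simp) _ _,
      ho.seqOk.congr hctx (fun x => by rw [Function.update_of_ne (by simp)]) fun _ _ => Iff.rfl,
      hf.congr (Function.update_of_ne (by simp) _ _) hctx
        fun _ => Function.update_of_ne (by simp) _ _, hcur, ?_⟩
  rw [Function.update_self]
  exact hc

/-- The heap cell written lies beyond the numbers of the permanent list. This matters in a repeated
iteration, where a crash leads back to the previous list. -/
theorem Inv.step_emit (hI : Inv N h loc m H a) {f : N.Frame} {i : In} {s t : N.gen.State}
    {L : List (CasDesc Obj Val)} {d : CasDesc Obj Val} (hp : loc p = .run f)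
    (hf : FrameOk m p (a.com p) f) (hcur : a.cur p = f.st) (hst : f.st = .gen i s L)
    (hs : N.gen.next s = .emit d t)
    (hr : (.write (.heap p (f.seq + L.length)) (some d) (.run (f.goto (.gen i t (L ++ [d])))) :
      N.SInstr n).Run m m' s') : Next N h loc H p m' s' := by
  classical
  have ho := hI.own p
  have hne : ¬ f.st.IsExec := by rw [hst]; exact not_isExec_gen _ _ _
  have hseq := hf.seq_of_not_isExec hne
  rw [(hI.exec.tentative p).nextSeq_eq (by rwa [hcur])] at hseq
  have hnc : ¬ N.Commits (a.cur p) := by simp [hcur, hst, Commits, hs]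
  cases hr
  have hctx : ctx (Function.update m (SObj.heap p (f.seq + L.length))
      (some d : Option (CasDesc Obj Val))) p = ctx m p := by
    unfold ctx
    rw [Function.update_of_ne (by simp), Function.update_of_ne (by simp)]
  have hf' : FrameOk (Function.update m (SObj.heap p (f.seq + L.length))
      (some d : Option (CasDesc Obj Val))) p (a.com p) f := by
    refine ⟨by rw [Function.update_of_ne (by simp), hf.valid], by rw [hctx]; exact hf.seq,
      fun i' s' L' h b e he => ?_, hf.recovering⟩
    rw [hst, LState.gen.injEq] at h
    obtain ⟨rfl, rfl, rfl⟩ := h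
    have := (List.getElem?_eq_some_iff.1 he).1
    rw [Function.update_of_ne (by simp; omega)]
    exact hf.heap _ _ _ hst b e he
  refine hI.advance_of_cell (t := .gen i t (L ++ [d])) (com' := a.com p) ?_ ?_
    (fun x => Function.update_of_ne (by simp) _ _)
    (fun x q => Function.update_of_ne (by simp) _ _) (Env.update_heap p m H _ _) (.inr ⟨hnc, rfl⟩)
    ⟨ho.ctxOk.congr hctx fun b hb => Function.update_of_ne (by simp; omega) _ _,
      ho.seqOk.congr hctx (fun x => by rw [Function.update_of_ne (by simp)]) fun _ _ => Iff.rfl,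
      ctrl_run_goto hf' hne (not_isExec_gen _ _ _) ?_⟩
  · rw [hp, hcur, hst]; rfl
  · rw [hcur, hst]
    simp only [instr, hs]
    exact .loc _ _
  · intro i' s' L' h b e he
    simp only [LState.gen.injEq] at h
    obtain ⟨rfl, rfl, rfl⟩ := h
    rw [List.getElem?_append] at he
    split_ifs at he with hb
    · exact hf'.heap _ _ _ hst b e he
    · obtain ⟨hb', rfl⟩ := List.getElem?_eq_some_iff.1 he
      simp only [List.length_singleton] at hb'
      obtain rfl : b = L.length := by omega
      rw [Function.update_self]
      simp

/-- The second half of a capsule boundary. -/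
theorem Inv.step_commit (hI : Inv N h loc m H a) {f : N.Frame} (hp : loc p = .commit f)
    (hr : (N.sinstr p (loc p)).Run m m' s') : Next N h loc H p m' s' := by
  classical
  have ho := hI.own p
  rw [hp] at ho hr
  obtain ⟨hf, hcur, hb⟩ := ho.ctrl
  -- Common to the three kinds of boundaries: flipping the pointer replaces the whole context in one
  -- step. The new base number exceeds all tags and announcements of `p`, so the bookkeeping starts
  -- afresh at position 0.
  have key : ∀ t, N.instr f.st = .loc t → N.Commits f.st → t.pos = 0 →
      (∀ b, t.nextSeq b = b) → (∀ i s L, t = .gen i s L → L = []) → ¬ f.st.IsExec →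
      (m (.slot p (!f.valid))).seq = f.seq →
      (∀ m₁ : SMem n Obj Val In Out, ctx m₁ p = m (.slot p (!f.valid)) →
        (∀ s, m₁ (.heap p s) = m (.heap p s)) → CtxOk N m₁ p t) →
      Next N h loc H p m' s' := by
    intro t hi hcom hpos hnext hgen hne hseq hctxOk
    have hfs := hf.seq_of_not_isExec hne
    have ht := hI.exec.tentative p
    rw [ht.nextSeq_eq (by rwa [hcur])] at hfs
    have hrec := hf.not_recovering hne
    simp only [sinstr, hi, Frame.goto_of_not_isExec hne] at hr
    cases hr
    have hctx : ctx (Function.update m (SObj.ptr p) (!f.valid)) p = m (.slot p (!f.valid)) := by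
      unfold ctx
      rw [Function.update_self, Function.update_of_ne (by simp)]
    have hlist : ∀ x, (m (.ann x p)).1 < f.seq := fun x => by
      rw [hfs]
      exact ho.seqOk.ann_lt x
    refine hI.advance_of_cell (t := t) (com' := t) (by rw [hp, hcur]; rfl)
      (by rw [hcur, hi]; exact .loc _ _) (fun x => Function.update_of_ne (by simp) _ _)
      (fun x q => Function.update_of_ne (by simp) _ _) (Env.update_ptr p m H _)
      (.inl ⟨by rwa [hcur], rfl⟩) ⟨hctxOk _ hctx fun s => Function.update_of_ne (by simp) _ _,
        ⟨fun b hb => by omega, fun x s hs => ?_, fun x => ?_, fun x => ?_⟩,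
        ctrl_run ⟨?_, ?_, fun i s L hL b d hd => ?_, fun h => ?_⟩ hrec rfl⟩
    · rw [hctx, hseq, hpos]
      have := ho.seqOk.lt x s hs
      have := ht.pos_le
      omega
    · rw [hctx, hseq, Function.update_of_ne (by simp)]
      have := hlist x
      omega
    · rw [hctx, hseq, Function.update_of_ne (by simp)]
      have := hlist x
      omega
    · rw [Function.update_self]
    · rw [hctx, hseq, hnext]
      split <;> rfl
    · dsimp only at hL
      simp [hgen i s L hL] at hd
    · simp [hrec] at h
  unfold Frame.boundary at hb
  split at hb
  · rename_i i hst
    have hb := Option.some.inj hb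
    refine key (N.callGen i) (by rw [hst]; rfl) (by rw [hst]; trivial) rfl (fun b => rfl)
      (fun i s L h => ?_) (by rw [hst]; exact not_isExec_called _) (by rw [← hb]) fun m₁ hm₁ _ => ?_
    · simp only [callGen, LState.gen.injEq] at h
      exact h.2.2.symm
    · exact .gen i (by rw [hm₁, ← hb])
  · rename_i i s L hst
    split at hb
    · rename_i r hs
      have hb := Option.some.inj hb
      refine key (.exec i L 0) (by rw [hst]; simp only [instr, hs])
        (by rw [hst]; exact ⟨r, hs⟩) rfl (fun b => rfl) (fun i s L h => by simp at h)
        (by rw [hst]; exact not_isExec_gen _ _ _) (by rw [← hb]) fun m₁ hm₁ hh => ?_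
      refine .exec i L 0 ⟨by rw [hm₁, ← hb], fun b d hd => ?_⟩
      rw [hh, hm₁, ← hb]
      exact hf.heap i s L hst b d hd
    · simp at hb
  · rename_i o hst
    have hb := Option.some.inj hb
    exact key .idle (by rw [hst]; rfl) (by rw [hst]; trivial) rfl (fun b => rfl)
      (fun i s L h => by simp at h) (by rw [hst]; exact not_isExec_resp _) (by rw [← hb])
      fun m₁ hm₁ _ => .idle (some o) (by rw [hm₁, ← hb])
  · simp at hb

theorem Inv.step_run_exec (hA : N.ABAFree n) (hN : N.ExpectsHeld n) (hI : Inv N h loc m H a)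
    {f : N.Frame} {i : In} {L : List (CasDesc Obj Val)} {j : ℕ} (hp : loc p = .run f)
    (hst : f.st = .exec i L j) (hr : (N.sinstr p (loc p)).Run m m' s') :
    Next N h loc H p m' s' := by
  have hev : (N.simulator n).event p (loc p) = none := by rw [hp]; rfl
  have ho := hI.own p
  rw [hp] at ho hr
  obtain ⟨hf, hc⟩ := ho.ctrl
  have ht := hI.exec.tentative p
  obtain ⟨j', hj', hcur⟩ : ∃ j', j ≤ j' ∧
      (a.cur p = .exec i L j' ∨ a.cur p = N.callWrap i L j') := by
    rcases hc with ⟨-, i', L', j₁, j₂, h₁, h₂, h₃⟩ | ⟨-, h₁⟩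
    · rw [hst, LState.exec.injEq] at h₁
      obtain ⟨rfl, rfl, rfl⟩ := h₁
      exact ⟨_, h₂, h₃⟩
    · exact ⟨j, le_rfl, .inl (h₁.trans hst)⟩
  have hlen : j' ≤ L.length := by
    rcases hcur with h | h <;> rw [h] at ht
    exacts [ht.eq_exec.2, ht.eq_callWrap.2]
  rcases hL : L[j]? with _ | d
  · simp only [sinstr, hst, instr, hL, Frame.boundary, Frame.emitted] at hr
    cases hr
    have := List.getElem?_eq_none_iff.1 hL
    -- At the end of the list the recovering executor has caught up, since the true position is at
    -- most the length.
    obtain rfl : j = j' := by omega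
    have hrec : (f.goto (N.callWrap i L j)).recovering = false := by rw [Frame.goto_callWrap hst]
    have hctrl := ctrl_run (H := H) (hf.goto_callWrap hst j) hrec (f.goto_st _).symm
    rcases hcur with hcur | hcur <;> rw [hcur] at ht
    · rw [ht.eq_exec.1] at ho
      refine hI.advance_same (com' := N.callWrap i L j) (by rw [hev, hcur]; rfl) ?_
        (.inl ⟨by rw [hcur]; trivial, rfl⟩) ⟨(ho.ctxOk.exec_congr _).2, ho.seqOk.callWrap, hctrl⟩
      rw [hcur]
      simp only [instr, hL]
      exact .loc _ _
    · refine hI.silent_same hev ?_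
      rw [ht.eq_callWrap.1, hcur]
      exact hctrl
  · have hd : IsCas f d := by
      refine ⟨fun b => if b then .exec i L (j + 1) else N.callWrap i L j, ?_⟩
      rw [hst]
      simp only [instr, hL]
    simp only [sinstr, hst, instr, hL] at hr
    split_ifs at hr with hrec
    · cases hr
      have hlag : Lag (a.cur p) f := ⟨i, L, j, j', hst, hj', hcur⟩
      dsimp only
      -- If the tag of this entry was ever in the cell, it is either the one just read, which is
      -- about to be notified, or recorded already.
      split
      · rename_i q s hq
        refine hI.silent_same hev ⟨hf, hrec, hlag, hd, ⟨_, by rw [← hq]; exact hI.ok.mem _⟩,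
          fun s' hs' => ?_⟩
        by_cases hqs : q = p ∧ s = s'
        · exact .inl hqs
        · refine .inr fun hh => (hI.ok.notified _ _ _ hh).resolve_left fun h => hqs ?_
          have := h.1
          rw [hq] at this
          simpa using this
      · rename_i hq
        refine hI.silent_same hev ⟨hf, hrec, hlag, hd, fun s' hs' hh => ?_⟩
        refine (hI.ok.notified _ _ _ hh).resolve_left fun h => ?_
        have := h.1
        rw [hq] at this
        simp at this
    · refine hI.step_rcas hA hN hev hf (.inl ?_) hd hr
      rcases hc with h | h
      · exact (hrec h.1).elim
      · exact h.2

theorem Inv.step_run_gen (hA : N.ABAFree n) (hN : N.ExpectsHeld n) (hI : Inv N h loc m H a)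
    {f : N.Frame} {i : In} {s : N.gen.State} {L : List (CasDesc Obj Val)} (hp : loc p = .run f)
    (hst : f.st = .gen i s L) (hr : (N.sinstr p (loc p)).Run m m' s') :
    Next N h loc H p m' s' := by
  have hev : (N.simulator n).event p (loc p) = none := by rw [hp]; rfl
  have ho := hI.own p
  rw [hp] at ho hr
  obtain ⟨hf, hc⟩ := ho.ctrl
  have hrec := hf.not_recovering (by rw [hst]; exact not_isExec_gen _ _ _)
  have hcur : a.cur p = f.st := by
    rcases hc with h | h
    · simp [hrec] at h
    · exact h.2
  have hheap : ∀ s', ∀ i₁ s₁ L₁, (LState.gen i s' L : N.LState) = .gen i₁ s₁ L₁ →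
      ∀ a d, L₁[a]? = some d → m (.heap p (f.seq + a)) = some d := by
    intro s' i₁ s₁ L₁ h
    simp only [LState.gen.injEq] at h
    obtain ⟨rfl, rfl, rfl⟩ := h
    exact hf.heap _ _ _ hst
  cases hs : N.gen.next s with
  | loc t =>
    simp only [sinstr, hst, instr, hs, Frame.boundary, Frame.emitted] at hr
    cases hr
    refine hI.advance_method hev hf hcur (by simp [hst, Commits, hs]) ?_ (not_isExec_gen _ _ _)
      (hheap t)
    rw [hst]
    simp only [instr, hs]
    exact .loc _ _
  | read x k =>
    simp only [sinstr, hst, instr, hs] at hr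
    cases hr
    refine hI.advance_method hev hf hcur (by simp [hst, Commits, hs]) ?_ (not_isExec_gen _ _ _)
      (hheap _)
    rw [hst, ← hI.mem_eq]
    simp only [instr, hs]
    exact .read x _ _
  | cas x old new k =>
    simp only [sinstr, hst, instr, hs, hrec] at hr
    refine hI.step_rcas hA hN hev hf (.inl hcur) ?_ hr
    refine ⟨fun b => .gen i (k b) L, ?_⟩
    rw [hst]
    simp only [instr, hs]
  | emit d t =>
    simp only [sinstr, hst, instr, hs, Frame.boundary, Frame.emitted] at hr
    exact hI.step_emit hp hf hcur hst hs hr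
  | ret r =>
    simp only [sinstr, hst, instr, hs, Frame.boundary] at hr
    exact hI.step_boundary hp hf hcur (by simp only [Frame.boundary, hst, hs]) hr

theorem Inv.step_run_wrap (hA : N.ABAFree n) (hN : N.ExpectsHeld n) (hI : Inv N h loc m H a)
    {f : N.Frame} {i : In} {L : List (CasDesc Obj Val)} {j : ℕ} {s : N.wrap.State}
    (hp : loc p = .run f) (hst : f.st = .wrap i L j s)
    (hr : (N.sinstr p (loc p)).Run m m' s') : Next N h loc H p m' s' := by
  have hev : (N.simulator n).event p (loc p) = none := by rw [hp]; rfl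
  have ho := hI.own p
  rw [hp] at ho hr
  obtain ⟨hf, hc⟩ := ho.ctrl
  have hrec := hf.not_recovering (by rw [hst]; exact not_isExec_wrap _ _ _ _)
  have hcur : a.cur p = f.st := by
    rcases hc with h | h
    · simp [hrec] at h
    · exact h.2
  have hnc : ¬ N.Commits f.st := by rw [hst]; exact id
  rcases hs : N.wrap.next s with t | ⟨x, k⟩ | ⟨x, old, new, k⟩ | d | (_ | o)
  case emit => exact d.elim
  · simp only [sinstr, hst, instr, hs, Frame.boundary, Frame.emitted] at hr
    cases hr
    refine hI.advance_method hev hf hcur hnc ?_ (not_isExec_wrap _ _ _ _)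
      fun _ _ _ h => by simp at h
    rw [hst]
    simp only [instr, hs]
    exact .loc _ _
  · simp only [sinstr, hst, instr, hs] at hr
    cases hr
    refine hI.advance_method hev hf hcur hnc ?_ (not_isExec_wrap _ _ _ _)
      fun _ _ _ h => by simp at h
    rw [hst, ← hI.mem_eq]
    simp only [instr, hs]
    exact .read x _ _
  · simp only [sinstr, hst, instr, hs, hrec] at hr
    refine hI.step_rcas hA hN hev hf (.inl hcur) ?_ hr
    refine ⟨fun b => .wrap i L j (k b), ?_⟩
    rw [hst]
    simp only [instr, hs]
  · simp only [sinstr, hst, instr, hs, Frame.boundary, Frame.emitted] at hr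
    cases hr
    refine hI.advance_method hev hf hcur hnc ?_ (not_isExec_gen _ _ _) fun _ _ _ h => ?_
    · rw [hst]
      simp only [instr, hs]
      exact .loc _ _
    · simp only [callGen, LState.gen.injEq] at h
      intro b d hd
      simp [← h.2.2] at hd
  · simp only [sinstr, hst, instr, hs, Frame.boundary, Frame.emitted] at hr
    cases hr
    refine hI.advance_method hev hf hcur hnc ?_ (not_isExec_resp _) fun _ _ _ h => by simp at h
    rw [hst]
    simp only [instr, hs]
    exact .loc _ _

theorem Inv.step_run (hA : N.ABAFree n) (hN : N.ExpectsHeld n) (hI : Inv N h loc m H a)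
    {f : N.Frame} (hp : loc p = .run f) (hr : (N.sinstr p (loc p)).Run m m' s') :
    Next N h loc H p m' s' := by
  have hev : (N.simulator n).event p (loc p) = none := by rw [hp]; rfl
  have ho := hI.own p
  rw [hp] at ho
  obtain ⟨hf, hc⟩ := ho.ctrl
  have hcur : ¬ f.st.IsExec → a.cur p = f.st := fun hne => by
    rcases hc with h | h
    · simp [hf.not_recovering hne] at h
    · exact h.2
  cases hst : f.st with
  | idle =>
    have hcur := hcur (by rw [hst]; exact not_isExec_idle)
    rw [hp] at hr
    simp only [sinstr, hst, instr] at hr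
    cases hr
    refine hI.advance_method hev hf hcur (by rw [hst]; exact id) ?_ (not_isExec_called _)
      fun _ _ _ h => by simp at h
    rw [hst]
    exact .await _ _ _
  | called i =>
    have hcur := hcur (by rw [hst]; exact not_isExec_called _)
    rw [hp] at hr
    simp only [sinstr, hst, instr, Frame.boundary] at hr
    exact hI.step_boundary hp hf hcur (by simp only [Frame.boundary, hst]) hr
  | resp o =>
    have hcur := hcur (by rw [hst]; exact not_isExec_resp _)
    rw [hp] at hr
    simp only [sinstr, hst, instr, Frame.boundary] at hr
    exact hI.step_boundary hp hf hcur (by simp only [Frame.boundary, hst]) hr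
  | gen i s L => exact hI.step_run_gen hA hN hp hst hr
  | exec i L j => exact hI.step_run_exec hA hN hp hst hr
  | wrap i L j s => exact hI.step_run_wrap hA hN hp hst hr

/-- The check compares the tentative position with the true one without knowing the latter: it is
positive for entries before the true position and negative there, where ordinary execution resumes.
-/
theorem Inv.step_checkRead (hI : Inv N h loc m H a) {f : N.Frame} {d : CasDesc Obj Val}
    (hp : loc p = .checkRead f d) (hr : (N.sinstr p (loc p)).Run m m' s') :
    Next N h loc H p m' s' := by
  have hev : (N.simulator n).event p (loc p) = none := by rw [hp]; rfl
  have ho := hI.own p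
  rw [hp] at ho hr
  obtain ⟨hf, hrec, ⟨i, L, j', j, hst, hj, hcur⟩, hd, hs⟩ := ho.ctrl
  have hseq := hf.seq_exec hst
  have hL := hd.getElem? hst
  have ht := hI.exec.tentative p
  obtain ⟨hpos, hlist⟩ : (a.com p).pos = j ∧ (a.com p).list = L := by
    rcases hcur with h | h <;> rw [h] at ht
    · rw [ht.eq_exec.1]; exact ⟨rfl, rfl⟩
    · rw [ht.eq_callWrap.1]; exact ⟨rfl, rfl⟩
  simp only [sinstr, Frame.casSeq_exec hst, Option.map_some, Option.getD_some] at hr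
  cases hr
  by_cases hsucc : succeeded (m (.ann d.obj p)) (f.seq + j') = true
  · simp only [hsucc, if_true, (Frame.afterCas_exec hst hL).1]
    -- A larger announced number lies within the bound given by the permanent position, and a flag
    -- proves that the tag has been in the cell; either way the entry precedes position `j`.
    have hlt : j' < j := by
      rcases (succeeded_iff _ _).1 hsucc with h | h
      · have := ho.seqOk.ann_le d.obj
        omega
      · have := ho.seqOk.lt _ _ (hI.ok.flag _ _ _ h)
        omega
    refine hI.silent_same hev ⟨hf.goto_exec hst _ _, .inl ⟨by rw [Frame.goto_exec]; exact hrec,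
      i, L, j' + 1, j, f.goto_st _, hlt, hcur⟩⟩
  · simp only [hsucc]
    have hle : ¬ j' < j := fun hlt => hsucc (hs _ (Frame.casSeq_exec hst) (by
      rw [hseq]
      exact ho.seqOk.held j' (by omega) d (by rw [hlist, hL])))
    obtain rfl : j' = j := by omega
    refine hI.silent_same hev ⟨hf, ?_, hd⟩
    rcases hcur with h | h
    · exact .inl (h.trans hst.symm)
    · exact .inr ⟨i, L, j', hst, h⟩

theorem Inv.step_swap (hA : N.ABAFree n) (hI : Inv N h loc m H a)
    {f : N.Frame} {d : CasDesc Obj Val} {y : Cell n Val} (hp : loc p = .swap f d y)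
    (hr : (N.sinstr p (loc p)).Run m m' s') : Next N h loc H p m' s' := by
  classical
  have hev : (N.simulator n).event p (loc p) = none := by rw [hp]; rfl
  have ho := hI.own p
  rw [hp] at ho hr
  obtain ⟨hf, hready, hann⟩ := ho.ctrl
  have hcur := hready.cur_eq
  simp only [sinstr] at hr
  cases hr with
  | cas_failure _ _ _ _ _ hy =>
    -- With the expected value present, injectivity would make the content equal to `y`. So a
    -- failure of the swap is a genuine failure of the simulated CAS.
    refine hI.cas_fail hev hf (.inl hcur) hready.isCas fun h => hy ?_
    exact hI.ok.inj _ (hI.ok.mem _) hready.mem (h.trans hready.fst_eq.symm)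
  | cas_success _ _ _ _ _ hy =>
    obtain ⟨k, hk⟩ := hready.isCas
    have hk' : N.instr (a.cur p) = .cas d.obj d.exp d.new k := by rw [hcur, hk]
    have hold : a.mem d.obj = d.exp := by rw [hI.mem_eq, hy, hready.fst_eq]
    have hnew := hI.exec.new_notMem hA hk' hold
    obtain ⟨hm, hE, hH⟩ := hI.ok.swap (p := p) (o := f.casSeq) hnew
      (fun q s h => hready.notified q s (by rw [← hy]; exact h)) hann
    set m' := Function.update m (SObj.cell d.obj)
      ((d.new, f.casSeq.map fun s => (p, s)) : Cell n Val) with hm'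
    have hne : ∀ z, (∀ x, z ≠ .cell x) → m' z = m z := fun z hz => by
      rw [hm', Function.update_of_ne (hz _)]
    have hctx : ctx m' p = ctx m p := ctx_congr (hne _ (by simp)) fun b => hne _ (by simp)
    have hf' : FrameOk m' p (a.com p) f := hf.congr (hne _ (by simp)) hctx fun s => hne _ (by simp)
    have hcell : ∀ x, Function.update a.mem d.obj d.new x = (m' (.cell x)).1 := fun x => by
      by_cases hx : x = d.obj
      · subst hx
        rw [hm', Function.update_self, Function.update_self]
      · rw [hm', Function.update_of_ne hx, Function.update_of_ne (by simpa using hx), hI.mem_eq]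
    have hrun : (N.instr (a.cur p)).Run a.mem (Function.update a.mem d.obj d.new) (k true) := by
      rw [hk']
      exact .cas_success _ _ _ _ _ hold
    dsimp only
    rw [Frame.afterCas_eq hk]
    rcases instr_eq_cas hk with ⟨i, L, j, hst, hL, hkt, -⟩ | hmeth
    · have ht := (hst ▸ hcur ▸ hI.exec.tentative p).eq_exec
      have hcom : N.Commits (a.cur p) := by rw [hcur, hst]; trivial
      rw [ht.1] at ho
      refine hI.advance (by rw [hev, hcur, hst]; rfl) hrun hcell hm hE ?_
      rw [if_pos hcom, hkt]
      have hseq := hf.seq_exec hst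
      have hsO := ho.seqOk
      have hjL := (List.getElem?_eq_some_iff.1 hL).1
      refine ⟨((ho.ctxOk.exec_congr (j + 1)).1).congr hctx fun _ _ => hne _ (by simp),
        ⟨fun b hb e he => ?_, fun x s hs => ?_, fun x => ?_, fun x => ?_⟩,
        hf'.goto_exec hst _ _, ?_⟩
      · rw [hctx]
        change b < j + 1 at hb
        -- The position advances by one, and the tag just written accounts for the new entry.
        rcases Nat.lt_succ_iff_lt_or_eq.1 hb with hb | rfl
        · obtain ⟨w, hw⟩ := hsO.held b hb e he
          exact ⟨w, hE.subset _ hw⟩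
        · obtain rfl : _ = e := Option.some.inj (hL.symm.trans he)
          refine ⟨d.new, .inl ?_⟩
          rw [hm', Function.update_self, Frame.casSeq_exec hst, hseq]
          rfl
      · rw [hctx]
        change s < _ + (j + 1)
        rcases hH x p s hs with h | ⟨-, -, h⟩
        · have : s < _ + j := hsO.lt x s h
          omega
        · rw [Frame.casSeq_exec hst, hseq] at h
          have := Option.some.inj h
          omega
      · rw [hctx, hne _ (by simp)]
        exact (hsO.ann_le x).trans (Nat.add_le_add_left (Nat.le_succ j) _)
      · rw [hctx, hne _ (by simp)]
        exact hsO.ann_lt x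
      · cases hrec : f.recovering
        · exact .inr ⟨by rw [Frame.goto_exec]; exact hrec, (f.goto_st _).symm⟩
        · exact .inl ⟨by rw [Frame.goto_exec]; exact hrec, i, L, j + 1, j + 1, f.goto_st _, le_rfl,
            .inl rfl⟩
    · have hnc : ¬ N.Commits f.st := by
        rcases hmeth with ⟨i, s, L, h, h', -⟩ | ⟨i, L, j, s, h, h', -⟩ <;> exact h'
      have hne' : ¬ f.st.IsExec := by
        rcases hmeth with ⟨i, s, L, h, -, -⟩ | ⟨i, L, j, s, h, -, -⟩ <;> rw [h]
        exacts [not_isExec_gen _ _ _, not_isExec_wrap _ _ _ _]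
      have hnone : f.casSeq = none := by
        rcases hmeth with ⟨i, s, L, h, -, -⟩ | ⟨i, L, j, s, h, -, -⟩ <;> simp [Frame.casSeq, h]
      have hiff : ∀ x s, Holds (fun y => insert (m' (.cell y)) (H y)) x p s ↔ Holds H x p s := by
        refine fun x s => ⟨fun h => (hH x p s h).resolve_right fun h => ?_,
          fun ⟨w, hw⟩ => ⟨w, hE.subset _ hw⟩⟩
        -- CASes of generator and wrap-up write no tag, so the bookkeeping of sequence numbers is
        -- unaffected.
        rw [hnone] at h
        simp at h
      refine hI.advance (by rw [hev, hcur, event_eq_none hnc]) hrun hcell hm hE ?_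
      rw [if_neg (by rwa [hcur])]
      refine ⟨ho.ctxOk.congr hctx fun _ _ => hne _ (by simp),
        ho.seqOk.congr hctx (fun x => by rw [hne _ (by simp)]) hiff, ctrl_run_goto hf' hne' ?_ ?_⟩
      · rcases hmeth with ⟨i, s, L, h, -, h'⟩ | ⟨i, L, j, s, h, -, h'⟩ <;>
          obtain ⟨s', h'⟩ := h' true <;> rw [h']
        · exact not_isExec_gen _ _ _
        · exact not_isExec_wrap _ _ _ _
      · intro i₁ s₁ L₁ h₁
        rcases hmeth with ⟨i, s, L, h, -, h'⟩ | ⟨i, L, j, s, h, -, h'⟩ <;>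
          obtain ⟨s', h'⟩ := h' true <;> simp only [h', reduceCtorEq, LState.gen.injEq] at h₁
        obtain ⟨rfl, rfl, rfl⟩ := h₁
        exact hf'.heap _ _ _ h

theorem Inv.step (hA : N.ABAFree n) (hN : N.ExpectsHeld n) (hI : Inv N h loc m H a)
    (hr : (N.sinstr p (loc p)).Run m m' s') : Next N h loc H p m' s' := by
  cases hp : loc p with
  | restart => exact hI.step_restart hp hr
  | load b => exact hI.step_load hp hr
  | reload b seq i len L => exact hI.step_reload hp hr
  | run f => exact hI.step_run hA hN hp hr
  | commit f => exact hI.step_commit hp hr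
  | tryCas f d => exact hI.step_tryCas hA hN hp hr
  | notify f d y q s => exact hI.step_notify hp hr
  | announce f d y => exact hI.step_announce hp hr
  | swap f d y => exact hI.step_swap hA hp hr
  | checkNotify f d q s => exact hI.step_checkNotify hp hr
  | checkRead f d => exact hI.step_checkRead hp hr

end

section

variable {N : NormalizedAlgorithm Obj Val In Out} {n : ℕ}

/-! ### Executions with crashes -/

theorem sinstr_eq_cas_cell {p : Fin n} {t : N.SState n} {x : Obj} {y w : Cell n Val}
    {k : Bool → N.SState n} (h : N.sinstr p t = .cas (.cell x) y w k) :
    ∃ f d, t = .swap f d y ∧ x = d.obj ∧ w = (d.new, f.casSeq.map fun s => (p, s)) := by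
  cases t with
  | swap f d y' =>
    simp only [sinstr, Instr.cas.injEq, SObj.cell.injEq] at h
    obtain ⟨rfl, h₁, h₂, -⟩ := h
    exact ⟨f, d, by rw [eq_of_heq h₁], rfl, (eq_of_heq h₂).symm⟩
  | run f =>
    exfalso
    revert h
    simp only [sinstr]
    split
    · simp
    · simp
    · simp
    · split
      · simp [recover]
      · simp [rcas]
    · split <;> simp
  | commit f =>
    exfalso
    revert h
    simp only [sinstr]
    split <;> simp
  | announce f d y =>
    exfalso
    revert h
    simp only [sinstr]
    split <;> simp
  | reload b seq i len L =>
    exfalso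
    revert h
    simp only [sinstr]
    split_ifs <;> simp
  | _ => simp [sinstr, rcas] at h

theorem sinstr_ne_write_cell {p : Fin n} {t : N.SState n} {x : Obj} {w : Cell n Val}
    {s' : N.SState n} : N.sinstr p t ≠ .write (.cell x) w s' := by
  intro h
  revert h
  cases t with
  | run f =>
    simp only [sinstr]
    split
    · simp
    · simp
    · simp
    · split
      · simp [recover]
      · simp [rcas]
    · split <;> simp
  | commit f =>
    simp only [sinstr]
    split <;> simp
  | announce f d y =>
    simp only [sinstr]
    split <;> simp
  | reload b seq i len L =>
    simp only [sinstr]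
    split_ifs <;> simp
  | _ => simp [sinstr, rcas]

theorem cell_of_run {p : Fin n} {t s' : N.SState n} {m m' : SMem n Obj Val In Out}
    (hr : (N.sinstr p t).Run m m' s') (x : Obj) :
    m' (.cell x) = m (.cell x) ∨ ∃ w k, N.sinstr p t = .cas (.cell x) (m (.cell x)) w k ∧
      m' (.cell x) = w := by
  classical
  generalize hI : N.sinstr p t = I at hr
  cases hr with
  | write y v s =>
    left
    by_cases hy : y = .cell x
    · subst hy
      exact (sinstr_ne_write_cell hI).elim
    · exact Function.update_of_ne (Ne.symm hy) _ _
  | cas_success y old new k _ h =>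
    by_cases hy : y = .cell x
    · subst hy
      right
      subst h
      exact ⟨new, k, rfl, Function.update_self _ _ _⟩
    · exact .inl (Function.update_of_ne (Ne.symm hy) _ _)
  | _ => exact .inl rfl

/-- Translates the ghost history into events of the execution, in terms of which recovery is
specified. -/
theorem exists_holds_insert_iff {H : Obj → Set (Cell n Val)} {r : Fin n} {t s' : N.SState n}
    {m m' : SMem n Obj Val In Out} (hm : ∀ x, m (.cell x) ∈ H x)
    (hr : (N.sinstr r t).Run m m' s') (p : Fin n) (s : ℕ) :
    (∃ x, Holds (fun x => insert (m' (.cell x)) (H x)) x p s) ↔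
      (∃ x, Holds H x p s) ∨ N.CasDone p s (.step ⟨r, m, t, s'⟩) := by
  constructor
  · rintro ⟨x, v, hv | hv⟩
    · rcases cell_of_run hr x with h | ⟨w, k, hk, hw⟩
      · exact .inl ⟨x, v, by rw [hv, h]; exact hm x⟩
      · right
        rw [hw] at hv
        subst hv
        obtain ⟨f, d, -, -, hwd⟩ := sinstr_eq_cas_cell hk
        obtain ⟨s₁, -, hs₁⟩ := Option.map_eq_some_iff.1 (congrArg Prod.snd hwd).symm
        simp only [Prod.mk.injEq] at hs₁
        obtain ⟨rfl, rfl⟩ := hs₁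
        exact ⟨m, t, s', x, _, v, k, rfl, hk, rfl⟩
    · exact .inl ⟨x, v, hv⟩
  · rintro (⟨x, v, hv⟩ | ⟨m₁, pre, post, x, y, v, k, he, hk, hy⟩)
    · exact ⟨x, v, .inr hv⟩
    · simp only [PersistentProgram.PStep.step.injEq] at he
      obtain ⟨rfl, rfl, rfl, rfl⟩ := he
      classical
      refine ⟨x, v, .inl ?_⟩
      rw [hk] at hr
      cases hr with
      | cas_success => rw [Function.update_self]
      | cas_failure _ _ _ _ _ h => exact (h hy).elim

theorem Inv.init : Inv N [] (fun _ => .run ⟨false, 1, .idle, false⟩)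
    (N.simulator n).mem₀ (fun x => {(N.mem₀ x, none)})
    ⟨fun _ => .idle, fun _ => .idle, N.mem₀⟩ := by
  have hH : ∀ x p s, ¬ Holds (n := n) (fun x => {(N.mem₀ x, none)}) x p s := by
    rintro x p s ⟨v, hv⟩
    simp at hv
  refine ⟨by simpa using VExec.nil, fun x => rfl, ⟨fun x => rfl, fun x => Set.injOn_singleton _ _,
    fun x p s h => ?_, fun x p s h => (hH _ _ _ h).elim⟩, fun p => ⟨.idle none rfl,
    ⟨fun a ha => by simp [LState.pos] at ha, fun x s h => (hH _ _ _ h).elim,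
      fun x => Nat.zero_le _, fun x => Nat.zero_lt_one⟩, ctrl_run ⟨rfl, rfl,
        fun _ _ _ h => by simp at h, fun h => by simp at h⟩ rfl rfl⟩⟩
  simp [simulator] at h

theorem exists_inv (hA : N.ABAFree n) (hN : N.ExpectsHeld n) {E : List (N.simulator n).PStep}
    {c : (N.simulator n).toProgram.Config} (hE : (N.simulator n).PExec E c) :
    ∃ H a, Inv N ((N.simulator n).toProgram.history ((N.simulator n).steps E)) c.loc c.mem H a ∧
      ∀ p s, (∃ e ∈ E, N.CasDone p s e) ↔ ∃ x, Holds H x p s := by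
  induction hE with
  | nil =>
    refine ⟨_, _, Inv.init, fun p s => ?_⟩
    simp [Holds]
  | @step E c hE p m' s' hr ih =>
    obtain ⟨H, a, hI, hH⟩ := ih
    obtain ⟨a', hI'⟩ := hI.step hA hN hr
    refine ⟨fun x => insert (m' (.cell x)) (H x), a', ?_, fun q s => ?_⟩
    · convert hI' using 1
      simp only [Program.history, PersistentProgram.steps, List.filterMap_append,
        List.filterMap_cons, List.filterMap_nil]
      cases (N.simulator n).event p (c.loc p) <;> rfl
    · refine Iff.trans ?_ (exists_holds_insert_iff hI.ok.mem hr q s).symm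
      rw [← hH]
      simp [or_and_right, exists_or]
  | @crash E c hE p ih =>
    obtain ⟨H, a, hI, hH⟩ := ih
    obtain ⟨a', hI'⟩ := hI.crash p
    refine ⟨H, a', ?_, fun q s => ?_⟩
    · have hsteps : (N.simulator n).steps (E ++ [.crash p]) = (N.simulator n).steps E := by
        simp [PersistentProgram.steps]
      rw [hsteps]
      exact hI'
    · rw [← hH]
      simp [or_and_right, exists_or, CasDone]

/-- The invariant supplies an execution with volatile progress and the same history, and
parallelizability makes up for the losses. -/
theorem simulates (hP : N.Parallelizable n) (hA : N.ABAFree n) (hN : N.ExpectsHeld n) :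
    (N.simulator n).Simulates (N.program n) := by
  rintro E ⟨c, hE⟩
  obtain ⟨H, a, hI, -⟩ := exists_inv hA hN hE
  exact hI.exec.exists_isExec hP

end

/-! ### Recovery of the executor. -/

theorem _root_.PersistentNormalized.PersistentProgram.PExec.split {n : ℕ}
    {A : PersistentProgram n In Out} {F : List A.PStep} {c : A.toProgram.Config}
    (hF : A.PExec F c) {E₀ E₁ : List A.PStep} {e : A.toProgram.Step}
    (h : F = E₀ ++ .step e :: E₁) :
    ∃ c₀ m', A.PExec E₀ c₀ ∧ e.mem = c₀.mem ∧ e.pre = c₀.loc e.proc ∧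
      (A.instr e.proc e.pre).Run e.mem m' e.post := by
  induction hF generalizing E₁ with
  | nil => simp at h
  | @step E c hE p m' s' hr ih =>
    obtain rfl | ⟨E₃, e', rfl⟩ := List.eq_nil_or_concat' E₁
    · obtain ⟨rfl, h'⟩ := List.append_inj' h rfl
      simp only [List.cons.injEq, PersistentProgram.PStep.step.injEq, and_true] at h'
      subst h'
      exact ⟨c, m', hE, rfl, rfl, hr⟩
    · rw [← List.cons_append, ← List.append_assoc] at h
      exact ih (List.append_inj' h rfl).1
  | @crash E c hE p ih =>
    obtain rfl | ⟨E₃, e', rfl⟩ := List.eq_nil_or_concat' E₁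
    · obtain ⟨rfl, h'⟩ := List.append_inj' h rfl
      simp at h'
    · rw [← List.cons_append, ← List.append_assoc] at h
      exact ih (List.append_inj' h rfl).1

section

variable {N : NormalizedAlgorithm Obj Val In Out} {n : ℕ} {m m' : SMem n Obj Val In Out}
  {H : Obj → Set (Cell n Val)} {p : Fin n} {com cur : N.LState} {s s' : N.SState n}

/-- The permanent state determines which entries of the list have succeeded. -/
theorem SeqOk.exists_holds_iff (h : SeqOk m H p com) {a : ℕ} (ha : a < com.list.length) :
    (∃ x, Holds H x p ((ctx m p).seq + a)) ↔ a < com.pos := by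
  refine ⟨fun ⟨x, hx⟩ => ?_, fun hlt => ⟨_, h.held a hlt _ (List.getElem?_eq_getElem ha)⟩⟩
  have := h.lt x _ hx
  omega

theorem Tentative.of_lag (ht : N.Tentative com cur) {i : In} {L : List (CasDesc Obj Val)} {j : ℕ}
    (h : cur = .exec i L j ∨ cur = N.callWrap i L j) :
    com.pos = j ∧ com.list = L ∧ j ≤ L.length := by
  rcases h with h | h <;> rw [h] at ht
  · rw [ht.eq_exec.1]
    exact ⟨rfl, rfl, ht.eq_exec.2⟩
  · rw [ht.eq_callWrap.1]
    exact ⟨rfl, rfl, ht.eq_callWrap.2⟩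

theorem Own.check_iff (hm : MemOk m H) (ht : N.Tentative com cur) {f : N.Frame}
    {d : CasDesc Obj Val} (h : Own m H p com cur (.checkRead f d)) {i : In}
    {L : List (CasDesc Obj Val)} {j : ℕ} (hst : f.st = .exec i L j)
    (hr : (N.sinstr p (.checkRead f d)).Run m m' s') :
    s' = .run (f.goto (.exec i L (j + 1))) ↔ ∃ x, Holds H x p (f.seq + j) := by
  obtain ⟨hf, hrec, ⟨i', L', j', j₂, hst', hj, hcur⟩, hd, hs⟩ := h.ctrl
  rw [hst, LState.exec.injEq] at hst'
  obtain ⟨rfl, rfl, rfl⟩ := hst'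
  have hseq := hf.seq_exec hst
  have hL := hd.getElem? hst
  obtain ⟨hpos, rfl, -⟩ := ht.of_lag hcur
  have hlen := (List.getElem?_eq_some_iff.1 hL).1
  have hiff := h.seqOk.exists_holds_iff hlen
  have hsucc : succeeded (m (.ann d.obj p)) (f.seq + j) = true ↔ ∃ x, Holds H x p (f.seq + j) := by
    constructor
    · intro hsucc
      rcases (succeeded_iff _ _).1 hsucc with h' | h'
      · rw [hseq, hiff]
        have := h.seqOk.ann_le d.obj
        omega
      · exact ⟨_, hm.flag _ _ _ h'⟩
    · intro hx
      refine hs _ (Frame.casSeq_exec hst) ?_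
      rw [hseq] at hx ⊢
      exact h.seqOk.held j (hiff.1 hx) d hL
  rw [← hsucc]
  simp only [sinstr, Frame.casSeq_exec hst, Option.map_some, Option.getD_some] at hr
  cases hr
  by_cases hb : succeeded (m (.ann d.obj p)) (f.seq + j) = true
  · simp [hb, (Frame.afterCas_exec hst hL).1]
  · simp [hb]

/-- The executor is left at the end of the list, at a first read that finds another value, or at a
failing swap. In each case it is no longer behind the permanent position, which is therefore the
index returned. -/
theorem Own.position (ht : N.Tentative com cur) (h : Own m H p com cur s) {f f' : N.Frame}
    {i : In} {L : List (CasDesc Obj Val)} {j r : ℕ} (hs : s.frame? = some f)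
    (hst : f.st = .exec i L j) (hf' : f'.st = N.callWrap i L r)
    (hr : (N.sinstr p s).Run m m' (.run f')) :
    f.seq = (ctx m p).seq ∧ com.list = L ∧ com.pos = r ∧ r ≤ L.length := by
  have hwrap : ∀ {j'}, f' = f.goto (N.callWrap i L j') → j' = r := fun {j'} h => by
    rw [h, Frame.goto_st] at hf'
    simp only [callWrap, LState.wrap.injEq] at hf'
    exact hf'.2.2.1
  have hexec : ∀ {j'}, f' = f.goto (.exec i L j') → False := fun {j'} h => by
    rw [h, Frame.goto_st] at hf'
    simp [callWrap] at hf'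
  have hentry : AtEntry cur f → cur = .exec i L j ∨ cur = N.callWrap i L j := by
    rintro (h | ⟨i', L', j', h, h'⟩)
    · exact .inl (h.trans hst)
    · rw [hst, LState.exec.injEq] at h
      obtain ⟨rfl, rfl, rfl⟩ := h
      exact .inr h'
  have hrcas : ∀ {d}, IsCas f d → (N.rcas f d : N.SInstr n).Run m m' (.run f') → j = r := by
    intro d hd hr
    generalize hs' : (SState.run f' : N.SState n) = s' at hr
    cases hr
    dsimp only at hs'
    split_ifs at hs' with hy
    · split at hs'
      · simp at hs'
      · unfold afterNotify at hs'
        split at hs' <;> simp at hs'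
    · rw [(Frame.afterCas_exec hst (hd.getElem? hst)).2] at hs'
      exact hwrap (SState.run.inj hs')
  have key : FrameOk m p com f → (cur = .exec i L j ∨ cur = N.callWrap i L j) → j = r →
      f.seq = (ctx m p).seq ∧ com.list = L ∧ com.pos = r ∧ r ≤ L.length := by
    rintro hf hcur rfl
    obtain ⟨h₁, h₂, h₃⟩ := ht.of_lag hcur
    exact ⟨hf.seq_exec hst, h₂, h₁, h₃⟩
  have hctrl := h.ctrl
  cases s with
  | run f =>
    obtain rfl := Option.some.inj hs
    obtain ⟨hf, hc⟩ := hctrl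
    rcases hL : L[j]? with _ | d
    · simp only [sinstr, hst, instr, hL, Frame.boundary, Frame.emitted] at hr
      generalize hs' : (SState.run f' : N.SState n) = s' at hr
      cases hr
      obtain rfl := hwrap (SState.run.inj hs')
      have hlen := List.getElem?_eq_none_iff.1 hL
      refine key hf ?_ rfl
      rcases hc with ⟨-, i', L', j₁, j₂, h₁, h₂, h₃⟩ | ⟨-, h₁⟩
      · rw [hst, LState.exec.injEq] at h₁
        obtain ⟨rfl, rfl, rfl⟩ := h₁
        have := (ht.of_lag h₃).2.2
        obtain rfl : j = j₂ := by omega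
        exact h₃
      · exact .inl (h₁.trans hst)
    · have hd : IsCas f d := by
        refine ⟨fun b => if b then .exec i L (j + 1) else N.callWrap i L j, ?_⟩
        rw [hst]
        simp only [instr, hL]
      simp only [sinstr, hst, instr, hL] at hr
      split_ifs at hr with hrec
      · generalize hs' : (SState.run f' : N.SState n) = s' at hr
        cases hr
        dsimp only at hs'
        split at hs' <;> simp at hs'
      · refine key hf (.inl ?_) (hrcas hd hr)
        rcases hc with h | h
        · exact (hrec h.1).elim
        · exact h.2.trans hst
  | commit f =>
    obtain rfl := Option.some.inj hs
    have := hctrl.2.2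
    simp [Frame.boundary, hst] at this
  | tryCas f d =>
    obtain rfl := Option.some.inj hs
    exact key hctrl.1 (hentry hctrl.2.1) (hrcas hctrl.2.2 hr)
  | notify f d y q s =>
    obtain ⟨-, hb⟩ := exists_eq_of_run_cas hr
    unfold afterNotify at hb
    split at hb <;> simp at hb
  | announce f d y =>
    simp only [sinstr] at hr
    generalize hs' : (SState.run f' : N.SState n) = s' at hr
    split at hr <;> cases hr <;> simp at hs'
  | swap f d y =>
    obtain rfl := Option.some.inj hs
    obtain ⟨hf, hready, -⟩ := hctrl
    obtain ⟨b, hb⟩ := exists_eq_of_run_cas hr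
    have hb := SState.run.inj hb
    have hL := hready.isCas.getElem? hst
    cases b
    · rw [(Frame.afterCas_exec hst hL).2] at hb
      exact key hf (.inl (hready.cur_eq.trans hst)) (hwrap hb)
    · rw [(Frame.afterCas_exec hst hL).1] at hb
      exact (hexec hb).elim
  | checkNotify f d q s =>
    obtain ⟨-, hb⟩ := exists_eq_of_run_cas hr
    simp at hb
  | checkRead f d =>
    obtain rfl := Option.some.inj hs
    obtain ⟨hf, hrec, hlag, hd, hs⟩ := hctrl
    simp only [sinstr] at hr
    generalize hs' : (SState.run f' : N.SState n) = s' at hr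
    cases hr
    dsimp only at hs'
    split_ifs at hs'
    rw [(Frame.afterCas_exec hst (hd.getElem? hst)).1] at hs'
    exact (hexec (SState.run.inj hs')).elim
  | _ => simp [SState.frame?] at hs

theorem executorRecovers (hA : N.ABAFree n) (hN : N.ExpectsHeld n) : N.ExecutorRecovers n := by
  constructor
  · rintro E₀ E₁ p m f d post i L j ⟨c, hE⟩ hst
    obtain ⟨c₀, m', hE₀, hmem, hpre, hr⟩ := hE.split rfl
    obtain ⟨H, a, hI, hH⟩ := exists_inv hA hN hE₀
    dsimp only at hmem hpre hr
    subst hmem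
    have ho := hI.own p
    rw [← hpre] at ho
    rw [hH]
    exact ho.check_iff hI.ok (hI.exec.tentative p) hst hr
  · rintro E₀ E₁ p m pre post f f' i L j r ⟨c, hE⟩ hfr hst rfl hf'
    obtain ⟨c₀, m', hE₀, hmem, hpre, hr⟩ := hE.split rfl
    obtain ⟨H, a, hI, hH⟩ := exists_inv hA hN hE₀
    dsimp only at hmem hpre hr
    subst hmem
    have ho := hI.own p
    rw [← hpre] at ho
    obtain ⟨h₁, rfl, rfl, h₄⟩ := ho.position (hI.exec.tentative p) hfr hst hf' hr
    refine ⟨h₄, fun b hb => ?_⟩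
    rw [hH, h₁]
    exact ho.seqOk.exists_holds_iff hb
  · rintro E₀ E₁ E₂ e e' p s ⟨c, hE⟩ he ⟨m, pre, post, x, y, v, k, rfl, hk, hy⟩
    obtain ⟨c₀, m', hE₀, hmem, hpre, hr⟩ := hE.split rfl
    obtain ⟨H, a, hI, hH⟩ := exists_inv hA hN hE₀
    dsimp only at hmem hpre hr
    subst hmem
    obtain ⟨f, d, rfl, rfl, hw⟩ := sinstr_eq_cas_cell hk
    obtain ⟨s₁, hs₁, hs₂⟩ := Option.map_eq_some_iff.1 (congrArg Prod.snd hw).symm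
    simp only [Prod.mk.injEq, true_and] at hs₂
    subst hs₂
    have ho := hI.own p
    rw [← hpre] at ho
    obtain ⟨hf, hready, -⟩ := ho.ctrl
    obtain ⟨i, L, j, hst, rfl⟩ := Frame.casSeq_eq_some hs₁
    obtain ⟨x, hx⟩ := (hH p (f.seq + j)).1 ⟨e, by simp, he⟩
    have h₁ := ho.seqOk.lt x _ hx
    -- A process about to swap stands at its permanent position, so the number it would write
    -- exceeds all that it has written before.
    have h₂ := (hI.exec.tentative p).of_lag (.inl (hready.cur_eq.trans hst))
    rw [hf.seq_exec hst] at h₁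
    omega

/-! ### Position of the capsule boundaries. -/

theorem sinstr_eq_write_ptr {p : Fin n} {t s' : N.SState n} {v : Bool}
    (h : N.sinstr p t = .write (.ptr p) v s') : ∃ f u, t = .commit f ∧ N.instr f.st = .loc u := by
  revert h
  cases t with
  | run f =>
    simp only [sinstr]
    split
    · simp
    · simp
    · simp
    · split
      · simp [recover]
      · simp [rcas]
    · split <;> simp
  | commit f =>
    simp only [sinstr]
    split
    · rename_i t ht
      exact fun _ => ⟨f, t, rfl, ht⟩
    · simp
  | announce f d y =>
    simp only [sinstr]
    split <;> simp
  | reload b seq i len L =>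
    simp only [sinstr]
    split_ifs <;> simp
  | _ => simp [sinstr, rcas]

theorem isBoundary_iff {e : (N.simulator n).toProgram.Step} :
    (N.simulator n).IsBoundary e ↔ ∃ f t, e.pre = .commit f ∧ N.instr f.st = .loc t := by
  obtain ⟨p, m, pre, post⟩ := e
  constructor
  · rintro ⟨v, s', h⟩
    exact sinstr_eq_write_ptr h
  · rintro ⟨f, t, rfl, ht⟩
    refine ⟨!f.valid, .run { f.goto t with valid := !f.valid }, ?_⟩
    change N.sinstr p (.commit f) = _
    simp only [sinstr, ht]
    rfl

theorem Frame.boundary_isSome_iff {f : N.Frame} :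
    f.boundary.isSome ↔ (N.event f.st).isSome ∨ N.BeforeExecutor f.st := by
  cases hst : f.st with
  | gen i s L =>
    cases hs : N.gen.next s <;>
      simp [Frame.boundary, hst, hs, event, BeforeExecutor, instr]
  | exec i L j =>
    rcases hL : L[j]? with _ | d <;>
      simp [Frame.boundary, hst, hL, event, BeforeExecutor, instr, callWrap]
  | wrap i L j s =>
    rcases hs : N.wrap.next s with _ | _ | _ | d | (_ | o)
    case emit => exact d.elim
    all_goals simp [Frame.boundary, hst, hs, event, BeforeExecutor, instr, callGen]
  | _ => simp [Frame.boundary, hst, event, BeforeExecutor, instr, callGen]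

theorem boundary_only (hA : N.ABAFree n) (hN : N.ExpectsHeld n)
    {E : List (N.simulator n).PStep} (hE : (N.simulator n).IsPExec E)
    {e : (N.simulator n).toProgram.Step} (he : .step e ∈ E) (hb : (N.simulator n).IsBoundary e) :
    (N.event ((N.impl n).orig e.pre)).isSome ∨ N.BeforeExecutor ((N.impl n).orig e.pre) := by
  obtain ⟨E₀, E₁, rfl⟩ := List.append_of_mem he
  obtain ⟨c, hE⟩ := hE
  obtain ⟨c₀, m', hE₀, -, hpre, -⟩ := hE.split rfl
  obtain ⟨H, a, hI, -⟩ := exists_inv hA hN hE₀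
  obtain ⟨f, t, hf, -⟩ := isBoundary_iff.1 hb
  have ho := (hI.own e.proc).ctrl
  rw [← hpre, hf] at ho
  rw [hf]
  exact Frame.boundary_isSome_iff.1 (by rw [ho.2.2]; rfl)

end

end NormalizedAlgorithm

end PersistentNormalized

namespace PersistentNormalized

/-! ## Positions in executions -/

/-- Replaces the sets of positions in the definition of `index` by counts over prefixes, which are
additive under concatenation. -/
theorem ncard_lt_eq_countP {α : Type*} (l : List α) (P : α → Prop) [DecidablePred P] (k : ℕ) :
    {u : Fin l.length | u.val < k ∧ P l[u]}.ncard = (l.take k).countP fun e => decide (P e) := by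
  induction k with
  | zero => simp
  | succ k ih =>
    by_cases hk : k < l.length
    · rw [List.take_succ_eq_append_getElem hk, List.countP_append, ← ih]
      by_cases hP : P l[k]
      · have : {u : Fin l.length | u.val < k + 1 ∧ P l[u]} =
            insert ⟨k, hk⟩ {u : Fin l.length | u.val < k ∧ P l[u]} := by
          ext u
          simp only [Set.mem_ofPred_eq, Set.mem_insert_iff, Fin.ext_iff]
          constructor
          · rintro ⟨h₁, h₂⟩
            rcases Nat.lt_succ_iff_lt_or_eq.1 h₁ with h | h
            exacts [.inr ⟨h, h₂⟩, .inl h]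
          · rintro (h | ⟨h₁, h₂⟩)
            · refine ⟨by omega, ?_⟩
              have : u = ⟨k, hk⟩ := Fin.ext h
              subst this
              exact hP
            · exact ⟨by omega, h₂⟩
        rw [this, Set.ncard_insert_of_notMem (by simp) (Set.toFinite _)]
        simp [hP]
      · have : {u : Fin l.length | u.val < k + 1 ∧ P l[u]} =
            {u : Fin l.length | u.val < k ∧ P l[u]} := by
          ext u
          simp only [Set.mem_ofPred_eq]
          refine ⟨fun ⟨h₁, h₂⟩ => ⟨?_, h₂⟩, fun ⟨h₁, h₂⟩ => ⟨by omega, h₂⟩⟩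
          rcases Nat.lt_succ_iff_lt_or_eq.1 h₁ with h | h
          · exact h
          · have : u = ⟨k, hk⟩ := Fin.ext h
            subst this
            exact (hP h₂).elim
        rw [this]
        simp [hP]
    · have h₁ : l.take (k + 1) = l.take k := by
        rw [List.take_of_length_le (by omega), List.take_of_length_le (by omega)]
      rw [h₁, ← ih]
      congr 1
      ext u
      have := u.2
      simp only [Set.mem_ofPred_eq]
      constructor <;> rintro ⟨-, h⟩ <;> exact ⟨by omega, h⟩

theorem countP_take_le {α : Type*} (l : List α) (P : α → Bool) {j k : ℕ} (h : j ≤ k) :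
    (l.take j).countP P ≤ (l.take k).countP P :=
  (List.take_prefix_take_left h).sublist.countP_le

theorem countP_take_lt {α : Type*} (l : List α) (P : α → Bool) {j i k : ℕ} (h : j ≤ i) (hk : i < k)
    (hi : i < l.length) (hP : P l[i] = true) : (l.take j).countP P < (l.take k).countP P := by
  refine lt_of_lt_of_le ?_ (countP_take_le l P hk)
  rw [List.take_succ_eq_append_getElem hi, List.countP_append]
  have := countP_take_le l P h
  simp only [List.countP_singleton, hP, if_true]
  omega

theorem exists_of_countP_take_lt {α : Type*} (l : List α) (P : α → Bool) {j k : ℕ}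
    (h : (l.take j).countP P < (l.take k).countP P) :
    ∃ i, ∃ hi : i < l.length, j ≤ i ∧ i < k ∧ P l[i] = true := by
  by_contra hn
  push Not at hn
  induction k with
  | zero => simp at h
  | succ k ih =>
    by_cases hj : j ≤ k
    · have hk : (l.take (k + 1)).countP P = (l.take k).countP P := by
        by_cases hk : k < l.length
        · rw [List.take_succ_eq_append_getElem hk, List.countP_append]
          simp [hn k hk hj (Nat.lt_succ_self k)]
        · rw [List.take_of_length_le (by omega), List.take_of_length_le (by omega)]
      rw [hk] at h
      exact ih h fun i hi hji hik => hn i hi hji (by omega)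
    · have := countP_take_le l P (show k + 1 ≤ j by omega)
      omega

theorem filterMap_position {α β : Type*} (l : List α) (f : α → Option β) {j : ℕ}
    (hj : j < (l.filterMap f).length) :
    ∃ i, ∃ hi : i < l.length, f l[i] = some (l.filterMap f)[j] ∧
      j = ((l.take i).filterMap f).length := by
  induction l generalizing j with
  | nil => simp at hj
  | cons a l ih =>
    cases hfa : f a with
    | none =>
      have hc : (a :: l).filterMap f = l.filterMap f := List.filterMap_cons_none hfa
      obtain ⟨i, hi, h₁, h₂⟩ := ih (j := j) (by rwa [hc] at hj)
      refine ⟨i + 1, by simpa using hi, ?_, ?_⟩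
      · simpa only [List.getElem_cons_succ, hc] using h₁
      · rw [List.take_succ_cons, List.filterMap_cons_none hfa]
        exact h₂
    | some b =>
      have hc : (a :: l).filterMap f = b :: l.filterMap f := List.filterMap_cons_some hfa
      cases j with
      | zero =>
        refine ⟨0, by simp, ?_, by simp⟩
        simp only [List.getElem_cons_zero, hc, hfa]
      | succ j =>
        obtain ⟨i, hi, h₁, h₂⟩ := ih (j := j) (by rw [hc] at hj; simpa using hj)
        refine ⟨i + 1, by simpa using hi, ?_, ?_⟩
        · simpa only [List.getElem_cons_succ, hc] using h₁
        · rw [List.take_succ_cons, List.filterMap_cons_some hfa, List.length_cons, ← h₂]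

theorem filterMap_take {α β : Type*} (l : List α) (f : α → Option β) {i : ℕ} (hi : i < l.length)
    {b : β} (hb : f l[i] = some b) (k : ℕ) (hk : i < k) :
    ∃ R, (l.take k).filterMap f = (l.take i).filterMap f ++ b :: R := by
  have h₁ : l.take k = l.take i ++ l[i] :: (l.take k).drop (i + 1) := by
    have h₂ : i < (l.take k).length := by simp; omega
    conv_lhs => rw [← List.take_append_drop i (l.take k), List.drop_eq_getElem_cons h₂]
    rw [List.take_take, min_eq_left hk.le]
    simp
  refine ⟨((l.take k).drop (i + 1)).filterMap f, ?_⟩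
  conv_lhs => rw [h₁]
  rw [List.filterMap_append, List.filterMap_cons_some hb]

namespace Implementation

variable {n : ℕ} {In Out : Type} {A B : Program n In Out}

open Classical in
/-- The number of instructions that process `p` has completed. -/
noncomputable def completed (I : Implementation A B) (E : List A.Step) (p : Fin n) : ℕ :=
  E.countP fun e => decide (e.proc = p ∧ e.post ∈ I.start)

theorem index_eq (I : Implementation A B) (E : List A.Step) (t : Fin E.length) :
    I.index E t = I.completed (E.take t) E[t].proc := by
  classical
  unfold completed
  rw [← ncard_lt_eq_countP E (fun e => e.proc = E[t].proc ∧ e.post ∈ I.start)]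
  rfl

theorem index_lt (I : Implementation A B) {E : List A.Step} {u w v : Fin E.length} (huw : u ≤ w)
    (hwv : w < v) (hu : E[u].proc = E[w].proc) (hv : E[v].proc = E[w].proc)
    (hw : I.Completes E w) : I.index E u < I.index E v := by
  classical
  rw [index_eq, index_eq, hu, hv]
  exact countP_take_lt _ _ huw hwv w.2 (by rw [decide_eq_true_eq]; exact ⟨rfl, hw⟩)

theorem completed_take_le (I : Implementation A B) (E : List A.Step) (p : Fin n) {j k : ℕ}
    (h : j ≤ k) : I.completed (E.take j) p ≤ I.completed (E.take k) p :=
  countP_take_le _ _ h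

/-- Without a completion in between, two steps belong to the same instruction. -/
theorem completed_take_eq (I : Implementation A B) (E : List A.Step) (p : Fin n) {j k : ℕ}
    (hjk : j ≤ k) (h : ∀ v : Fin E.length, j ≤ v → v < k → E[v].proc = p → ¬ I.Completes E v) :
    I.completed (E.take j) p = I.completed (E.take k) p := by
  classical
  refine (I.completed_take_le E p hjk).antisymm (not_lt.1 fun hlt => ?_)
  obtain ⟨i, hi, h₁, h₂, h₃⟩ := exists_of_countP_take_lt _ _ hlt
  simp only [decide_eq_true_eq] at h₃
  exact h ⟨i, hi⟩ h₁ h₂ h₃.1 h₃.2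

theorem sameInstr_of_forall (I : Implementation A B) {E : List A.Step} {u v : Fin E.length}
    (huv : u ≤ v) (hp : E[u].proc = E[v].proc)
    (h : ∀ w : Fin E.length, u ≤ w → w < v → E[w].proc = E[u].proc → ¬ I.Completes E w) :
    I.SameInstr E u v := by
  refine ⟨hp, ?_⟩
  rw [index_eq, index_eq, ← hp]
  exact I.completed_take_eq E _ huv h

theorem Corr.sameInstr {I : Implementation A B} {E : List A.Step} {E' : List B.Step}
    {u v : Fin E.length} {t' : Fin E'.length} (hu : I.Corr E E' u t') (hv : I.Corr E E' v t') :
    I.SameInstr E u v :=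
  ⟨hu.1.trans hv.1.symm, hu.2.trans hv.2.symm⟩

theorem Corr.of_sameInstr {I : Implementation A B} {E : List A.Step} {E' : List B.Step}
    {u v : Fin E.length} {t' : Fin E'.length} (hv : I.Corr E E' v t') (h : I.SameInstr E u v) :
    I.Corr E E' u t' :=
  ⟨h.1.trans hv.1, h.2.trans hv.2⟩

/-! ### Linearization at the completing steps -/

open Classical in
/-- The instruction that a step completes, executed in the memory given by `μ`. -/
noncomputable def complete? (I : Implementation A B) (μ : (∀ x, A.Val x) → ∀ x, B.Val x)
    (e : A.Step) : Option B.Step :=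
  if e.post ∈ I.start then some ⟨e.proc, μ e.mem, I.orig e.pre, I.orig e.post⟩ else none

/-- Each instruction is taken to act at its last step, so an instruction that ends before another
one begins automatically precedes it. -/
noncomputable def lin (I : Implementation A B) (μ : (∀ x, A.Val x) → ∀ x, B.Val x)
    (E : List A.Step) : List B.Step :=
  E.filterMap (I.complete? μ)

variable (I : Implementation A B) (μ : (∀ x, A.Val x) → ∀ x, B.Val x)

theorem complete?_eq {e : A.Step} (h : e.post ∈ I.start) :
    I.complete? μ e = some ⟨e.proc, μ e.mem, I.orig e.pre, I.orig e.post⟩ := if_pos h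

theorem complete?_eq_some {e : A.Step} {e' : B.Step} (h : I.complete? μ e = some e') :
    e.post ∈ I.start ∧ e' = ⟨e.proc, μ e.mem, I.orig e.pre, I.orig e.post⟩ := by
  unfold complete? at h
  split_ifs at h with h'
  exact ⟨h', (Option.some.inj h).symm⟩

theorem lin_concat_of_mem (E : List A.Step) {e : A.Step} (h : e.post ∈ I.start) :
    I.lin μ (E ++ [e]) = I.lin μ E ++ [⟨e.proc, μ e.mem, I.orig e.pre, I.orig e.post⟩] := by
  unfold lin
  rw [List.filterMap_append, List.filterMap_cons_some (I.complete?_eq μ h), List.filterMap_nil]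

theorem lin_concat_of_notMem (E : List A.Step) {e : A.Step} (h : e.post ∉ I.start) :
    I.lin μ (E ++ [e]) = I.lin μ E := by
  unfold lin
  rw [List.filterMap_append, List.filterMap_cons_none (by simp [complete?, h]), List.filterMap_nil,
    List.append_nil]

/-- Every completion becomes exactly one step, so instructions carry the same numbers in both
executions. -/
theorem completed_lin (E : List A.Step) (p : Fin n) :
    (refl B).completed (I.lin μ E) p = I.completed E p := by
  classical
  induction E with
  | nil => rfl
  | cons e E ih =>
    unfold completed lin at *
    by_cases h : e.post ∈ I.start
    · rw [List.filterMap_cons_some (I.complete?_eq μ h), List.countP_cons, List.countP_cons, ih]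
      simp [refl, h]
    · rw [List.filterMap_cons_none (by simp [complete?, h]), List.countP_cons, ih]
      simp [h]

theorem completed_append (E F : List A.Step) (p : Fin n) :
    I.completed (E ++ F) p = I.completed E p + I.completed F p := List.countP_append

section

variable {E : List A.Step} {m : ℕ} {R : List B.Step}

/-- The step of the linearization that corresponds to a completing step. -/
theorem exists_lin_position {s : Fin E.length} (hs : I.Completes E s) (hm : s.val < m) :
    ∃ s' : Fin (I.lin μ (E.take m) ++ R).length, s'.val = (I.lin μ (E.take s)).length ∧
      s'.val < (I.lin μ (E.take m)).length ∧
      (I.lin μ (E.take m) ++ R)[s'] = ⟨E[s].proc, μ E[s].mem, I.orig E[s].pre, I.orig E[s].post⟩ ∧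
      I.Corr E (I.lin μ (E.take m) ++ R) s s' := by
  obtain ⟨R', hR'⟩ := filterMap_take E (I.complete? μ) s.2 (I.complete?_eq μ hs) m hm
  change I.lin μ (E.take m) = I.lin μ (E.take s) ++ _ at hR'
  have hlt : (I.lin μ (E.take s)).length < (I.lin μ (E.take m)).length := by
    rw [hR']
    simp
  have hget : ∀ h, (I.lin μ (E.take m) ++ R)[(I.lin μ (E.take s)).length]'h =
      ⟨E[s].proc, μ E[s].mem, I.orig E[s].pre, I.orig E[s].post⟩ := by
    intro h
    simp [hR']
  have htake : (I.lin μ (E.take m) ++ R).take (I.lin μ (E.take s)).length =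
      I.lin μ (E.take s) := by
    simp [hR']
  refine ⟨⟨(I.lin μ (E.take s)).length, by rw [List.length_append]; omega⟩, rfl, hlt, hget _, ?_⟩
  have hp : E[s].proc = ((I.lin μ (E.take m) ++ R)[(I.lin μ (E.take s)).length]'(by
      rw [List.length_append]; omega)).proc := by
    rw [hget]
  refine ⟨hp, ?_⟩
  rw [index_eq, index_eq]
  change _ = (refl B).completed ((I.lin μ (E.take m) ++ R).take (I.lin μ (E.take s)).length)
    ((I.lin μ (E.take m) ++ R)[(I.lin μ (E.take s)).length]'_).proc
  rw [htake, completed_lin, ← hp]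

/-- Every step of the linearization corresponds to a completing step. -/
theorem exists_of_lin_position {t' : Fin (I.lin μ (E.take m) ++ R).length}
    (ht' : t'.val < (I.lin μ (E.take m)).length) :
    ∃ t : Fin E.length, t.val < m ∧ I.Completes E t ∧ t'.val = (I.lin μ (E.take t)).length ∧
      (I.lin μ (E.take m) ++ R)[t'] =
        ⟨E[t].proc, μ E[t].mem, I.orig E[t].pre, I.orig E[t].post⟩ ∧
      I.Corr E (I.lin μ (E.take m) ++ R) t t' := by
  obtain ⟨i, hi, h₁, h₂⟩ := filterMap_position (E.take m) (I.complete? μ) ht'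
  obtain ⟨h₃, -⟩ := I.complete?_eq_some μ h₁
  have hi' : i < m ∧ i < E.length := by simpa using hi
  rw [List.getElem_take] at h₃
  rw [List.take_take, min_eq_left hi'.1.le] at h₂
  obtain ⟨s', h₄, h₅, h₆, h₇⟩ := I.exists_lin_position μ (R := R) (s := ⟨i, hi'.2⟩) h₃ hi'.1
  obtain rfl : s' = t' := Fin.ext (h₄.trans h₂.symm)
  exact ⟨⟨i, hi'.2⟩, hi'.1, h₃, h₂, h₆, h₇⟩

theorem length_lin_le {j k : ℕ} (h : j ≤ k) :
    (I.lin μ (E.take j)).length ≤ (I.lin μ (E.take k)).length :=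
  ((List.take_prefix_take_left h).filterMap _).length_le

theorem length_lin_lt {s : Fin E.length} (hs : I.Completes E s) {k : ℕ} (h : s.val < k) :
    (I.lin μ (E.take s)).length < (I.lin μ (E.take k)).length := by
  obtain ⟨s', h₁, h₂, -⟩ := I.exists_lin_position μ (R := []) hs h
  omega

/-- A linearization of the completed instructions of a prefix, followed by instructions, of different processes,
that have begun by then, is an execution to which the whole execution maps. -/
theorem mapsTo_lin (hE : B.IsExec (I.lin μ (E.take m) ++ R))
    (hR : ∀ t' : Fin (I.lin μ (E.take m) ++ R).length, (I.lin μ (E.take m)).length ≤ t'.val →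
      ∃ t : Fin E.length, t.val ≤ m ∧ I.Corr E (I.lin μ (E.take m) ++ R) t t' ∧
        I.orig E[t].pre = (I.lin μ (E.take m) ++ R)[t'].pre) :
    I.MapsTo E (I.lin μ (E.take m) ++ R) := by
  refine ⟨hE, fun t' => ?_, fun s t t' hs hst ht => ?_⟩
  · by_cases ht' : t'.val < (I.lin μ (E.take m)).length
    · obtain ⟨t, -, -, -, h₁, h₂⟩ := I.exists_of_lin_position μ ht'
      exact ⟨t, h₂, by rw [h₁]⟩
    · obtain ⟨t, -, h₁, h₂⟩ := hR t' (not_lt.1 ht')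
      exact ⟨t, h₁, h₂⟩
  · by_cases ht' : t'.val < (I.lin μ (E.take m)).length
    · obtain ⟨v, h₁, h₂, h₃, -, h₅⟩ := I.exists_of_lin_position μ ht'
      have hsv : s < v := hst v (h₅.sameInstr ht)
      obtain ⟨s', h₆, h₇, -, h₈⟩ := I.exists_lin_position μ (R := R) (m := m) hs
        (lt_trans hsv h₁)
      refine ⟨s', ?_, h₈⟩
      rw [Fin.lt_def, h₆, h₃]
      exact I.length_lin_lt μ hs hsv
    -- An appended instruction has begun by time `m`, so whatever ended before its beginning is
    -- already in the linearized prefix.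
    · obtain ⟨v, h₁, h₂, -⟩ := hR t' (not_lt.1 ht')
      have hsv : s < v := hst v (h₂.sameInstr ht)
      obtain ⟨s', h₆, h₇, -, h₈⟩ := I.exists_lin_position μ (R := R) (m := m) hs
        (lt_of_lt_of_le hsv h₁)
      exact ⟨s', Fin.lt_def.2 (lt_of_lt_of_le h₇ (not_lt.1 ht')), h₈⟩

/-- Correspondence for the instructions added at the end. -/
theorem corr_append (hR : (R.map Program.Step.proc).Nodup) {i : ℕ} (hi : i < R.length)
    {u : Fin E.length} (hu : E[u].proc = R[i].proc)
    (hidx : I.completed (E.take u) E[u].proc = I.completed (E.take m) E[u].proc) :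
    ∃ t' : Fin (I.lin μ (E.take m) ++ R).length, t'.val = (I.lin μ (E.take m)).length + i ∧
      (I.lin μ (E.take m) ++ R)[t'] = R[i] ∧ I.Corr E (I.lin μ (E.take m) ++ R) u t' := by
  classical
  have hlt : (I.lin μ (E.take m)).length + i < (I.lin μ (E.take m) ++ R).length := by
    rw [List.length_append]
    omega
  have hget : (I.lin μ (E.take m) ++ R)[(I.lin μ (E.take m)).length + i] = R[i] := by simp
  refine ⟨⟨_, hlt⟩, rfl, hget, ?_⟩
  have hp : E[u].proc = ((I.lin μ (E.take m) ++ R)[(I.lin μ (E.take m)).length + i]).proc := by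
    rw [hget, hu]
  refine ⟨hp, ?_⟩
  rw [index_eq, index_eq]
  change _ = (refl B).completed
    ((I.lin μ (E.take m) ++ R).take ((I.lin μ (E.take m)).length + i))
    ((I.lin μ (E.take m) ++ R)[(I.lin μ (E.take m)).length + i]).proc
  rw [← hp, List.take_length_add_append, completed_append, completed_lin, hidx]
  -- The appended instructions belong to different processes, so none of them shifts the number of
  -- another.
  have : (refl B).completed (R.take i) E[u].proc = 0 := by
    unfold completed
    rw [List.countP_eq_zero]
    intro e he
    obtain ⟨j, hj, rfl⟩ := List.getElem_of_mem he
    have hj' : j < i := by simp at hj; omega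
    simp only [List.getElem_take, decide_eq_true_eq, not_and]
    intro hpj
    have := (hR.getElem_inj_iff (i := j) (j := i) (hi := by simp; omega)
      (hj := by simpa using hi)).1 (by simpa [hpj] using hu)
    omega
  omega

end

end Implementation

end PersistentNormalized

namespace PersistentNormalized

namespace NormalizedAlgorithm

variable {Obj Val In Out : Type}

/-! ## Crash-free executions of the simulator -/

section

variable {N : NormalizedAlgorithm Obj Val In Out} {n : ℕ}

/-- Control states that occur without crashes. -/
def SState.Plain : N.SState n → Prop
  | .run f => f.recovering = false
  | .commit f => f.recovering = false
  | .notify f _ _ _ _ => f.recovering = false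
  | .announce f _ _ => f.recovering = false
  | .swap f _ _ => f.recovering = false
  | _ => False

/-- The number of steps after which the control state can be reached from the start of an instruction. -/
def SState.rank : N.SState n → ℕ
  | .commit _ => 1
  | .notify _ _ _ _ _ => 1
  | .announce _ _ _ => 2
  | .swap _ _ _ => 3
  | _ => 0

/-- The longest implementation is that of an executor CAS: read, notification, announcement, swap.
This is where the constant 4 comes from. -/
theorem SState.rank_lt (t : N.SState n) : t.rank < 4 := by
  cases t <;> simp [SState.rank]

/-- The shared memory of the data structure. -/
def values (m : SMem n Obj Val In Out) (x : Obj) : Val := (m (.cell x)).1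

theorem Frame.goto_recovering {f : N.Frame} (hf : f.recovering = false) (t : N.LState) :
    (f.goto t).recovering = false := by
  unfold Frame.goto
  split
  · rfl
  · exact hf

theorem event_eq_none_or (t : N.LState) : N.event t = none ∨ ∃ u, N.instr t = .loc u := by
  cases t with
  | called i => exact .inr ⟨_, rfl⟩
  | resp o => exact .inr ⟨_, rfl⟩
  | _ => exact .inl rfl

theorem Frame.instr_of_boundary {f : N.Frame} (h : f.boundary.isSome) :
    ∃ u, N.instr f.st = .loc u := by
  rcases Frame.boundary_isSome_iff.1 h with h | ⟨i, L, h⟩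
  · rcases event_eq_none_or f.st with h' | h'
    · simp [h'] at h
    · exact h'
  · exact ⟨_, h⟩

variable {m m' : SMem n Obj Val In Out} {H : Obj → Set (Cell n Val)} {p : Fin n}
  {com cur : N.LState} {t s' : N.SState n}

/-- A step that completes an instruction. -/
structure StepCompletes (N : NormalizedAlgorithm Obj Val In Out) {n : ℕ} (p : Fin n)
    (m m' : SMem n Obj Val In Out) (t s' : N.SState n) : Prop where
  start : s' ∈ (N.impl n).start
  run : (N.instr ((N.impl n).orig t)).Run (values m) (values m') ((N.impl n).orig s')
  event : (N.simulator n).event p t = N.event ((N.impl n).orig t)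

/-- A step in the middle of an instruction. -/
structure StepContinues (N : NormalizedAlgorithm Obj Val In Out) {n : ℕ} (p : Fin n)
    (m m' : SMem n Obj Val In Out) (t s' : N.SState n) : Prop where
  start : s' ∉ (N.impl n).start
  orig : (N.impl n).orig s' = (N.impl n).orig t
  values : values m' = values m
  event : (N.simulator n).event p t = none
  rank : t.rank < s'.rank

theorem StepContinues.afterNotify {f : N.Frame} {d : CasDesc Obj Val} {y : Cell n Val}
    (ht : (N.impl n).orig t = f.st) (hv : NormalizedAlgorithm.values m' = NormalizedAlgorithm.values m)
    (he : (N.simulator n).event p t = none)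
    (hr : t.rank < 2) : StepContinues N p m m' t (N.afterNotify f d y) := by
  unfold NormalizedAlgorithm.afterNotify
  split
  · exact ⟨fun ⟨_, h⟩ => by simp at h, ht.symm, hv, he, hr⟩
  · exact ⟨fun ⟨_, h⟩ => by simp at h, ht.symm, hv, he, hr.trans (Nat.lt_succ_self _)⟩

theorem plain_afterNotify {f : N.Frame} (hf : f.recovering = false) (d : CasDesc Obj Val)
    (y : Cell n Val) : (N.afterNotify f d y).Plain := by
  unfold afterNotify
  split <;> exact hf

theorem values_update {x : SObj n Obj} (hx : ∀ y, x ≠ .cell y) (v : SVal n Obj Val In Out x)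
    [DecidableEq (SObj n Obj)] : values (Function.update m x v) = values m := by
  funext y
  simp [values, Function.update_of_ne (hx y).symm]

open Classical in
theorem values_update_cell (x : Obj) (y : Cell n Val) :
    values (Function.update m (SObj.cell x) y) = Function.update (values m) x y.1 := by
  funext z
  by_cases hz : z = x
  · subst hz
    simp [values]
  · simp [values, hz]

theorem step_run_refines (hc : Ctrl m H p com cur t) {f : N.Frame} (ht : t = .run f)
    (hf : f.recovering = false)
    (hr : (N.sinstr p t).Run m m' s') :
    s'.Plain ∧ (StepCompletes N p m m' t s' ∨ StepContinues N p m m' t s') := by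
  classical
  subst ht
  have hev : ∀ {I : Instr Obj (fun _ => Val) In N.LState}, N.instr f.st = I →
      (∀ u, I ≠ .loc u) → N.event f.st = none := by
    rintro I rfl hu
    exact (event_eq_none_or f.st).resolve_right fun ⟨u, h⟩ => hu u h
  have hcomp : ∀ u, (N.instr f.st).Run (values m) (values m') u → N.event f.st = none →
      s' = .run (f.goto u) →
      s'.Plain ∧ (StepCompletes N p m m' (.run f) s' ∨ StepContinues N p m m' (.run f) s') := by
    rintro u h₁ h₂ rfl
    refine ⟨Frame.goto_recovering hf u, .inl ⟨⟨_, rfl⟩, ?_, h₂.symm⟩⟩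
    change (N.instr f.st).Run _ _ (f.goto u).st
    rwa [Frame.goto_st]
  simp only [sinstr] at hr
  cases hi : N.instr f.st with
  | await k =>
    rw [hi] at hr
    cases hr
    exact hcomp _ (by rw [hi]; exact .await _ _ _) (hev hi (by simp)) rfl
  | read x k =>
    rw [hi] at hr
    cases hr
    exact hcomp _ (by rw [hi]; exact .read x k (values m)) (hev hi (by simp)) rfl
  | write x v u => exact (N.instr_ne_write _ _ _ _ hi).elim
  | cas x old new k =>
    simp only [hi, hf, Bool.false_eq_true, if_false, rcas] at hr
    generalize hs : (fun y : Cell n Val => if y.1 = old then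
      match y.2 with
      | some (q, s) => SState.notify f ⟨x, old, new⟩ y q s
      | none => N.afterNotify f ⟨x, old, new⟩ y
      else SState.run (f.afterCas false)) = K at hr
    cases hr
    subst hs
    dsimp only
    split_ifs with hy
    · rcases h₂ : (m (.cell x)).2 with _ | ⟨q, s⟩
      · exact ⟨plain_afterNotify hf _ _, .inr (.afterNotify rfl rfl rfl (by simp [SState.rank]))⟩
      · exact ⟨hf, .inr ⟨fun ⟨_, h⟩ => by simp at h, rfl, rfl, rfl, Nat.zero_lt_one⟩⟩
    -- The first read alone completes a CAS that finds another value.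
    · simp only [hy, if_false, Frame.afterCas_eq hi] at hcomp ⊢
      refine hcomp (k false) ?_ (hev hi (by simp)) rfl
      rw [hi]
      exact .cas_failure (V := fun _ => Val) x old new k (values m) hy
  | loc u =>
    simp only [hi] at hr
    rcases hb : f.boundary with _ | c
    · have hev' : N.event f.st = none := by
        by_contra h
        have := Frame.boundary_isSome_iff.2 (.inl (Option.isSome_iff_ne_none.2 h))
        simp [hb] at this
      rcases he : f.emitted with _ | ⟨s, d⟩
      · simp only [hb, he] at hr
        cases hr
        exact hcomp u (by rw [hi]; exact .loc _ _) hev' rfl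
      · simp only [hb, he] at hr
        cases hr
        exact hcomp u (by rw [values_update (by simp), hi]; exact .loc _ _) hev' rfl
    · simp only [hb] at hr
      cases hr
      exact ⟨hf, .inr ⟨fun ⟨_, h⟩ => by simp at h, rfl, values_update (by simp) _, rfl,
        Nat.zero_lt_one⟩⟩

/-- Notification, announcement and the writing of a context leave the values of the cells alone, so
each instruction has its whole effect in the step that ends it. For a failing swap, injectivity of
`H` turns a different content into a different value. -/
theorem step_refines (hm : MemOk m H) (hc : Ctrl m H p com cur t) (ht : t.Plain)
    (hr : (N.sinstr p t).Run m m' s') :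
    s'.Plain ∧ (StepCompletes N p m m' t s' ∨ StepContinues N p m m' t s') := by
  classical
  cases t with
  | run f => exact step_run_refines hc rfl ht hr
  | commit f =>
    obtain ⟨u, hu⟩ := Frame.instr_of_boundary (f := f) (by rw [hc.2.2]; rfl)
    simp only [sinstr, hu] at hr
    cases hr
    refine ⟨Frame.goto_recovering ht u, .inl ⟨⟨_, rfl⟩, ?_, rfl⟩⟩
    rw [values_update (by simp)]
    change (N.instr f.st).Run _ _ (f.goto u).st
    rw [Frame.goto_st, hu]
    exact .loc _ _
  | notify f d y q s =>
    obtain ⟨b, rfl⟩ := exists_eq_of_run_cas hr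
    refine ⟨plain_afterNotify ht _ _, .inr (.afterNotify rfl ?_ rfl (by simp [SState.rank]))⟩
    simp only [sinstr] at hr
    cases hr
    · exact values_update (by simp) _
    · rfl
  | announce f d y =>
    rcases hs : f.casSeq with _ | s
    · simp only [sinstr, hs] at hr
      cases hr
      exact ⟨ht, .inr ⟨fun ⟨_, h⟩ => by simp at h, rfl, rfl, rfl, by simp [SState.rank]⟩⟩
    · simp only [sinstr, hs] at hr
      cases hr
      exact ⟨ht, .inr ⟨fun ⟨_, h⟩ => by simp at h, rfl, values_update (by simp) _, rfl,
        by simp [SState.rank]⟩⟩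
  | swap f d y =>
    obtain ⟨-, ⟨-, ⟨k, hk⟩, hy, hd, -⟩, -⟩ := hc
    have hev : N.event f.st = none :=
      (event_eq_none_or f.st).resolve_right fun ⟨u, h⟩ => by simp [hk] at h
    simp only [sinstr] at hr
    have hcomp : ∀ b, (N.instr f.st).Run (values m) (values m') (k b) →
        s' = .run (f.afterCas b) → s'.Plain ∧
          (StepCompletes N p m m' (.swap f d y) s' ∨ StepContinues N p m m' (.swap f d y) s') := by
      rintro b h₁ rfl
      rw [Frame.afterCas_eq hk]
      refine ⟨Frame.goto_recovering ht _, .inl ⟨⟨_, rfl⟩, ?_, hev.symm⟩⟩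
      change (N.instr f.st).Run _ _ (f.goto _).st
      rwa [Frame.goto_st]
    cases hr with
    | cas_success _ _ _ _ _ h =>
      refine hcomp true ?_ rfl
      rw [values_update_cell, hk]
      refine .cas_success d.obj d.exp d.new k (values m) ?_
      rw [← hd, ← h]
      rfl
    | cas_failure _ _ _ _ _ h =>
      refine hcomp false ?_ rfl
      rw [hk]
      refine .cas_failure d.obj d.exp d.new k (values m) fun h' => h ?_
      exact hm.inj d.obj (hm.mem d.obj) hy (h'.trans hd.symm)
  | _ => exact ht.elim

/-- The object that a step of the simulator accesses is that of the instruction being simulated. -/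
theorem target_eq (hc : Ctrl m H p com cur t) (ht : t.Plain) {z : SObj n Obj} {x : Obj}
    (hz : (N.sinstr p t).target = some z) (hx : (N.impl n).base z = some x) :
    (N.instr ((N.impl n).orig t)).target = some x := by
  have hcas : ∀ {f : N.Frame} {d : CasDesc Obj Val}, IsCas f d → d.obj = x →
      (N.instr f.st).target = some x := by
    rintro f d ⟨k, hk⟩ rfl
    rw [hk]
    rfl
  cases t with
  | run f =>
    change (N.instr f.st).target = some x
    simp only [sinstr] at hz
    cases hi : N.instr f.st with
    | read y k =>
      simp only [hi, Instr.target, Option.some.injEq] at hz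
      subst hz
      exact hx
    | write y v u => exact (N.instr_ne_write _ _ _ _ hi).elim
    | cas y old new k =>
      have : f.recovering = false := ht
      simp only [hi, this, Instr.target, rcas, Option.some.injEq, Bool.false_eq_true,
        if_false] at hz
      subst hz
      exact hx
    | await k => simp [hi, Instr.target] at hz
    | loc u =>
      simp only [hi] at hz
      rcases hb : f.boundary with _ | c
      · rcases he : f.emitted with _ | ⟨s, d⟩
        · simp [hb, he, Instr.target] at hz
        · simp only [hb, he, Instr.target, Option.some.injEq] at hz
          subst hz
          cases hx
      · simp only [hb, Instr.target, Option.some.injEq] at hz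
        subst hz
        cases hx
  | commit f =>
    simp only [sinstr] at hz
    split at hz
    · simp only [Instr.target, Option.some.injEq] at hz
      subst hz
      cases hx
    · simp [Instr.target] at hz
  | notify f d y q s =>
    obtain rfl : SObj.ann d.obj q = z := Option.some.inj hz
    exact hcas hc.2.2.1 (Option.some.inj hx)
  | announce f d y =>
    refine hcas hc.2.isCas ?_
    simp only [sinstr] at hz
    split at hz
    · obtain rfl : SObj.ann d.obj p = z := Option.some.inj hz
      exact Option.some.inj hx
    · simp [Instr.target] at hz
  | swap f d y =>
    obtain rfl : SObj.cell d.obj = z := Option.some.inj hz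
    exact hcas hc.2.1.isCas (Option.some.inj hx)
  | _ => exact ht.elim

end

end NormalizedAlgorithm

end PersistentNormalized

namespace PersistentNormalized

/-- Double counting: here `S` will be the responses in the simulator, `T` the instructions to which
they belong. -/
theorem ncard_le_mul_ncard {α β : Type*} [Finite α] [Finite β] {S : Set α} {T : Set β} {k : ℕ}
    (R : α → β → Prop) (hS : ∀ a ∈ S, ∃ b ∈ T, R a b) (hR : ∀ b, {a | R a b}.ncard ≤ k) :
    S.ncard ≤ k * T.ncard := by
  classical
  have := Fintype.ofFinite α
  have := Fintype.ofFinite β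
  have hsub : S.toFinset ⊆ T.toFinset.biUnion fun b => {a | R a b}.toFinset := by
    intro a ha
    obtain ⟨b, hb, hab⟩ := hS a (by simpa using ha)
    simp only [Finset.mem_biUnion, Set.mem_toFinset]
    exact ⟨b, hb, hab⟩
  rw [Set.ncard_eq_toFinset_card', Set.ncard_eq_toFinset_card', mul_comm]
  refine (Finset.card_le_card hsub).trans (Finset.card_biUnion_le_card_mul _ _ _ fun b _ => ?_)
  rw [← Set.ncard_eq_toFinset_card']
  exact hR b

namespace Program

variable {n : ℕ} {In Out : Type} {A : Program n In Out}

theorem Exec.take {E : List A.Step} {c : A.Config} (hE : A.Exec E c) (k : ℕ) :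
    ∃ c', A.Exec (E.take k) c' ∧
      ∀ h : k < E.length, E[k].pre = c'.loc E[k].proc ∧ E[k].mem = c'.mem := by
  induction hE with
  | nil => exact ⟨_, by simpa using Exec.nil, fun h => by simp at h⟩
  | @step E c hE p m' s' hr ih =>
    rcases lt_trichotomy k E.length with hk | rfl | hk
    · obtain ⟨c', h₁, h₂⟩ := ih
      refine ⟨c', by rwa [List.take_append_of_le_length hk.le], fun h => ?_⟩
      simp only [List.getElem_append_left hk]
      exact h₂ hk
    · exact ⟨c, by simpa using hE, fun h => by simp⟩
    · refine ⟨⟨Function.update c.loc p s', m'⟩, ?_, fun h => ?_⟩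
      · rw [List.take_of_length_le (by simp; omega)]
        exact .step hE p hr
      · simp at h
        omega

theorem history_concat (E : List A.Step) (e : A.Step) :
    A.history (E ++ [e]) =
      A.history E ++ ((A.event e.proc e.pre).map fun v => (e.proc, v)).toList := by
  unfold history
  rw [List.filterMap_append]
  cases h : A.event e.proc e.pre <;> simp [h]

theorem _root_.PersistentNormalized.Instr.exists_run {Obj In S : Type} {V : Obj → Type}
    {I : Instr Obj V In S} (h : I.target.isSome) (m : ∀ x, V x) : ∃ m' s', I.Run m m' s' := by
  cases I with
  | await k => simp [Instr.target] at h
  | loc s => simp [Instr.target] at h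
  | read x k => exact ⟨_, _, .read x k m⟩
  | write x v s => exact ⟨_, _, .write x v s m⟩
  | cas x old new k =>
    by_cases hx : m x = old
    · exact ⟨_, _, .cas_success x old new k m hx⟩
    · exact ⟨_, _, .cas_failure x old new k m hx⟩

/-- Processes that are about to access base objects can do so one after the other. -/
theorem Exec.append_accesses {qs : List (Fin n)} (hqs : qs.Nodup) {E : List A.Step} {c : A.Config}
    (hE : A.Exec E c) (h : ∀ q ∈ qs, (A.instr q (c.loc q)).target.isSome) :
    ∃ R, A.IsExec (E ++ R) ∧ R.map Step.proc = qs ∧ ∀ e ∈ R, e.pre = c.loc e.proc := by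
  induction qs generalizing E c with
  | nil => exact ⟨[], ⟨c, by simpa using hE⟩, rfl, by simp⟩
  | cons q qs ih =>
    rw [List.nodup_cons] at hqs
    obtain ⟨m', s', hr⟩ := Instr.exists_run (h q (by simp)) c.mem
    have hne : ∀ r ∈ qs, Function.update c.loc q s' r = c.loc r := fun r hmem =>
      Function.update_of_ne (by rintro rfl; exact hqs.1 hmem) _ _
    obtain ⟨R, h₁, h₂, h₃⟩ := ih hqs.2 (.step hE q hr) fun r hmem => by
      change (A.instr r (Function.update c.loc q s' r)).target.isSome
      rw [hne r hmem]
      exact h r (by simp [hmem])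
    refine ⟨⟨q, c.mem, c.loc q, s'⟩ :: R, by simpa using h₁, by simp [h₂], fun e he => ?_⟩
    rcases List.mem_cons.1 he with rfl | he
    · rfl
    · rw [h₃ e he]
      exact hne _ (by rw [← h₂]; exact List.mem_map_of_mem he)

end Program

namespace PersistentProgram

variable {n : ℕ} {In Out : Type} {A : PersistentProgram n In Out}

theorem _root_.PersistentNormalized.Program.Exec.pexec {E : List A.toProgram.Step}
    {c : A.toProgram.Config} (hE : A.toProgram.Exec E c) : A.PExec (E.map .step) c := by
  induction hE with
  | nil => exact .nil
  | step _ p hr ih =>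
    rw [List.map_append]
    exact .step ih p hr

end PersistentProgram

namespace NormalizedAlgorithm

variable {Obj Val In Out : Type}

section

variable {N : NormalizedAlgorithm Obj Val In Out} {n : ℕ}

/-- What is known about the steps of crash-free executions. -/
structure StepOk (e : (N.simulator n).toProgram.Step) : Prop where
  completes_or : (∃ m', StepCompletes N e.proc e.mem m' e.pre e.post) ∨
    ∃ m', StepContinues N e.proc e.mem m' e.pre e.post
  target : ∀ x, ((N.simulator n).toProgram.object e).bind (N.impl n).base = some x →
    (N.instr ((N.impl n).orig e.pre)).target = some x
  commit : (N.event ((N.impl n).orig e.pre)).isSome ∨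
    N.BeforeExecutor ((N.impl n).orig e.pre) → e.post ∈ (N.impl n).start →
    (N.simulator n).IsBoundary e
  boundary : (N.simulator n).IsBoundary e → e.post ∈ (N.impl n).start

/-- An instruction that has a boundary goes through `commit` after its first step, so it can be
completed by the pointer write only. -/
theorem isBoundary_of_start {m m' : SMem n Obj Val In Out} {H : Obj → Set (Cell n Val)} {p : Fin n}
    {com cur : N.LState} {t s' : N.SState n} (hc : Ctrl m H p com cur t) (ht : t.Plain)
    (hr : (N.sinstr p t).Run m m' s')
    (h : (N.event ((N.impl n).orig t)).isSome ∨ N.BeforeExecutor ((N.impl n).orig t))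
    (hs : s' ∈ (N.impl n).start) :
    (N.simulator n).IsBoundary ⟨p, m, t, s'⟩ := by
  classical
  obtain ⟨g, rfl⟩ := hs
  have hcas : ∀ {f : N.Frame} {d : CasDesc Obj Val}, IsCas f d → ¬ f.boundary.isSome := by
    rintro f d ⟨k, hk⟩ hb
    obtain ⟨u, hu⟩ := Frame.instr_of_boundary hb
    simp [hk] at hu
  have hb : ∀ {f : N.Frame}, (N.impl n).orig t = f.st → f.boundary.isSome := by
    intro f hf
    rw [hf] at h
    exact Frame.boundary_isSome_iff.2 h
  cases t with
  | run f =>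
    obtain ⟨u, hu⟩ := Frame.instr_of_boundary (hb (f := f) rfl)
    obtain ⟨c, hc⟩ := Option.isSome_iff_exists.1 (hb (f := f) rfl)
    simp only [sinstr, hu, hc] at hr
    cases hr
  | commit f =>
    obtain ⟨u, hu⟩ := Frame.instr_of_boundary (hb (f := f) rfl)
    exact isBoundary_iff.2 ⟨f, u, rfl, hu⟩
  | notify f d y q s => exact (hcas hc.2.2.1 (hb rfl)).elim
  | announce f d y => exact (hcas hc.2.isCas (hb rfl)).elim
  | swap f d y => exact (hcas hc.2.1.isCas (hb rfl)).elim
  | _ => exact ht.elim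

variable {E : List (N.simulator n).toProgram.Step} {c : (N.simulator n).toProgram.Config}

/-- The shared memory of the data structure, in the memory of the simulator. -/
def memMap (m : ∀ x, (N.simulator n).Val x) : ∀ x, (N.program n).Val x := values m

/-- Completing steps extend the linearization by one step, and all others change neither the
simulated states nor the values. Since a crash-free execution is in particular an execution with
crashes allowed, the invariant is available. -/
theorem exec_plain (hA : N.ABAFree n) (hN : N.ExpectsHeld n)
    (hE : (N.simulator n).toProgram.Exec E c) :
    (∀ p, (c.loc p).Plain) ∧ (∀ e ∈ E, StepOk e) ∧
      (N.program n).Exec ((N.impl n).lin memMap E) ⟨fun p => (N.impl n).orig (c.loc p), memMap c.mem⟩ ∧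
      (N.program n).history ((N.impl n).lin memMap E) = (N.simulator n).toProgram.history E := by
  classical
  induction hE with
  | nil => exact ⟨fun p => rfl, by simp, .nil, rfl⟩
  | @step E c hE p m' s' hr ih =>
    obtain ⟨h₁, h₂, h₃, h₄⟩ := ih
    obtain ⟨H, a, hI, -⟩ := exists_inv hA hN hE.pexec
    have hc := (hI.own p).ctrl
    obtain ⟨hpl, hs⟩ := step_refines hI.ok hc (h₁ p) hr
    refine ⟨fun q => ?_, fun e he => ?_, ?_⟩
    · by_cases hq : q = p
      · subst hq
        simpa using hpl
      · simpa [Function.update_of_ne hq] using h₁ q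
    · rcases List.mem_append.1 he with he | he
      · exact h₂ e he
      · obtain rfl := List.mem_singleton.1 he
        refine ⟨hs.imp (fun h => ⟨_, h⟩) fun h => ⟨_, h⟩, fun x hx => ?_,
          isBoundary_of_start hc (h₁ p) hr, fun hb => ?_⟩
        · obtain ⟨z, hz, hx⟩ := Option.bind_eq_some_iff.1 hx
          exact target_eq hc (h₁ p) hz hx
        · obtain ⟨f, u, hf, hu⟩ := isBoundary_iff.1 hb
          have hr : (N.sinstr p (c.loc p)).Run c.mem m' s' := hr
          change c.loc p = _ at hf
          rw [hf] at hr
          simp only [sinstr, hu] at hr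
          cases hr
          exact ⟨_, rfl⟩
    · have horig : (fun q => (N.impl n).orig (Function.update c.loc p s' q)) =
          Function.update (fun q => (N.impl n).orig (c.loc q)) p ((N.impl n).orig s') :=
        Function.comp_update _ _ _ _
      rw [Program.history_concat, ← h₄]
      rcases hs with ⟨h₅, h₆, h₇⟩ | ⟨h₅, h₆, h₇, h₈, -⟩
      · rw [Implementation.lin_concat_of_mem _ _ _ h₅, Program.history_concat, h₇]
        refine ⟨?_, rfl⟩
        have := Program.Exec.step h₃ p h₆
        rw [← horig] at this
        exact this
      · rw [Implementation.lin_concat_of_notMem _ _ _ h₅, h₈]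
        refine ⟨?_, (List.append_nil _).symm⟩
        rw [h₆, Function.update_eq_self] at horig
        have h₇ : memMap m' = memMap c.mem := h₇
        change (N.program n).Exec _ ⟨_, memMap m'⟩
        rw [h₇]
        have := h₃
        rw [← horig] at this
        exact this

theorem stepOk (hA : N.ABAFree n) (hN : N.ExpectsHeld n)
    (hE : (N.simulator n).toProgram.Exec E c) (u : Fin E.length) : StepOk E[u] :=
  (exec_plain hA hN hE).2.1 _ (List.getElem_mem _)

/-- The steps of a process that complete no instruction belong to the instruction that the process is
executing at the end. -/
theorem progress (hA : N.ABAFree n) (hN : N.ExpectsHeld n)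
    (hE : (N.simulator n).toProgram.Exec E c) {u : ℕ} (hu : u < E.length)
    (h : ∀ w (hw : w < E.length), u ≤ w → E[w].proc = E[u].proc → E[w].post ∉ (N.impl n).start) :
    SState.rank E[u].pre < SState.rank (c.loc E[u].proc) ∧
      (N.impl n).orig (c.loc E[u].proc) = (N.impl n).orig E[u].pre := by
  induction hE with
  | nil => simp at hu
  | @step E c hE p m' s' hr ih =>
    have hok := (exec_plain hA hN (.step hE p hr)).2.1 _
      (List.mem_append_right E (List.mem_singleton_self _))
    have hcont : (p = (E ++ [⟨p, c.mem, c.loc p, s'⟩])[u].proc) →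
        SState.rank (c.loc p) < SState.rank s' ∧
          (N.impl n).orig s' = (N.impl n).orig (c.loc p) := by
      intro hp
      have hns : s' ∉ (N.impl n).start := by
        have := h E.length (by simp) (by simp at hu; omega) (by simpa using hp)
        simpa using this
      rcases hok.completes_or with ⟨_, hs⟩ | ⟨_, hs⟩
      · exact (hns hs.start).elim
      · exact ⟨hs.rank, hs.orig⟩
    by_cases hu' : u < E.length
    · simp only [List.getElem_append_left hu'] at hcont ⊢
      obtain ⟨h₁, h₂⟩ := ih hu' fun w hw huw hp => by
        have := h w (by simp; omega) huw (by simpa [List.getElem_append_left, hu', hw] using hp)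
        simpa [List.getElem_append_left, hw] using this
      by_cases hp : p = E[u].proc
      · obtain ⟨h₃, h₄⟩ := hcont hp
        rw [← hp] at h₁ h₂ ⊢
        rw [Function.update_self]
        exact ⟨h₁.trans h₃, h₄.trans h₂⟩
      · rw [Function.update_of_ne (Ne.symm hp)]
        exact ⟨h₁, h₂⟩
    · obtain rfl : u = E.length := by simp at hu; omega
      simp only [List.getElem_append_right le_rfl, Nat.sub_self, List.getElem_cons_zero] at hcont ⊢
      rw [Function.update_self]
      exact hcont trivial

end

/-! ## Contention delay -/

section

variable {N : NormalizedAlgorithm Obj Val In Out} {n : ℕ}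
  {E : List (N.simulator n).toProgram.Step} {c : (N.simulator n).toProgram.Config}

theorem progress_take (hA : N.ABAFree n) (hN : N.ExpectsHeld n)
    {u : Fin E.length} {k : ℕ} (hu : u.val < k)
    (h : ∀ w : Fin E.length, u ≤ w → w.val < k → E[w].proc = E[u].proc →
      ¬ (N.impl n).Completes E w) {c' : (N.simulator n).toProgram.Config}
    (hc' : (N.simulator n).toProgram.Exec (E.take k) c') :
    SState.rank E[u].pre < SState.rank (c'.loc E[u].proc) ∧
      (N.impl n).orig (c'.loc E[u].proc) = (N.impl n).orig E[u].pre := by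
  have hlt : u.val < (E.take k).length := by simp [hu]
  have := progress hA hN hc' hlt fun w hw huw hp => by
    have hw' : w < k ∧ w < E.length := by simpa using hw
    simp only [List.getElem_take] at hp ⊢
    exact h ⟨w, hw'.2⟩ huw hw'.1 hp
  simp only [List.getElem_take] at this
  exact this

theorem progress_between (hA : N.ABAFree n) (hN : N.ExpectsHeld n)
    (hE : (N.simulator n).toProgram.Exec E c) {u v : Fin E.length} (huv : u < v)
    (hp : E[u].proc = E[v].proc)
    (h : ∀ w : Fin E.length, u ≤ w → w < v → E[w].proc = E[u].proc →
      ¬ (N.impl n).Completes E w) :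
    SState.rank E[u].pre < SState.rank E[v].pre ∧
      (N.impl n).orig E[v].pre = (N.impl n).orig E[u].pre := by
  obtain ⟨c', h₁, h₂⟩ := hE.take v
  have := progress_take hA hN (k := v) huv h h₁
  have hpre : E[v].pre = c'.loc E[v].proc := (h₂ v.2).1
  rwa [hp, ← hpre] at this

theorem not_completes_of_sameInstr {I : Implementation (N.simulator n).toProgram (N.program n)}
    {u v : Fin E.length} (h : I.SameInstr E u v) (w : Fin E.length) (huw : u ≤ w) (hwv : w < v)
    (hp : E[w].proc = E[u].proc) : ¬ I.Completes E w := fun hw =>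
  (I.index_lt huw hwv hp.symm (h.1.symm.trans hp.symm) hw).ne h.2

/-- The rank increases strictly along the steps of one instruction, hence is injective on them. -/
theorem ncard_sameInstr_le (hA : N.ABAFree n) (hN : N.ExpectsHeld n)
    (hE : (N.simulator n).toProgram.Exec E c) (t : Fin E.length) :
    {u : Fin E.length | (N.impl n).SameInstr E u t}.ncard ≤ 4 := by
  have hlt : ∀ u v : Fin E.length, (N.impl n).SameInstr E u t → (N.impl n).SameInstr E v t →
      u < v → SState.rank E[u].pre < SState.rank E[v].pre := by
    intro u v hu hv huv
    have h : (N.impl n).SameInstr E u v := ⟨hu.1.trans hv.1.symm, hu.2.trans hv.2.symm⟩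
    exact (progress_between hA hN hE huv h.1 (not_completes_of_sameInstr h)).1
  have := Set.ncard_le_ncard_of_injOn (t := Set.Iio 4)
    (s := {u : Fin E.length | (N.impl n).SameInstr E u t}) (fun u => SState.rank E[u].pre)
    (fun u _ => SState.rank_lt _) (fun u hu v hv huv => ?_) (Set.finite_Iio 4)
  · simpa [Set.ncard_eq_toFinset_card'] using this
  · rcases lt_trichotomy u v with h | h | h
    · exact ((hlt u v hu hv h).ne huv).elim
    · exact h
    · exact ((hlt v u hv hu h).ne huv.symm).elim

theorem isComputationDelay (hA : N.ABAFree n) (hN : N.ExpectsHeld n) :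
    (N.impl n).IsComputationDelay 4 := by
  constructor
  · rintro E ⟨c, hE⟩ t
    exact ncard_sameInstr_le hA hN hE t
  · rintro E ⟨c, hE⟩
    obtain ⟨-, -, h₁, h₂⟩ := exec_plain hA hN hE
    have hlin : (N.impl n).lin memMap (E.take E.length) ++ [] = (N.impl n).lin memMap E := by
      rw [List.take_length, List.append_nil]
    refine ⟨(N.impl n).lin memMap (E.take E.length) ++ [],
      (N.impl n).mapsTo_lin memMap (by rw [hlin]; exact ⟨_, h₁⟩) fun t' ht' => ?_, by rw [hlin, h₂],
      fun t ht => ?_⟩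
    · have := t'.2
      simp only [List.append_nil] at this
      omega
    · obtain ⟨s', -, -, h₃, h₄⟩ := (N.impl n).exists_lin_position memMap (R := []) ht t.2
      exact ⟨s', h₄, by rw [h₃]⟩

/-- Boundary steps are completing steps, and an instruction is completed only once. -/
theorem boundary_one (hA : N.ABAFree n) (hN : N.ExpectsHeld n)
    (hE : (N.simulator n).toProgram.Exec E c) {t : Fin E.length} (ht : (N.impl n).Completes E t)
    (h : (N.event ((N.impl n).orig E[t].pre)).isSome ∨
      N.BeforeExecutor ((N.impl n).orig E[t].pre)) :
    {u : Fin E.length | (N.impl n).SameInstr E u t ∧ (N.simulator n).IsBoundary E[u]}.ncard = 1 := by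
  rw [Set.ncard_eq_one]
  refine ⟨t, Set.ext fun u => ⟨fun ⟨hu, hb⟩ => ?_, ?_⟩⟩
  · have hcu : (N.impl n).Completes E u := (stepOk hA hN hE u).boundary hb
    rcases lt_trichotomy u t with hut | hut | hut
    · exact (not_completes_of_sameInstr hu u le_rfl hut rfl hcu).elim
    · exact hut
    · exact (not_completes_of_sameInstr ⟨hu.1.symm, hu.2.symm⟩ t le_rfl hut rfl ht).elim
  · rintro rfl
    exact ⟨⟨rfl, rfl⟩, (stepOk hA hN hE u).commit h ht⟩

end

section

variable {N : NormalizedAlgorithm Obj Val In Out} {n : ℕ}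
  {E : List (N.simulator n).toProgram.Step} {c : (N.simulator n).toProgram.Config}

/-- From step `u` on until time `t`, its process is executing an instruction that accesses `x`. -/
structure Pending (E : List (N.simulator n).toProgram.Step) (t : Fin E.length) (x : Obj)
    (u : Fin E.length) : Prop where
  le : u ≤ t
  target : (N.instr ((N.impl n).orig E[u].pre)).target = some x
  not_completes : ∀ w : Fin E.length, u ≤ w → w < t → E[w].proc = E[u].proc →
    ¬ (N.impl n).Completes E w

theorem Pending.orig_eq (hA : N.ABAFree n) (hN : N.ExpectsHeld n)
    {t u : Fin E.length} {x : Obj} (hu : Pending E t x u)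
    {c' : (N.simulator n).toProgram.Config}
    (hc' : (N.simulator n).toProgram.Exec (E.take t) c') (ht : E[t].pre = c'.loc E[t].proc) :
    (N.impl n).orig (c'.loc E[u].proc) = (N.impl n).orig E[u].pre := by
  rcases hu.le.lt_or_eq with h | rfl
  · exact (progress_take hA hN (k := t) h hu.not_completes hc').2
  · rw [ht]

theorem Pending.completed_eq {t u : Fin E.length} {x : Obj} (hu : Pending E t x u) :
    (N.impl n).completed (E.take u) E[u].proc = (N.impl n).completed (E.take t) E[u].proc :=
  (N.impl n).completed_take_eq E _ hu.le hu.not_completes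

/-- An execution of the data structure up to the access of step `t`: the instructions
completed before, then the pending accesses to the same object, and the access of step `t` at last. -/
theorem exists_pending_accesses (hA : N.ABAFree n) (hN : N.ExpectsHeld n)
    (hE : (N.simulator n).toProgram.Exec E c) (t : Fin E.length) {x : Obj}
    (hx : (N.instr ((N.impl n).orig E[t].pre)).target = some x) :
    ∃ R : List (N.program n).Step,
      (N.program n).IsExec ((N.impl n).lin memMap (E.take t) ++ R) ∧
      (R.map Program.Step.proc).Nodup ∧
      (∃ h : R.length - 1 < R.length, R[R.length - 1].proc = E[t].proc) ∧
      (∀ u, Pending E t x u → ∃ i, ∃ h : i < R.length, R[i].proc = E[u].proc) ∧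
      (∀ i (h : i < R.length), ∃ u, Pending E t x u ∧ R[i].proc = E[u].proc) ∧
      ∀ u i (h : i < R.length), Pending E t x u → R[i].proc = E[u].proc →
        R[i].pre = (N.impl n).orig E[u].pre := by
  classical
  obtain ⟨c', hc', hpre⟩ := hE.take t
  have hpre : E[t].pre = c'.loc E[t].proc := (hpre t.2).1
  have htt : Pending E t x t := ⟨le_rfl, hx, fun w h₁ h₂ => (not_lt.2 h₁ h₂).elim⟩
  -- A process has at most one pending instruction, so a set of processes describes the pending
  -- accesses; the process of step `t` is put last.
  let Q : Finset (Fin n) := {q | q ≠ E[t].proc ∧ ∃ u, Pending E t x u ∧ E[u].proc = q}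
  have hmem : ∀ q, q ∈ Q.toList ++ [E[t].proc] ↔ ∃ u, Pending E t x u ∧ E[u].proc = q := by
    intro q
    simp only [List.mem_append, Finset.mem_toList, List.mem_singleton, Q, Finset.mem_filter,
      Finset.mem_univ, true_and]
    constructor
    · rintro (⟨-, h⟩ | rfl)
      · exact h
      · exact ⟨t, htt, rfl⟩
    · intro h
      by_cases hq : q = E[t].proc
      · exact .inr hq
      · exact .inl ⟨hq, h⟩
  have hnd : (Q.toList ++ [E[t].proc]).Nodup := by
    rw [List.nodup_append]
    refine ⟨Finset.nodup_toList _, List.nodup_singleton _, fun a ha b hb => ?_⟩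
    rw [List.mem_singleton.1 hb]
    have := Finset.mem_toList.1 ha
    simp only [Q, Finset.mem_filter] at this
    exact this.2.1
  obtain ⟨-, -, hlin, -⟩ := exec_plain hA hN hc'
  obtain ⟨R, h₁, h₂, h₃⟩ := hlin.append_accesses hnd fun q hq => by
    obtain ⟨u, hu, rfl⟩ := (hmem q).1 hq
    change (N.instr ((N.impl n).orig (c'.loc E[u].proc))).target.isSome
    rw [hu.orig_eq hA hN hc' hpre, hu.target]
    rfl
  have hlen : R.length = Q.toList.length + 1 := by
    rw [← List.length_map (f := Program.Step.proc), h₂, List.length_append]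
    rfl
  have hget : ∀ i (h : i < R.length), R[i].proc = (R.map Program.Step.proc)[i]'(by simpa) := by
    intro i h
    rw [List.getElem_map]
  refine ⟨R, h₁, by rwa [h₂], ⟨by omega, ?_⟩, fun u hu => ?_, fun i hi => ?_,
    fun u i hi hu hp => ?_⟩
  · rw [hget]
    simp only [h₂]
    simp [hlen]
  · have := (hmem E[u].proc).2 ⟨u, hu, rfl⟩
    rw [← h₂] at this
    obtain ⟨i, hi, h⟩ := List.getElem_of_mem this
    rw [List.getElem_map] at h
    exact ⟨i, by simpa using hi, h⟩
  · have : R[i].proc ∈ R.map Program.Step.proc := List.mem_map_of_mem (List.getElem_mem hi)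
    rw [h₂] at this
    obtain ⟨u, hu, h⟩ := (hmem _).1 this
    exact ⟨u, hu, h.symm⟩
  · rw [h₃ _ (List.getElem_mem hi), hp]
    exact hu.orig_eq hA hN hc' hpre

/-- Each response that counts belongs to an instruction accessing `x`, which is either completed
before step `t` or pending then. In the constructed execution both kinds lie between the previous
instruction of the process of `t` and its own access, and each one stands for at most four
responses. -/
theorem contention_le (hA : N.ABAFree n) (hN : N.ExpectsHeld n)
    (hE : (N.simulator n).toProgram.Exec E c) (t : Fin E.length) {x : Obj}
    (hx : (N.instr ((N.impl n).orig E[t].pre)).target = some x) :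
    ∃ E', (N.impl n).MapsTo E E' ∧ ∃ t' : Fin E'.length, (N.impl n).Corr E E' t t' ∧
      (N.impl n).contention E t x ≤
        4 * (Implementation.refl (N.program n)).contention E' t' x := by
  classical
  obtain ⟨R, hexec, hnd, ⟨hlast, hlastp⟩, hR₁, hR₂, hR₃⟩ := exists_pending_accesses hA hN hE t hx
  have htt : Pending E t x t := ⟨le_rfl, hx, fun w h₁ h₂ => (not_lt.2 h₁ h₂).elim⟩
  set F := (N.impl n).lin memMap (E.take t) 
  have hinj : ∀ i j (hi : i < R.length) (hj : j < R.length), R[i].proc = R[j].proc → i = j := by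
    intro i j hi hj h
    exact (hnd.getElem_inj_iff (i := i) (j := j) (hi := by simpa) (hj := by simpa)).1 (by simpa)
  have hlen : ∀ v : Fin (F ++ R).length, F.length ≤ v.val → v.val - F.length < R.length := by
    intro v hv
    have h₁ := v.2
    have h₂ := List.length_append (as := F) (bs := R)
    omega
  obtain ⟨t', ht', htR, htc⟩ := (N.impl n).corr_append memMap hnd hlast hlastp.symm rfl
  change t'.val = F.length + _ at ht'
  refine ⟨F ++ R, (N.impl n).mapsTo_lin memMap hexec fun s' hs' => ?_, t', htc, ?_⟩
  · have hi := hlen s' hs'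
    obtain ⟨u, hu, hp⟩ := hR₂ _ hi
    obtain ⟨u', hu', h₁, h₂⟩ := (N.impl n).corr_append memMap hnd hi hp.symm hu.completed_eq
    obtain rfl : u' = s' := Fin.ext (hu'.trans (Nat.add_sub_cancel' hs'))
    refine ⟨u, hu.le, h₂, ?_⟩
    rw [h₁]
    exact (hR₃ u _ hi hu hp).symm
  have hbefore : ∀ v' : Fin (F ++ R).length, F.length ≤ v'.val → v' < t' →
      (F ++ R)[v'].proc ≠ (F ++ R)[t'].proc := by
    intro v' h₁ h₂ h
    have hi := hlen v' h₁
    have hv : (F ++ R)[v'] = R[v'.val - F.length] := List.getElem_append_right h₁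
    rw [hv, htR] at h
    have := hinj _ _ _ _ h
    have := Fin.lt_def.1 h₂
    omega
  have hobj : ∀ {e : (N.program n).Step} {s : (N.simulator n).State}, e.pre = (N.impl n).orig s →
      (N.instr ((N.impl n).orig s)).target = some x →
      ((N.program n).object e).bind (Implementation.refl (N.program n)).base = some x := by
    intro e s h₁ h₂
    have : (N.program n).object e = some x := by
      unfold Program.object
      rw [h₁]
      exact h₂
    rw [this]
    rfl
  refine ncard_le_mul_ncard (fun u u' => (N.impl n).Corr E (F ++ R) u u') ?_ fun u' => ?_
  · rintro u ⟨hut, hup, hux, huc⟩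
    have hux := (stepOk hA hN hE u).target x hux
    have hlt' : ∀ {u' : Fin (F ++ R).length}, u'.val < F.length → u' < t' := fun h =>
      Fin.lt_def.2 (by omega)
    have hproc : ∀ {u'}, (N.impl n).Corr E (F ++ R) u u' → (F ++ R)[u'].proc ≠ (F ++ R)[t'].proc :=
      fun h h' => hup (h.1.trans (h'.trans htc.1.symm))
    by_cases hw : ∃ w : Fin E.length, u ≤ w ∧ w < t ∧ E[w].proc = E[u].proc ∧
        (N.impl n).Completes E w
    · obtain ⟨w, ⟨huw, hwt, hwp, hwc⟩, hmin⟩ := WellFounded.has_min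
        (wellFounded_lt (α := Fin E.length)) {w | u ≤ w ∧ w < t ∧ E[w].proc = E[u].proc ∧
          (N.impl n).Completes E w} hw
      have hmin : ∀ v : Fin E.length, u ≤ v → v < w → E[v].proc = E[u].proc →
          ¬ (N.impl n).Completes E v := fun v h₁ h₂ h₃ h₄ =>
        hmin v ⟨h₁, h₂.trans hwt, h₃, h₄⟩ h₂
      have horig : (N.impl n).orig E[w].pre = (N.impl n).orig E[u].pre := by
        rcases huw.lt_or_eq with h | rfl
        · exact (progress_between hA hN hE h hwp.symm hmin).2
        · rfl
      obtain ⟨w', h₁, h₂, h₃, h₄⟩ := (N.impl n).exists_lin_position memMap (R := R) hwc hwt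
      have hcorr := h₄.of_sameInstr ((N.impl n).sameInstr_of_forall huw hwp.symm hmin)
      refine ⟨w', ⟨hlt' h₂, hproc hcorr, ?_, fun v' h₅ h₆ h₇ => ?_⟩, hcorr⟩
      · refine hobj (s := E[w].pre) ?_ (horig ▸ hux)
        rw [h₃]
      · by_cases h₈ : v'.val < F.length
        · obtain ⟨v, h₉, h₁₀, h₁₁, -, h₁₂⟩ := (N.impl n).exists_of_lin_position memMap h₈
          -- An instruction of the process of `t` between the two in the linearization would be
          -- completed after `u` and before `t`, against the choice of the window.
          refine (huc v (huw.trans_lt ?_) h₉ (h₁₂.1.trans (h₇.trans htc.1.symm)) h₁₀).elim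
          by_contra h
          have := (N.impl n).length_lin_le memMap (E := E) (Fin.le_def.1 (not_lt.1 h))
          have := Fin.lt_def.1 h₅
          omega
        · exact (hbefore v' (not_lt.1 h₈) h₆ h₇).elim
    · push Not at hw
      have hu : Pending E t x u := ⟨hut.le, hux, hw⟩
      obtain ⟨i, hi, hp⟩ := hR₁ u hu
      obtain ⟨u', hu', h₁, h₂⟩ := (N.impl n).corr_append memMap hnd hi hp.symm hu.completed_eq
      change u'.val = F.length + i at hu'
      -- Pending accesses of other processes come before the last one, which belongs to the process
      -- of `t`.
      have hi' : i ≠ R.length - 1 := by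
        rintro rfl
        exact hup (hp.symm.trans hlastp)
      refine ⟨u', ⟨Fin.lt_def.2 (by omega), hproc h₂, ?_, fun v' h₅ h₆ h₇ => ?_⟩, h₂⟩
      · refine hobj (s := E[u].pre) ?_ hux
        rw [h₁]
        exact hR₃ u i hi hu hp
      · refine (hbefore v' ?_ h₆ h₇).elim
        have := Fin.lt_def.1 h₅
        omega
  · by_cases h : ∃ u, (N.impl n).Corr E (F ++ R) u u'
    · obtain ⟨u, hu⟩ := h
      exact (Set.ncard_le_ncard (fun v hv => hv.sameInstr hu) (Set.toFinite _)).trans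
        (ncard_sameInstr_le hA hN hE u)
    · push Not at h
      have : {v | (N.impl n).Corr E (F ++ R) v u'} = ∅ := Set.eq_empty_of_forall_notMem h
      rw [this]
      simp

theorem isContentionDelay (hA : N.ABAFree n) (hN : N.ExpectsHeld n) :
    (N.impl n).IsContentionDelay 4 := by
  refine ⟨isComputationDelay hA hN, ?_⟩
  rintro E ⟨c, hE⟩ t - x hx C hC
  obtain ⟨E', h₁, t', h₂, h₃⟩ := contention_le hA hN hE t hx
  exact ⟨E', h₁, t', h₂, by omega⟩

end

end NormalizedAlgorithm

end PersistentNormalized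

/-! ### The theorem. -/

theorem mainTheorem6 :
    ∃ k : ℕ, ∀ (n : ℕ) (Obj Val In Out : Type)
      (N : PersistentNormalized.NormalizedAlgorithm Obj Val In Out),
      N.Parallelizable n → N.ABAFree n → N.ExpectsHeld n →
        (N.simulator n).Simulates (N.program n) ∧
        (N.impl n).IsContentionDelay k ∧
        N.BoundariesAtExecutor n ∧
        N.ExecutorRecovers n := by
  refine ⟨4, fun n Obj Val In Out N hP hA hN => ?_⟩
  open PersistentNormalized NormalizedAlgorithm in
  exact ⟨simulates hP hA hN, isContentionDelay hA hN,
    ⟨fun E hE e he hb => boundary_only hA hN hE he hb,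
      fun E ⟨c, hE⟩ t ht h => boundary_one hA hN hE ht h⟩, executorRecovers hA hN⟩
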